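/- Notation. For $n\in\mathbb Z$ put $\langle n\rangle=(1+n^2)^{1/2}$, and for $s\in\mathbb R$ let $\|f\|_{\ell^2_s}=\big(\sum_{n\in\mathbb Z}\langle n\rangle^{2s}|f(n)|^2\big)^{1/2}\in[0,\infty]$. Write $n_{ij\dots}=n_i+n_j+\cdots$, $a\vee b=\max(a,b)$, $a\wedge b=\min(a,b)$, and $\mathbf 1_{P}$ for the indicator of a condition $P$. On $\{(n,n_1,\dots,n_5)\in\mathbb Z^6: n=n_{12345}\}$ let $$\Phi=n|n|-n_1|n_1|-n_3|n_3|-n_5|n_5|,$$ and, for constants $c_1,\dots,c_7\in\mathbb C$, let $$m_1=c_1n_{45}\mathbf 1_{n>0,\,n_{45}<0},\quad m_2=c_2n_{45}\mathbf 1_{n>0,\,n_{45}<0},\quad m_3=c_3n_{45}\Big(2+\frac n{n_{123}}\Big)\mathbf 1_{n<0,\,n_{45}>0},$$ $$m_4=c_4n_{45}\Big(1+\frac n{n_{123}}\Big)\mathbf 1_{n<0,\,n_{45}>0},\quad m_5=c_5\frac{n_{45}n}{n_{123}}\mathbf 1_{n<0,\,n_{45}>0},$$ $$m_6=c_6\frac{n_{23}n_{45}}{n_{2345}}\mathbf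 1_{n_{23}>0,\,n_{45}>0},\quad m_7=c_7\frac{n_{23}n_{45}}{n_{2345}}\mathbf 1_{n_{23}<0,\,n_{45}<0},$$ and $m_i^*(n,n_1,\dots,n_5)=\overline{m_i(-n,-n_1,\dots,-n_5)}$. Let $\eta=2^{-10}$ and define $\mathcal A_1,\mathcal A_2\subset\mathbb Z^5$ by $$\begin{aligned}\mathcal A_1={}&\{n_{15}n_{35}=0\}\cup\{|n_2|\vee|n_4|\ge\eta^2(|n_5|\wedge|n_{12345}|)\}\\ &\cup\{|n_2|\vee|n_4|<\eta^2|n_5|,\ |n_5|<\eta(|n_1|\wedge|n_3|),\ |n_{24}|\ge\eta|n_{13}|\}\\ &\cup\{|n_2|\vee|n_4|<\eta^2|n_5|,\ |n_3|<\eta(|n_1|\wedge|n_5|),\ |n_{24}|\ge\eta|n_{15}|,\ |n_5|\le2|n_1|\},\\ \mathcal A_2={}&\{n_{13}n_{15}=0\}\cup\{|n_2|\vee|n_4|\ge\eta(|n_3|\wedge|n_5|)\}.\end{aligned}$$ With $\mathcal A=\mathcal A_1$ if $1\le i\le5$ and $\mathcal A=\mathcal A_2$ if $i=6,7$, put $$\hat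 m_i=m_i\mathbf 1_{(n_l)\notin\mathcal A\text{ and }|\Phi|>|n_2|^2\vee|n_4|^2},\qquad \hat{\hat m}_i=m_i\mathbf 1_{(n_l)\in\mathcal A\text{ or }|\Phi|\le|n_2|^2\vee|n_4|^2},$$ and define $\hat m_i^*$ from $m_i^*$ by the same cut-off as $\hat m_i$ from $m_i$. For a non-negative kernel $K=K(n,n_1,\dots,n_5)$ and functions $\omega_1,W_2,\omega_3,W_4,\omega_5:\mathbb Z\to[0,\infty)$ let $$\mathcal Q(K)(n)=\sum_{n=n_{12345}}K\,\omega_1(n_1)W_2(n_2)\omega_3(n_3)W_4(n_4)\omega_5(n_5)\in[0,\infty].$$ Proposition. Let $s>1/2$. There exists $\delta>0$, depending only on $s$, such that for all $c_1,\dots,c_7\in\mathbb C$ there is a finite constant $C$, depending only on $s$ and $c_1,\dots,c_7$, such that for all $\omega_1,W_2,\omega_3,W_4,\omega_5:\mathbb Z\to[0,\infty)$ the following hold (in $[0,\infty]$, with $0\cdot\infty=0$). (0) For every $\hat{\hat m}\in\{\hat{\hat m}_i: 1\le i\le7\}$, $$\|\mathcal Q(|\hat{\hat m}|)\|_{\ell^2_s}\le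 C\|\omega_1\|_{\ell^2_s}\|\omega_3\|_{\ell^2_s}\|\omega_5\|_{\ell^2_s}\Big(\|W_2\|_{\ell^2_{s+1}}\|W_4\|_{\ell^2_s}+\|W_2\|_{\ell^2_s}\|W_4\|_{\ell^2_{s+1}}\Big).$$ For every $\hat m\in\{\hat m_i,\hat m_i^*: 1\le i\le7\}$: (1) $$\Big\|\mathcal Q\Big(\frac{|\hat m|}{\langle\Phi\rangle^{1/2}}\Big)\Big\|_{\ell^2_s}\le C\|\omega_1\|_{\ell^2_s}\|W_2\|_{\ell^2_s}\|\omega_3\|_{\ell^2_s}\|W_4\|_{\ell^2_s}\|\omega_5\|_{\ell^2_s};$$ (2) $$\Big\|\mathcal Q\Big(\frac{|\hat m|}{\langle\Phi\rangle}\Big)\Big\|_{\ell^2_s}\le C\|\omega_1\|_{\ell^2_s}\|\omega_3\|_{\ell^2_s}\|\omega_5\|_{\ell^2_s}\Big(\|W_2\|_{\ell^2_{s-1}}\|W_4\|_{\ell^2_s}\wedge\|W_2\|_{\ell^2_s}\|W_4\|_{\ell^2_{s-1}}\Big);$$ (3) $$\Big\|\mathcal Q\Big(\frac{|\hat m|}{\langle\Phi\rangle^{1-\delta}}\Big)\Big\|_{\ell^2_{s-1}}\le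 C\Big(\|\omega_1\|_{\ell^2_{s-1}}\|\omega_3\|_{\ell^2_s}\|\omega_5\|_{\ell^2_s}\wedge\|\omega_1\|_{\ell^2_s}\|\omega_3\|_{\ell^2_{s-1}}\|\omega_5\|_{\ell^2_s}\wedge\|\omega_1\|_{\ell^2_s}\|\omega_3\|_{\ell^2_s}\|\omega_5\|_{\ell^2_{s-1}}\Big)\|W_2\|_{\ell^2_s}\|W_4\|_{\ell^2_s}.$$ -/

import Mathlib

open scoped NNReal ENNReal

namespace MBO

noncomputable section

/-- The Japanese bracket `⟨n⟩ = (1 + n²)^{1/2}`. -/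
def jb (n : ℤ) : ℝ := Real.sqrt (1 + (n : ℝ) ^ 2)

/-- The `ℓ²_s(ℤ)` norm `‖⟨·⟩^s f‖_{ℓ²}` of a non-negative function, as an element of `[0,∞]`. -/
def wnorm (s : ℝ) (f : ℤ → ℝ≥0∞) : ℝ≥0∞ :=
  (∑' n : ℤ, (ENNReal.ofReal (jb n ^ s) * f n) ^ 2) ^ (1 / 2 : ℝ)

/-- The `ℓ²_s(ℤ)` norm of a finite-valued non-negative function. -/
def nrm (s : ℝ) (f : ℤ → ℝ≥0) : ℝ≥0∞ := wnorm s (fun n => (f n : ℝ≥0∞))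

/-- Functions of the frequencies `(n, n₁, n₂, n₃, n₄, n₅)`; only their values on the hyperplane
`n = n₁ + n₂ + n₃ + n₄ + n₅` enter the quintilinear forms. -/
abbrev Multiplier (α : Type) := ℤ → ℤ → ℤ → ℤ → ℤ → ℤ → α

/-- The resonance function `Φ = n|n| - n₁|n₁| - n₃|n₃| - n₅|n₅|`. -/
def Phi (n n₁ n₃ n₅ : ℤ) : ℤ := n * |n| - n₁ * |n₁| - n₃ * |n₃| - n₅ * |n₅|

/-- The threshold `η = 2^{-10}`. -/
def eta : ℝ := 1 / 2 ^ 10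

open Classical in
/-- The multipliers `m₁, …, m₇` with constants `c₁, …, c₇`; the index `i : Fin 7` stands for
`m_{i+1}`. All denominators are nonzero where the indicator is. -/
def m (c : Fin 7 → ℂ) (i : Fin 7) : Multiplier ℂ := fun n n₁ n₂ n₃ n₄ n₅ =>
  match i with
  | 0 => if 0 < n ∧ n₄ + n₅ < 0 then c 0 * (n₄ + n₅) else 0
  | 1 => if 0 < n ∧ n₄ + n₅ < 0 then c 1 * (n₄ + n₅) else 0
  | 2 => if n < 0 ∧ 0 < n₄ + n₅ then c 2 * (n₄ + n₅) * (2 + n / (n₁ + n₂ + n₃)) else 0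
  | 3 => if n < 0 ∧ 0 < n₄ + n₅ then c 3 * (n₄ + n₅) * (1 + n / (n₁ + n₂ + n₃)) else 0
  | 4 => if n < 0 ∧ 0 < n₄ + n₅ then c 4 * ((n₄ + n₅) * n / (n₁ + n₂ + n₃)) else 0
  | 5 => if 0 < n₂ + n₃ ∧ 0 < n₄ + n₅ then
      c 5 * ((n₂ + n₃) * (n₄ + n₅) / (n₂ + n₃ + n₄ + n₅)) else 0
  | 6 => if n₂ + n₃ < 0 ∧ n₄ + n₅ < 0 then
      c 6 * ((n₂ + n₃) * (n₄ + n₅) / (n₂ + n₃ + n₄ + n₅)) else 0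

/-- The multipliers `m_i^*(n, n₁, …, n₅)`, the complex conjugate of `m_i(-n, -n₁, …, -n₅)`. -/
def mStar (c : Fin 7 → ℂ) (i : Fin 7) : Multiplier ℂ := fun n n₁ n₂ n₃ n₄ n₅ =>
  starRingEnd ℂ (m c i (-n) (-n₁) (-n₂) (-n₃) (-n₄) (-n₅))

/-- `(n₁, …, n₅) ∈ 𝒜₁`. -/
def A₁ (n₁ n₂ n₃ n₄ n₅ : ℤ) : Prop :=
  (n₁ + n₅) * (n₃ + n₅) = 0 ∨
  eta ^ 2 * min |(n₅ : ℝ)| |(n₁ + n₂ + n₃ + n₄ + n₅ : ℝ)| ≤ max |(n₂ : ℝ)| |(n₄ : ℝ)| ∨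
  (max |(n₂ : ℝ)| |(n₄ : ℝ)| < eta ^ 2 * |(n₅ : ℝ)| ∧
    |(n₅ : ℝ)| < eta * min |(n₁ : ℝ)| |(n₃ : ℝ)| ∧
    eta * |(n₁ + n₃ : ℝ)| ≤ |(n₂ + n₄ : ℝ)|) ∨
  (max |(n₂ : ℝ)| |(n₄ : ℝ)| < eta ^ 2 * |(n₅ : ℝ)| ∧
    |(n₃ : ℝ)| < eta * min |(n₁ : ℝ)| |(n₅ : ℝ)| ∧
    eta * |(n₁ + n₅ : ℝ)| ≤ |(n₂ + n₄ : ℝ)| ∧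
    |n₅| ≤ 2 * |n₁|)

/-- `(n₁, …, n₅) ∈ 𝒜₂`. -/
def A₂ (n₁ n₂ n₃ n₄ n₅ : ℤ) : Prop :=
  (n₁ + n₃) * (n₁ + n₅) = 0 ∨
  eta * min |(n₃ : ℝ)| |(n₅ : ℝ)| ≤ max |(n₂ : ℝ)| |(n₄ : ℝ)|

/-- The exceptional set attached to `m_i`: `𝒜₁` for `1 ≤ i ≤ 5` and `𝒜₂` for `i = 6, 7`
(here `i` is shifted by one). -/
def excSet (i : Fin 7) (n₁ n₂ n₃ n₄ n₅ : ℤ) : Prop :=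
  if i.val < 5 then A₁ n₁ n₂ n₃ n₄ n₅ else A₂ n₁ n₂ n₃ n₄ n₅

open Classical in
/-- The restriction of a multiplier to `(n_l) ∉ 𝒜` and `|Φ| > |n₂|² ∨ |n₄|²`. -/
def mainPart (i : Fin 7) (M : Multiplier ℂ) : Multiplier ℂ := fun n n₁ n₂ n₃ n₄ n₅ =>
  if ¬ excSet i n₁ n₂ n₃ n₄ n₅ ∧ max (|n₂| ^ 2) (|n₄| ^ 2) < |Phi n n₁ n₃ n₅| then
    M n n₁ n₂ n₃ n₄ n₅ else 0

open Classical in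
/-- The restriction of a multiplier to `(n_l) ∈ 𝒜` or `|Φ| ≤ |n₂|² ∨ |n₄|²`. -/
def harmlessPart (i : Fin 7) (M : Multiplier ℂ) : Multiplier ℂ := fun n n₁ n₂ n₃ n₄ n₅ =>
  if excSet i n₁ n₂ n₃ n₄ n₅ ∨ |Phi n n₁ n₃ n₅| ≤ max (|n₂| ^ 2) (|n₄| ^ 2) then
    M n n₁ n₂ n₃ n₄ n₅ else 0

/-- The multiplier `m̂_i`. -/
def mHat (c : Fin 7 → ℂ) (i : Fin 7) : Multiplier ℂ := mainPart i (m c i)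

/-- The multiplier `m̂_i^*`. -/
def mHatStar (c : Fin 7 → ℂ) (i : Fin 7) : Multiplier ℂ := mainPart i (mStar c i)

/-- The multiplier `m̂̂_i`. -/
def mHatHat (c : Fin 7 → ℂ) (i : Fin 7) : Multiplier ℂ := harmlessPart i (m c i)

/-- The kernel `|M|`. -/
def absKer (M : Multiplier ℂ) : Multiplier ℝ := fun n n₁ n₂ n₃ n₄ n₅ => ‖M n n₁ n₂ n₃ n₄ n₅‖

/-- The kernel `|M| / ⟨Φ⟩^a`. -/
def absKerDiv (M : Multiplier ℂ) (a : ℝ) : Multiplier ℝ := fun n n₁ n₂ n₃ n₄ n₅ =>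
  ‖M n n₁ n₂ n₃ n₄ n₅‖ / jb (Phi n n₁ n₃ n₅) ^ a

/-- The quintilinear form
`∑_{n = n₁+n₂+n₃+n₄+n₅} K(n,n₁,…,n₅) ω₁(n₁) W₂(n₂) ω₃(n₃) W₄(n₄) ω₅(n₅)` with a
non-negative kernel, evaluated on non-negative functions, as a sum in `[0,∞]`. -/
def Q (K : Multiplier ℝ) (ω₁ W₂ ω₃ W₄ ω₅ : ℤ → ℝ≥0) (n : ℤ) : ℝ≥0∞ :=
  ∑' (n₁ : ℤ) (n₂ : ℤ) (n₃ : ℤ) (n₄ : ℤ) (n₅ : ℤ),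
    if n = n₁ + n₂ + n₃ + n₄ + n₅ then
      ENNReal.ofReal (K n n₁ n₂ n₃ n₄ n₅) *
        ((ω₁ n₁ * W₂ n₂ * ω₃ n₃ * W₄ n₄ * ω₅ n₅ : ℝ≥0) : ℝ≥0∞)
    else 0

end

end MBO

open scoped NNReal ENNReal

namespace MBO

noncomputable section

/-! All estimates are weighted bounds for quintilinear forms, and one bounded kernel serves for all
of them. The kernel `symKer` consists of products that place the square summable weight ⟨·⟩^{-1/2-δ}
on four of the six frequencies (Young's inequality and its dual), and of the kernels ⟨n₃₅⟩^{-1-δ}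
and ⟨Φ/(2n₁₅)⟩^{-1-δ} with weights in n₂ and n₄, to which Schur's test applies (`bdd_symKer`). What
remains is pointwise: the multiplier, with weights of regularity 1/2+2δ, must be dominated by
`symKer`. `Main₁`, `Main₃` and `Low` are these dominations for estimates (1), (3) and (0);
`weight_shift` passes to regularity s, and `exists_wnorm_Q_le` passes to norms. Estimate (2) follows
from the domination for (1), since n₂² and n₄² are below |Φ| on the support of m̂.

The multipliers have size |n₄₅| or min(|n₂₃|, |n₄₅|). Let L = max(|n₂|, |n₄|) be small against the
frequencies that control this size. If the signs exclude cancellation in Φ, then |Φ| is at least a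
product of two large frequencies and power counting suffices. In the resonant pattern, up to
reflection and permutation n, n₁, n₃ ≥ 0 ≥ n₅ and |n₃₅| ≤ |n₁₅|, the identity Φ = 2 n₁₅ n₃₅ + n₂₄
(2n − n₂₄) governs everything (`resonance_cases`). Let N be the largest of |n|, |n₁|, |n₃|, |n₅|. If
|n₁₅| ≳ N, then |Φ| ≳ N|n₃₅| unless the n₂₄ term wins, and in that case |n₃₅| ≲ L. If |n₁₅| is small
against N, all four frequencies are comparable and Φ may be small although n₃₅ is large; this is
where the kernel in Φ/(2n₁₅) is needed, which for fixed n₁₅ is affine in the remaining frequencies.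

On the harmless part the gain is 1/L, from the derivative on n₂ or n₄. There the multiplier is O(L),
or two of n₁, n₃, n₅ cancel up to O(L), or the output is O(L), or |Φ| ≤ L² and the resonance
analysis is repeated with L in place of |Φ|^{1/2}. -/

/-! ### Cauchy–Schwarz for iterated sums in [0,∞]. -/

theorem tsum_mul_sq_le {ι : Type*} (f g : ι → ℝ≥0∞) :
    (∑' i, f i * g i) ^ 2 ≤ (∑' i, f i ^ 2) * ∑' i, g i ^ 2 := by
  have h : ∑' i, f i * g i ≤ (∑' i, f i ^ 2) ^ (1 / 2 : ℝ) * (∑' i, g i ^ 2) ^ (1 / 2 : ℝ) := by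
    rw [ENNReal.tsum_eq_iSup_sum]
    refine iSup_le fun s => ?_
    have hpq : Real.HolderConjugate 2 2 := by rw [Real.holderConjugate_iff]; norm_num
    refine (ENNReal.inner_le_Lp_mul_Lq s f g hpq).trans ?_
    simp only [ENNReal.rpow_two]
    gcongr <;> exact ENNReal.sum_le_tsum s
  calc (∑' i, f i * g i) ^ 2
      ≤ ((∑' i, f i ^ 2) ^ (1 / 2 : ℝ) * (∑' i, g i ^ 2) ^ (1 / 2 : ℝ)) ^ 2 := by gcongr
    _ = (∑' i, f i ^ 2) * ∑' i, g i ^ 2 := by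
        rw [mul_pow, ← ENNReal.rpow_two, ← ENNReal.rpow_two, ← ENNReal.rpow_mul,
          ← ENNReal.rpow_mul]
        norm_num

theorem tsum₃_mul_sq_le (f g : ℤ → ℤ → ℤ → ℝ≥0∞) :
    (∑' (a : ℤ) (b : ℤ) (c : ℤ), f a b c * g a b c) ^ 2 ≤
      (∑' (a : ℤ) (b : ℤ) (c : ℤ), f a b c ^ 2) * ∑' (a : ℤ) (b : ℤ) (c : ℤ), g a b c ^ 2 := by
  have h := tsum_mul_sq_le (fun t : ℤ × ℤ × ℤ => f t.1 t.2.1 t.2.2)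
    (fun t : ℤ × ℤ × ℤ => g t.1 t.2.1 t.2.2)
  simpa only [ENNReal.tsum_prod'] using h

theorem tsum₄_mul_sq_le (f g : ℤ → ℤ → ℤ → ℤ → ℝ≥0∞) :
    (∑' (a : ℤ) (b : ℤ) (c : ℤ) (d : ℤ), f a b c d * g a b c d) ^ 2 ≤
      (∑' (a : ℤ) (b : ℤ) (c : ℤ) (d : ℤ), f a b c d ^ 2) *
        ∑' (a : ℤ) (b : ℤ) (c : ℤ) (d : ℤ), g a b c d ^ 2 := by
  have h := tsum_mul_sq_le (fun t : ℤ × ℤ × ℤ × ℤ => f t.1 t.2.1 t.2.2.1 t.2.2.2)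
    (fun t : ℤ × ℤ × ℤ × ℤ => g t.1 t.2.1 t.2.2.1 t.2.2.2)
  simpa only [ENNReal.tsum_prod'] using h

/-! ### Bounded quintilinear forms and their permutations. -/

/-- The squared `ℓ²(ℤ)` norm. -/
def nsq (h : ℤ → ℝ≥0∞) : ℝ≥0∞ := ∑' n, h n ^ 2

theorem tsum_sub_left (f : ℤ → ℝ≥0∞) (a : ℤ) : ∑' n, f (a - n) = ∑' n, f n :=
  (Equiv.subLeft a).tsum_eq f

theorem tsum_sub_right (f : ℤ → ℝ≥0∞) (a : ℤ) : ∑' n, f (n - a) = ∑' n, f n :=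
  (Equiv.subRight a).tsum_eq f

/-- The quintilinear form with kernel `K` on the hyperplane `n = n₁ + ⋯ + n₅`. -/
def quint (K : ℤ → ℤ → ℤ → ℤ → ℤ → ℝ≥0∞) (h₁ h₂ h₃ h₄ h₅ : ℤ → ℝ≥0∞) (n : ℤ) : ℝ≥0∞ :=
  ∑' (n₁ : ℤ) (n₂ : ℤ) (n₃ : ℤ) (n₄ : ℤ) (n₅ : ℤ),
    if n = n₁ + n₂ + n₃ + n₄ + n₅ then
      K n₁ n₂ n₃ n₄ n₅ * (h₁ n₁ * h₂ n₂ * h₃ n₃ * h₄ n₄ * h₅ n₅)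
    else 0

/-- `K` is the kernel of a bounded quintilinear form on `ℓ²(ℤ)`. -/
def Bdd (K : ℤ → ℤ → ℤ → ℤ → ℤ → ℝ≥0∞) : Prop :=
  ∃ C : ℝ≥0, ∀ h₁ h₂ h₃ h₄ h₅ : ℤ → ℝ≥0∞,
    nsq (quint K h₁ h₂ h₃ h₄ h₅) ≤ C * (nsq h₁ * nsq h₂ * nsq h₃ * nsq h₄ * nsq h₅)

theorem quint_eq (K : ℤ → ℤ → ℤ → ℤ → ℤ → ℝ≥0∞) (h₁ h₂ h₃ h₄ h₅ : ℤ → ℝ≥0∞) (n : ℤ) :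
    quint K h₁ h₂ h₃ h₄ h₅ n = ∑' (n₁ : ℤ) (n₂ : ℤ) (n₃ : ℤ) (n₄ : ℤ),
      K n₁ n₂ n₃ n₄ (n - n₁ - n₂ - n₃ - n₄) *
        (h₁ n₁ * h₂ n₂ * h₃ n₃ * h₄ n₄ * h₅ (n - n₁ - n₂ - n₃ - n₄)) := by
  unfold quint
  refine tsum_congr fun n₁ => tsum_congr fun n₂ => tsum_congr fun n₃ => tsum_congr fun n₄ => ?_
  rw [tsum_eq_single (n - n₁ - n₂ - n₃ - n₄)]
  · rw [if_pos (by ring)]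
  · intro b hb
    rw [if_neg]
    rintro rfl
    exact hb (by ring)

theorem Bdd.mono {K K' : ℤ → ℤ → ℤ → ℤ → ℤ → ℝ≥0∞} (hK : Bdd K') (A : ℝ≥0)
    (h : ∀ n₁ n₂ n₃ n₄ n₅, K n₁ n₂ n₃ n₄ n₅ ≤ A * K' n₁ n₂ n₃ n₄ n₅) : Bdd K := by
  obtain ⟨C, hC⟩ := hK
  refine ⟨A ^ 2 * C, fun h₁ h₂ h₃ h₄ h₅ => ?_⟩
  have hle : ∀ n, quint K h₁ h₂ h₃ h₄ h₅ n ≤ A * quint K' h₁ h₂ h₃ h₄ h₅ n := by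
    intro n
    simp only [quint_eq, ← ENNReal.tsum_mul_left, ← mul_assoc]
    gcongr
    exact h _ _ _ _ _
  calc nsq (quint K h₁ h₂ h₃ h₄ h₅)
      ≤ ∑' n, (A * quint K' h₁ h₂ h₃ h₄ h₅ n) ^ 2 := by
        unfold nsq; gcongr; exact hle _
    _ = A ^ 2 * nsq (quint K' h₁ h₂ h₃ h₄ h₅) := by
        simp only [mul_pow, ENNReal.tsum_mul_left, nsq]
    _ ≤ A ^ 2 * (C * (nsq h₁ * nsq h₂ * nsq h₃ * nsq h₄ * nsq h₅)) := by
        gcongr; exact hC _ _ _ _ _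
    _ = _ := by push_cast; ring

theorem add_sq_le_ennreal (x y : ℝ≥0∞) : (x + y) ^ 2 ≤ 2 * (x ^ 2 + y ^ 2) := by
  have h : ∀ a b : ℝ≥0∞, a ≤ b → (a + b) ^ 2 ≤ 4 * b ^ 2 := fun a b hab => by
    calc (a + b) ^ 2 ≤ (b + b) ^ 2 := by gcongr
      _ = 4 * b ^ 2 := by ring
  by_cases hx : x = ⊤
  · simp [hx]
  by_cases hy : y = ⊤
  · simp [hy]
  lift x to ℝ≥0 using hx
  lift y to ℝ≥0 using hy
  exact_mod_cast (by
    rw [← NNReal.coe_le_coe]; push_cast; nlinarith [sq_nonneg ((x : ℝ) - y)] :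
      (x + y) ^ 2 ≤ 2 * (x ^ 2 + y ^ 2))

theorem nsq_add_le (f g : ℤ → ℝ≥0∞) : nsq (fun n => f n + g n) ≤ 2 * (nsq f + nsq g) := by
  unfold nsq
  rw [← ENNReal.tsum_add, ← ENNReal.tsum_mul_left]
  exact ENNReal.tsum_le_tsum fun n => add_sq_le_ennreal _ _

theorem Bdd.add {K K' : ℤ → ℤ → ℤ → ℤ → ℤ → ℝ≥0∞} (hK : Bdd K) (hK' : Bdd K') :
    Bdd (fun n₁ n₂ n₃ n₄ n₅ => K n₁ n₂ n₃ n₄ n₅ + K' n₁ n₂ n₃ n₄ n₅) := by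
  obtain ⟨C, hC⟩ := hK
  obtain ⟨C', hC'⟩ := hK'
  refine ⟨2 * (C + C'), fun h₁ h₂ h₃ h₄ h₅ => ?_⟩
  have h : quint (fun n₁ n₂ n₃ n₄ n₅ => K n₁ n₂ n₃ n₄ n₅ + K' n₁ n₂ n₃ n₄ n₅) h₁ h₂ h₃ h₄ h₅ =
      fun n => quint K h₁ h₂ h₃ h₄ h₅ n + quint K' h₁ h₂ h₃ h₄ h₅ n := by
    funext n
    simp only [quint_eq, ← ENNReal.tsum_add, add_mul]
  rw [h]
  refine (nsq_add_le _ _).trans ?_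
  calc _ ≤ 2 * (C * (nsq h₁ * nsq h₂ * nsq h₃ * nsq h₄ * nsq h₅) +
        C' * (nsq h₁ * nsq h₂ * nsq h₃ * nsq h₄ * nsq h₅)) := by
        gcongr
        · exact hC _ _ _ _ _
        · exact hC' _ _ _ _ _
    _ = _ := by push_cast; ring

theorem Bdd.swap₁₂ {K : ℤ → ℤ → ℤ → ℤ → ℤ → ℝ≥0∞} (hK : Bdd K) :
    Bdd (fun n₁ n₂ n₃ n₄ n₅ => K n₂ n₁ n₃ n₄ n₅) := by
  obtain ⟨C, hC⟩ := hK
  refine ⟨C, fun h₁ h₂ h₃ h₄ h₅ => ?_⟩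
  convert hC h₂ h₁ h₃ h₄ h₅ using 2
  · funext n
    unfold quint
    rw [ENNReal.tsum_comm]
    refine tsum_congr fun n₁ => tsum_congr fun n₂ => tsum_congr fun n₃ => tsum_congr fun n₄ =>
      tsum_congr fun n₅ => ?_
    rw [add_comm n₂ n₁, mul_comm (h₁ n₂)]
  · ring

theorem Bdd.swap₂₃ {K : ℤ → ℤ → ℤ → ℤ → ℤ → ℝ≥0∞} (hK : Bdd K) :
    Bdd (fun n₁ n₂ n₃ n₄ n₅ => K n₁ n₃ n₂ n₄ n₅) := by
  obtain ⟨C, hC⟩ := hK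
  refine ⟨C, fun h₁ h₂ h₃ h₄ h₅ => ?_⟩
  convert hC h₁ h₃ h₂ h₄ h₅ using 2
  · funext n
    unfold quint
    refine tsum_congr fun n₁ => ?_
    rw [ENNReal.tsum_comm]
    refine tsum_congr fun n₂ => tsum_congr fun n₃ => tsum_congr fun n₄ =>
      tsum_congr fun n₅ => ?_
    rw [add_right_comm n₁ n₃ n₂, mul_right_comm (h₁ n₁)]
  · ring

theorem Bdd.swap₃₄ {K : ℤ → ℤ → ℤ → ℤ → ℤ → ℝ≥0∞} (hK : Bdd K) :
    Bdd (fun n₁ n₂ n₃ n₄ n₅ => K n₁ n₂ n₄ n₃ n₅) := by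
  obtain ⟨C, hC⟩ := hK
  refine ⟨C, fun h₁ h₂ h₃ h₄ h₅ => ?_⟩
  convert hC h₁ h₂ h₄ h₃ h₅ using 2
  · funext n
    unfold quint
    refine tsum_congr fun n₁ => tsum_congr fun n₂ => ?_
    rw [ENNReal.tsum_comm]
    refine tsum_congr fun n₃ => tsum_congr fun n₄ => tsum_congr fun n₅ => ?_
    rw [add_right_comm _ n₄ n₃, mul_right_comm _ (h₃ n₄)]
  · ring

theorem Bdd.swap₄₅ {K : ℤ → ℤ → ℤ → ℤ → ℤ → ℝ≥0∞} (hK : Bdd K) :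
    Bdd (fun n₁ n₂ n₃ n₄ n₅ => K n₁ n₂ n₃ n₅ n₄) := by
  obtain ⟨C, hC⟩ := hK
  refine ⟨C, fun h₁ h₂ h₃ h₄ h₅ => ?_⟩
  convert hC h₁ h₂ h₃ h₅ h₄ using 2
  · funext n
    unfold quint
    refine tsum_congr fun n₁ => tsum_congr fun n₂ => tsum_congr fun n₃ => ?_
    rw [ENNReal.tsum_comm]
    refine tsum_congr fun n₄ => tsum_congr fun n₅ => ?_
    rw [add_right_comm _ n₅ n₄, mul_right_comm _ (h₄ n₅)]
  · ring

theorem Bdd.swap₁₃ {K : ℤ → ℤ → ℤ → ℤ → ℤ → ℝ≥0∞} (hK : Bdd K) :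
    Bdd (fun n₁ n₂ n₃ n₄ n₅ => K n₃ n₂ n₁ n₄ n₅) :=
  hK.swap₁₂.swap₂₃.swap₁₂

theorem Bdd.swap₃₅ {K : ℤ → ℤ → ℤ → ℤ → ℤ → ℝ≥0∞} (hK : Bdd K) :
    Bdd (fun n₁ n₂ n₃ n₄ n₅ => K n₁ n₂ n₅ n₄ n₃) :=
  hK.swap₃₄.swap₄₅.swap₃₄

theorem tsum_rotate₄ (f : ℤ → ℤ → ℤ → ℤ → ℝ≥0∞) :
    ∑' (a : ℤ) (b : ℤ) (c : ℤ) (d : ℤ), f a b c d =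
      ∑' (b : ℤ) (c : ℤ) (d : ℤ) (a : ℤ), f a b c d := by
  rw [ENNReal.tsum_comm]
  refine tsum_congr fun b => ?_
  rw [ENNReal.tsum_comm]
  refine tsum_congr fun c => ?_
  rw [ENNReal.tsum_comm]

theorem tsum_rotate₅ (f : ℤ → ℤ → ℤ → ℤ → ℤ → ℝ≥0∞) :
    ∑' (a : ℤ) (b : ℤ) (c : ℤ) (d : ℤ) (e : ℤ), f a b c d e =
      ∑' (b : ℤ) (c : ℤ) (d : ℤ) (e : ℤ) (a : ℤ), f a b c d e := by
  rw [ENNReal.tsum_comm]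
  exact tsum_congr fun b => tsum_rotate₄ _

/-! ### Three criteria for boundedness. -/

/-- Young's inequality: four of the functions are summed absolutely. -/
theorem Bdd.young {w : ℤ → ℝ≥0∞} {S : ℝ≥0} (hw : nsq w ≤ S) :
    Bdd (fun n₁ n₂ n₃ n₄ _ => w n₁ * w n₂ * w n₃ * w n₄) := by
  refine ⟨S * S * S * S, fun h₁ h₂ h₃ h₄ h₅ => ?_⟩
  -- Cauchy–Schwarz with the four weights as one factor. The other factor is summed over n
  -- afterwards, where h₅ is a translate.
  have hF : ∀ n, quint (fun n₁ n₂ n₃ n₄ _ => w n₁ * w n₂ * w n₃ * w n₄) h₁ h₂ h₃ h₄ h₅ n ^ 2 ≤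
      (S * S * S * S) * ∑' (n₁ : ℤ) (n₂ : ℤ) (n₃ : ℤ) (n₄ : ℤ),
        (h₁ n₁ * h₂ n₂ * h₃ n₃ * h₄ n₄ * h₅ (n - n₁ - n₂ - n₃ - n₄)) ^ 2 := by
    intro n
    rw [quint_eq]
    refine (tsum₄_mul_sq_le _ _).trans ?_
    gcongr
    simp only [mul_pow, ENNReal.tsum_mul_left, ENNReal.tsum_mul_right]
    unfold nsq at hw
    gcongr
  refine (ENNReal.tsum_le_tsum hF).trans ?_
  rw [ENNReal.tsum_mul_left]
  push_cast
  gcongr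
  refine le_of_eq ?_
  rw [tsum_rotate₅]
  simp only [mul_pow, ENNReal.tsum_mul_left, ENNReal.tsum_mul_right,
    tsum_sub_right (fun n => h₅ n ^ 2), sub_sub, nsq]

/-- The estimate dual to Young's inequality: two of the functions are paired by Cauchy-Schwarz, the
other three are summed absolutely, and the output is summed with the help of a weight. -/
theorem Bdd.youngDual {w : ℤ → ℝ≥0∞} {S : ℝ≥0} (hw : nsq w ≤ S) :
    Bdd (fun n₁ n₂ n₃ n₄ n₅ => w (n₁ + n₂ + n₃ + n₄ + n₅) * (w n₂ * w n₃ * w n₄)) := by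
  refine ⟨S * S * S * S, fun h₁ h₂ h₃ h₄ h₅ => ?_⟩
  have hF : ∀ n, quint (fun n₁ n₂ n₃ n₄ n₅ => w (n₁ + n₂ + n₃ + n₄ + n₅) * (w n₂ * w n₃ * w n₄))
      h₁ h₂ h₃ h₄ h₅ n ^ 2 ≤
      w n ^ 2 * ((S * S * S) * (nsq h₁ * nsq h₂ * nsq h₃ * nsq h₄ * nsq h₅)) := by
    intro n
    have e : quint (fun n₁ n₂ n₃ n₄ n₅ => w (n₁ + n₂ + n₃ + n₄ + n₅) * (w n₂ * w n₃ * w n₄))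
      h₁ h₂ h₃ h₄ h₅ n = w n * ∑' (n₁ : ℤ) (n₂ : ℤ) (n₃ : ℤ) (n₄ : ℤ),
        (h₁ n₁ * (w n₂ * w n₃ * w n₄)) *
          (h₂ n₂ * h₃ n₃ * h₄ n₄ * h₅ (n - n₁ - n₂ - n₃ - n₄)) := by
      rw [quint_eq]
      simp only [← ENNReal.tsum_mul_left]
      refine tsum_congr fun n₁ => tsum_congr fun n₂ => tsum_congr fun n₃ => tsum_congr fun n₄ => ?_
      rw [show n₁ + n₂ + n₃ + n₄ + (n - n₁ - n₂ - n₃ - n₄) = n by ring]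
      ring
    rw [e, mul_pow]
    gcongr
    -- One factor holds h₁ and three weights, the other h₂, h₃, h₄, h₅; in the latter n₁ occurs only
    -- in h₅, so it is summed first. The weight at the output, already outside, makes the bound
    -- summable in n.
    refine (tsum₄_mul_sq_le _ _).trans ?_
    have h2 : ∑' (n₁ : ℤ) (n₂ : ℤ) (n₃ : ℤ) (n₄ : ℤ),
        (h₂ n₂ * h₃ n₃ * h₄ n₄ * h₅ (n - n₁ - n₂ - n₃ - n₄)) ^ 2 =
        nsq h₂ * nsq h₃ * nsq h₄ * nsq h₅ := by
      rw [tsum_rotate₄]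
      have : ∀ n₁ n₂ n₃ n₄ : ℤ, n - n₁ - n₂ - n₃ - n₄ = (n - n₂ - n₃ - n₄) - n₁ := by
        intros; ring
      simp only [mul_pow, ENNReal.tsum_mul_left, ENNReal.tsum_mul_right, this,
        tsum_sub_left (fun n => h₅ n ^ 2), nsq]
    rw [h2]
    simp only [mul_pow, ENNReal.tsum_mul_left, ENNReal.tsum_mul_right]
    unfold nsq at hw
    calc _ ≤ (∑' i, h₁ i ^ 2) * (S * S * S) * (nsq h₂ * nsq h₃ * nsq h₄ * nsq h₅) := by gcongr
      _ = _ := by simp only [nsq]; ring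
  refine (ENNReal.tsum_le_tsum hF).trans ?_
  rw [ENNReal.tsum_mul_right]
  push_cast
  calc _ ≤ S * ((S * S * S) * (nsq h₁ * nsq h₂ * nsq h₃ * nsq h₄ * nsq h₅)) := by
        unfold nsq at hw; gcongr
    _ = _ := by ring

/-- Schur's test, applied for fixed `n₂`, `n₄` and `n₁ + n₅`. -/
theorem Bdd.schur {w : ℤ → ℝ≥0∞} {S S' : ℝ≥0} (hw : nsq w ≤ S)
    {k : ℤ → ℤ → ℤ → ℤ → ℤ → ℝ≥0∞}
    (hk₁ : ∀ n₂ n₃ n₄ a, ∑' n₁, k n₁ n₂ n₃ n₄ (a - n₁) ≤ S')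
    (hk₃ : ∀ n₁ n₂ n₄ n₅, ∑' n₃, k n₁ n₂ n₃ n₄ n₅ ≤ S') :
    Bdd (fun n₁ n₂ n₃ n₄ n₅ => w n₂ * w n₄ * k n₁ n₂ n₃ n₄ n₅) := by
  refine ⟨S * S * S' * S', fun h₁ h₂ h₃ h₄ h₅ => ?_⟩
  have hF : ∀ n, quint (fun n₁ n₂ n₃ n₄ n₅ => w n₂ * w n₄ * k n₁ n₂ n₃ n₄ n₅)
      h₁ h₂ h₃ h₄ h₅ n ^ 2 ≤
      nsq h₂ * nsq h₃ * nsq h₄ * ∑' (n₂ : ℤ) (n₃ : ℤ) (n₄ : ℤ) (n₁ : ℤ),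
        S' * (w n₂ * w n₄) ^ 2 * (k n₁ n₂ n₃ n₄ (n - n₁ - n₂ - n₃ - n₄) *
          (h₁ n₁ * h₅ (n - n₁ - n₂ - n₃ - n₄)) ^ 2) := by
    intro n
    -- The sum over n₁ is innermost: with n, n₂, n₃, n₄ fixed, n₁ + n₅ is fixed, as `hk₁` requires.
    -- Cauchy–Schwarz in (n₂, n₃, n₄) then removes h₂, h₃, h₄.
    have e : quint (fun n₁ n₂ n₃ n₄ n₅ => w n₂ * w n₄ * k n₁ n₂ n₃ n₄ n₅) h₁ h₂ h₃ h₄ h₅ n =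
        ∑' (n₂ : ℤ) (n₃ : ℤ) (n₄ : ℤ), (h₂ n₂ * h₃ n₃ * h₄ n₄) *
          (w n₂ * w n₄ * ∑' n₁ : ℤ, k n₁ n₂ n₃ n₄ (n - n₁ - n₂ - n₃ - n₄) *
            (h₁ n₁ * h₅ (n - n₁ - n₂ - n₃ - n₄))) := by
      rw [quint_eq, tsum_rotate₄]
      simp only [← ENNReal.tsum_mul_left]
      refine tsum_congr fun n₂ => tsum_congr fun n₃ => tsum_congr fun n₄ => tsum_congr fun n₁ => ?_
      ring
    rw [e]
    refine (tsum₃_mul_sq_le _ _).trans ?_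
    have e₂ : ∑' (n₂ : ℤ) (n₃ : ℤ) (n₄ : ℤ), (h₂ n₂ * h₃ n₃ * h₄ n₄) ^ 2 =
        nsq h₂ * nsq h₃ * nsq h₄ := by
      simp only [mul_pow, ENNReal.tsum_mul_left, ENNReal.tsum_mul_right, nsq]
    rw [e₂]
    gcongr with n₂ n₃ n₄
    rw [ENNReal.tsum_mul_left]
    rw [mul_pow (w n₂ * w n₄), mul_assoc, mul_left_comm]
    gcongr
    -- The Schur splitting κ = κ^{1/2} κ^{1/2}.
    have hcs : ∀ (κ h : ℤ → ℝ≥0∞), (∑' i, κ i * h i) ^ 2 ≤ (∑' i, κ i) * ∑' i, κ i * h i ^ 2 := by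
      intro κ h
      have hsq : ∀ x : ℝ≥0∞, (x ^ (1 / 2 : ℝ)) ^ 2 = x := fun x => by
        rw [← ENNReal.rpow_two, ← ENNReal.rpow_mul]; norm_num
      have := tsum_mul_sq_le (fun i => κ i ^ (1 / 2 : ℝ)) (fun i => κ i ^ (1 / 2 : ℝ) * h i)
      simpa only [mul_pow, hsq, ← mul_assoc, ← pow_two] using this
    refine (hcs _ _).trans ?_
    gcongr
    have hn : ∀ n₁, n - n₁ - n₂ - n₃ - n₄ = n - n₂ - n₃ - n₄ - n₁ := by intro; ring
    simp only [hn]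
    exact hk₁ n₂ n₃ n₄ (n - n₂ - n₃ - n₄)
  refine (ENNReal.tsum_le_tsum hF).trans ?_
  rw [ENNReal.tsum_mul_left]
  have hG : ∑' n : ℤ, ∑' (n₂ : ℤ) (n₃ : ℤ) (n₄ : ℤ) (n₁ : ℤ),
        S' * (w n₂ * w n₄) ^ 2 * (k n₁ n₂ n₃ n₄ (n - n₁ - n₂ - n₃ - n₄) *
          (h₁ n₁ * h₅ (n - n₁ - n₂ - n₃ - n₄)) ^ 2) ≤ S * S * S' * S' * (nsq h₁ * nsq h₅) := by
    rw [tsum_rotate₅]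
    -- The output variable is traded for n₅; then n₃ occurs only in k and is summed innermost, as
    -- `hk₃` requires.
    have e : ∑' (n₂ : ℤ) (n₃ : ℤ) (n₄ : ℤ) (n₁ : ℤ) (n : ℤ),
        S' * (w n₂ * w n₄) ^ 2 * (k n₁ n₂ n₃ n₄ (n - n₁ - n₂ - n₃ - n₄) *
          (h₁ n₁ * h₅ (n - n₁ - n₂ - n₃ - n₄)) ^ 2) =
        ∑' (n₂ : ℤ) (n₄ : ℤ) (n₁ : ℤ) (n : ℤ) (n₃ : ℤ),
        S' * (w n₂ * w n₄) ^ 2 * (h₁ n₁ * h₅ n) ^ 2 * k n₁ n₂ n₃ n₄ n := by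
      refine tsum_congr fun n₂ => ?_
      conv_rhs => rw [← tsum_rotate₄]
      refine tsum_congr fun n₃ => tsum_congr fun n₄ => tsum_congr fun n₁ => ?_
      have h : ∀ n, n - n₁ - n₂ - n₃ - n₄ = n - (n₁ + n₂ + n₃ + n₄) := by intro; ring
      simp only [h]
      rw [tsum_sub_right (fun n => S' * (w n₂ * w n₄) ^ 2 * (k n₁ n₂ n₃ n₄ n *
          (h₁ n₁ * h₅ n) ^ 2))]
      exact tsum_congr fun n => by ring
    rw [e]
    calc _ ≤ ∑' (n₂ : ℤ) (n₄ : ℤ) (n₁ : ℤ) (n : ℤ),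
          S' * (w n₂ * w n₄) ^ 2 * (h₁ n₁ * h₅ n) ^ 2 * S' := by
          simp only [ENNReal.tsum_mul_left]
          gcongr
          exact hk₃ _ _ _ _
      _ = nsq w * nsq w * S' * S' * (nsq h₁ * nsq h₅) := by
          simp only [mul_pow, ENNReal.tsum_mul_left, ENNReal.tsum_mul_right, nsq]
          ring
      _ ≤ _ := by gcongr
  calc _ ≤ nsq h₂ * nsq h₃ * nsq h₄ * (S * S * S' * S' * (nsq h₁ * nsq h₅)) := by gcongr
    _ = _ := by push_cast; ring

/-! ### Brackets and uniform sums of their powers. -/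

/-- The bracket `(1 + y²)^{1/2}` of a real number. -/
def br (y : ℝ) : ℝ := Real.sqrt (1 + y ^ 2)

theorem jb_eq_br (n : ℤ) : jb n = br n := rfl

theorem one_le_br (y : ℝ) : 1 ≤ br y := by
  unfold br; rw [Real.one_le_sqrt]; nlinarith [sq_nonneg y]

theorem br_pos (y : ℝ) : 0 < br y := lt_of_lt_of_le one_pos (one_le_br y)

theorem br_sq (y : ℝ) : br y ^ 2 = 1 + y ^ 2 := Real.sq_sqrt (by positivity)

theorem abs_le_br (y : ℝ) : |y| ≤ br y := by
  apply Real.abs_le_sqrt; linarith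

theorem br_le_one_add_abs (y : ℝ) : br y ≤ 1 + |y| := by
  unfold br
  rw [Real.sqrt_le_left (by positivity)]
  nlinarith [abs_nonneg y, sq_abs y]

theorem br_neg (y : ℝ) : br (-y) = br y := by simp [br]

theorem br_le_mul_of_abs_le {C x y : ℝ} (hC : 1 ≤ C) (h : |x| ≤ C * |y|) : br x ≤ C * br y := by
  have h1 : br x ^ 2 ≤ (C * br y) ^ 2 := by
    rw [mul_pow, br_sq, br_sq, ← sq_abs x, ← sq_abs y]
    nlinarith [abs_nonneg x, abs_nonneg y, mul_self_le_mul_self (abs_nonneg x) h]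
  exact le_of_abs_le (abs_le_of_sq_le_sq h1 (mul_nonneg (by linarith) (br_pos y).le))

theorem br_le_br {x y : ℝ} (h : |x| ≤ |y|) : br x ≤ br y := by
  simpa using br_le_mul_of_abs_le le_rfl (by simpa using h)

theorem br_le_mul_abs {y : ℝ} (h : 1 ≤ |y|) : br y ≤ 2 * |y| := by
  linarith [br_le_one_add_abs y]

theorem summable_jb_rpow {r : ℝ} (hr : 1 < r) : Summable fun n : ℤ => jb n ^ (-r) := by
  have h₁ := (Real.summable_abs_int_rpow hr).add (hasSum_ite_eq (0 : ℤ) (1 : ℝ)).summable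
  refine h₁.of_nonneg_of_le (fun n => Real.rpow_nonneg (br_pos _).le _) fun n => ?_
  by_cases hn : n = 0
  · subst hn
    have : jb 0 = 1 := by simp [jb]
    rw [this, Real.one_rpow]
    simpa using Real.rpow_nonneg le_rfl (-r)
  · rw [if_neg hn, add_zero]
    refine Real.rpow_le_rpow_of_nonpos (by positivity) (abs_le_br _) (by linarith)

/-- The points lk + c are at least 1/2 apart, so after recentring at the integer −round(c/l) the sum
compares with Σ⟨k⟩^{-r}. Uniformity in l and c is what Schur's test needs. -/
theorem exists_tsum_br_le {r : ℝ} (hr : 1 < r) : ∃ S : ℝ≥0, ∀ l c : ℝ, 1 / 2 ≤ |l| →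
    ∑' k : ℤ, ENNReal.ofReal (br (l * k + c) ^ (-r)) ≤ S := by
  have hsum := summable_jb_rpow hr
  refine ⟨Real.toNNReal (4 ^ r * ∑' n : ℤ, jb n ^ (-r)), fun l c hl => ?_⟩
  have hl0 : l ≠ 0 := by rintro rfl; norm_num at hl
  set m : ℤ := round (c / l) with hm
  have hpt : ∀ k : ℤ, br (l * k + c) ^ (-r) ≤ 4 ^ r * jb (k - -m) ^ (-r) := by
    intro k
    have hfr : |c / l - m| ≤ 1 / 2 := abs_sub_round _
    -- Rounding moves k + m by at most 1/2, hence by at most half of |k + m| when this is nonzero: a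
    -- factor 2. The slope |l| ≥ 1/2 costs another 2.
    have hle : br ((k - -m : ℤ) : ℝ) ≤ 4 * br (l * k + c) := by
      have e : l * k + c = l * ((k + m) + (c / l - m)) := by field_simp; ring
      have h1 : |((k - -m : ℤ) : ℝ)| ≤ 4 * |l * k + c| := by
        by_cases h0 : k + m = 0
        · have : ((k - -m : ℤ) : ℝ) = 0 := by exact_mod_cast (by omega : k - -m = 0)
          rw [this, abs_zero]; positivity
        have h1 : (1 : ℝ) ≤ |(k : ℝ) + m| := by exact_mod_cast Int.one_le_abs h0
        have h2 : |(k : ℝ) + m| ≤ 2 * |(k + m) + (c / l - m)| := by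
          have h3 := abs_sub_abs_le_abs_add ((k : ℝ) + m) (c / l - m)
          linarith
        rw [e, abs_mul]
        have : ((k - -m : ℤ) : ℝ) = k + m := by push_cast; ring
        rw [this]
        nlinarith [abs_nonneg (((k : ℝ) + m) + (c / l - m))]
      exact br_le_mul_of_abs_le (by norm_num) h1
    rw [jb_eq_br]
    calc br (l * k + c) ^ (-r) ≤ (br ((k - -m : ℤ) : ℝ) / 4) ^ (-r) :=
          Real.rpow_le_rpow_of_nonpos (div_pos (br_pos _) (by norm_num)) (by linarith)
            (by linarith)
      _ = 4 ^ r * br ((k - -m : ℤ) : ℝ) ^ (-r) := by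
          rw [Real.div_rpow (br_pos _).le (by norm_num), Real.rpow_neg (by norm_num : (0:ℝ) ≤ 4)]
          field_simp
  calc ∑' k : ℤ, ENNReal.ofReal (br (l * k + c) ^ (-r))
      ≤ ∑' k : ℤ, ENNReal.ofReal (4 ^ r * jb (k - -m) ^ (-r)) :=
        ENNReal.tsum_le_tsum fun k => ENNReal.ofReal_le_ofReal (hpt k)
    _ = ∑' k : ℤ, ENNReal.ofReal (4 ^ r * jb k ^ (-r)) :=
        tsum_sub_right (fun k => ENNReal.ofReal (4 ^ r * jb k ^ (-r))) (-m)
    _ = _ := by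
        have h0 : ∀ k : ℤ, 0 ≤ 4 ^ r * jb k ^ (-r) := fun k =>
          mul_nonneg (by positivity) (Real.rpow_nonneg (br_pos _).le _)
        rw [← ENNReal.ofReal_tsum_of_nonneg h0 (hsum.mul_left _), tsum_mul_left]
        rfl

/-! ### The majorant kernel and its symmetries. -/

/-- The weight `⟨n⟩^{-1/2-δ}`, which is square summable for `δ > 0`. -/
def wt (δ : ℝ) (n : ℤ) : ℝ := jb n ^ (-(1 / 2 + δ))

theorem wt_nonneg (δ : ℝ) (n : ℤ) : 0 ≤ wt δ n := Real.rpow_nonneg (br_pos _).le _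

open Classical in
/-- The kernel `⟨Ψ / (2 n₁₅)⟩^{-1-δ}` with `Ψ = 2 n₁₅ n₃₅ + n₂₄ (2 n - n₂₄)`, restricted to the
range where `n₂₄` is small against `n₁₅`. -/
def resKer (δ : ℝ) (n₁ n₂ n₃ n₄ n₅ : ℤ) : ℝ :=
  if 4 * |n₂ + n₄| ≤ |n₁ + n₅| ∧ n₁ + n₅ ≠ 0 then
    br ((n₃ + n₅ : ℝ) + (n₂ + n₄) * (2 * (n₁ + n₂ + n₃ + n₄ + n₅) - (n₂ + n₄)) /
      (2 * (n₁ + n₅))) ^ (-(1 + δ))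
  else 0

theorem resKer_nonneg (δ : ℝ) (n₁ n₂ n₃ n₄ n₅ : ℤ) : 0 ≤ resKer δ n₁ n₂ n₃ n₄ n₅ := by
  unfold resKer
  split_ifs
  exacts [Real.rpow_nonneg (br_pos _).le _, le_rfl]

/-- The basic majorant of the kernels, before symmetrisation in `n₁`, `n₃`, `n₅`. -/
def majKer (δ : ℝ) (n₁ n₂ n₃ n₄ n₅ : ℤ) : ℝ :=
  wt δ n₂ * wt δ n₄ * (wt δ n₁ * wt δ n₃ + wt δ (n₁ + n₂ + n₃ + n₄ + n₅) * wt δ n₁ +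
    jb (n₃ + n₅) ^ (-(1 + δ)) + resKer δ n₁ n₂ n₃ n₄ n₅) +
  wt δ n₁ * wt δ n₃ * wt δ n₅ * (wt δ n₂ + wt δ n₄)

theorem majKer_nonneg (δ : ℝ) (n₁ n₂ n₃ n₄ n₅ : ℤ) : 0 ≤ majKer δ n₁ n₂ n₃ n₄ n₅ := by
  have h := fun n => wt_nonneg δ n
  have h1 := resKer_nonneg δ n₁ n₂ n₃ n₄ n₅
  have h2 : 0 ≤ jb (n₃ + n₅) ^ (-(1 + δ)) := Real.rpow_nonneg (br_pos _).le _
  unfold majKer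
  have := h n₁; have := h n₂; have := h n₃; have := h n₄; have := h n₅
  have := h (n₁ + n₂ + n₃ + n₄ + n₅)
  positivity

/-- The majorant of the kernels, symmetric in `n₁`, `n₃`, `n₅`. -/
def symKer (δ : ℝ) (n₁ n₂ n₃ n₄ n₅ : ℤ) : ℝ :=
  majKer δ n₁ n₂ n₃ n₄ n₅ + majKer δ n₁ n₂ n₅ n₄ n₃ + majKer δ n₃ n₂ n₁ n₄ n₅ +
  majKer δ n₃ n₂ n₅ n₄ n₁ + majKer δ n₅ n₂ n₁ n₄ n₃ + majKer δ n₅ n₂ n₃ n₄ n₁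

theorem symKer_nonneg (δ : ℝ) (n₁ n₂ n₃ n₄ n₅ : ℤ) : 0 ≤ symKer δ n₁ n₂ n₃ n₄ n₅ := by
  have h := majKer_nonneg δ
  unfold symKer
  have := h n₁ n₂ n₃ n₄ n₅; have := h n₁ n₂ n₅ n₄ n₃; have := h n₃ n₂ n₁ n₄ n₅
  have := h n₃ n₂ n₅ n₄ n₁; have := h n₅ n₂ n₁ n₄ n₃; have := h n₅ n₂ n₃ n₄ n₁
  positivity

theorem symKer_swap₁₃ (δ : ℝ) (n₁ n₂ n₃ n₄ n₅ : ℤ) :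
    symKer δ n₃ n₂ n₁ n₄ n₅ = symKer δ n₁ n₂ n₃ n₄ n₅ := by unfold symKer; ring

theorem symKer_swap₃₅ (δ : ℝ) (n₁ n₂ n₃ n₄ n₅ : ℤ) :
    symKer δ n₁ n₂ n₅ n₄ n₃ = symKer δ n₁ n₂ n₃ n₄ n₅ := by unfold symKer; ring

theorem majKer_le_symKer (δ : ℝ) (n₁ n₂ n₃ n₄ n₅ : ℤ) :
    majKer δ n₁ n₂ n₃ n₄ n₅ ≤ symKer δ n₁ n₂ n₃ n₄ n₅ := by
  have h := majKer_nonneg δ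
  unfold symKer
  linarith [h n₁ n₂ n₃ n₄ n₅, h n₁ n₂ n₅ n₄ n₃, h n₃ n₂ n₁ n₄ n₅, h n₃ n₂ n₅ n₄ n₁,
    h n₅ n₂ n₁ n₄ n₃, h n₅ n₂ n₃ n₄ n₁]

theorem jb_neg (n : ℤ) : jb (-n) = jb n := by simp [jb]

theorem wt_neg (δ : ℝ) (n : ℤ) : wt δ (-n) = wt δ n := by simp [wt, jb_neg]

theorem resKer_neg (δ : ℝ) (n₁ n₂ n₃ n₄ n₅ : ℤ) :
    resKer δ (-n₁) (-n₂) (-n₃) (-n₄) (-n₅) = resKer δ n₁ n₂ n₃ n₄ n₅ := by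
  have h1 : 4 * |-n₂ + -n₄| ≤ |-n₁ + -n₅| ∧ -n₁ + -n₅ ≠ 0 ↔
      4 * |n₂ + n₄| ≤ |n₁ + n₅| ∧ n₁ + n₅ ≠ 0 := by
    rw [← neg_add, ← neg_add, abs_neg, abs_neg, neg_ne_zero]
  unfold resKer
  simp only [h1]
  congr 2
  rw [← br_neg]
  congr 1
  push_cast
  rw [show (2 * (-(n₁:ℝ) + -n₅)) = -(2 * (n₁ + n₅)) by ring, div_neg]
  ring

theorem majKer_neg (δ : ℝ) (n₁ n₂ n₃ n₄ n₅ : ℤ) :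
    majKer δ (-n₁) (-n₂) (-n₃) (-n₄) (-n₅) = majKer δ n₁ n₂ n₃ n₄ n₅ := by
  unfold majKer
  simp only [resKer_neg, ← neg_add, wt_neg, jb_neg]

theorem symKer_neg (δ : ℝ) (n₁ n₂ n₃ n₄ n₅ : ℤ) :
    symKer δ (-n₁) (-n₂) (-n₃) (-n₄) (-n₅) = symKer δ n₁ n₂ n₃ n₄ n₅ := by
  simp only [symKer, majKer_neg]

/-! ### Boundedness of the majorant. -/

theorem exists_nsq_wt_le {δ : ℝ} (hδ : 0 < δ) :
    ∃ S : ℝ≥0, nsq (fun n => ENNReal.ofReal (wt δ n)) ≤ S := by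
  obtain ⟨S, hS⟩ := exists_tsum_br_le (r := 1 + 2 * δ) (by linarith)
  refine ⟨S, ?_⟩
  have := hS 1 0 (by norm_num)
  unfold nsq
  refine le_trans (le_of_eq (tsum_congr fun n => ?_)) this
  rw [← ENNReal.ofReal_pow (wt_nonneg _ _), wt, ← Real.rpow_natCast, jb_eq_br,
    ← Real.rpow_mul (br_pos _).le]
  congr 2
  · simp
  · push_cast; ring

/-- The argument of the bracket is affine in both Schur sums. With n₁₅ = a fixed, n does not move
and the slope in n₁ is −1. With the other inputs fixed, the slope in n₃ is 1 + n₂₄/n₁₅, which the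
cut-off 4|n₂₄| ≤ |n₁₅| keeps above 1/2. -/
theorem bdd_resKer {δ : ℝ} (hδ : 0 < δ) : Bdd (fun n₁ n₂ n₃ n₄ n₅ =>
    ENNReal.ofReal (wt δ n₂) * ENNReal.ofReal (wt δ n₄) *
      ENNReal.ofReal (resKer δ n₁ n₂ n₃ n₄ n₅)) := by
  obtain ⟨S, hS⟩ := exists_nsq_wt_le hδ
  obtain ⟨S', hS'⟩ := exists_tsum_br_le (r := 1 + δ) (by linarith)
  refine Bdd.schur (k := fun n₁ n₂ n₃ n₄ n₅ => ENNReal.ofReal (resKer δ n₁ n₂ n₃ n₄ n₅)) hS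
    (S' := S') ?_ ?_
  · intro n₂ n₃ n₄ a
    unfold resKer
    by_cases h : 4 * |n₂ + n₄| ≤ |a| ∧ a ≠ 0
    · refine le_trans (le_of_eq (tsum_congr fun n₁ => ?_)) (hS' (-1) (n₃ + a +
        (n₂ + n₄) * (2 * (n₂ + n₃ + n₄ + a) - (n₂ + n₄)) / (2 * a)) (by norm_num))
      rw [if_pos (by simpa using h)]
      push_cast
      congr 3
      rw [show (n₁ + (a - n₁) : ℝ) = a by ring]
      ring
    · refine le_trans (le_of_eq ?_) zero_le
      rw [ENNReal.tsum_eq_zero]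
      intro n₁
      rw [if_neg (by simpa using h), ENNReal.ofReal_zero]
  · intro n₁ n₂ n₄ n₅
    unfold resKer
    by_cases h : 4 * |n₂ + n₄| ≤ |n₁ + n₅| ∧ n₁ + n₅ ≠ 0
    · have h0 : (n₁ + n₅ : ℝ) ≠ 0 := by exact_mod_cast h.2
      have hl : 1 / 2 ≤ |1 + (n₂ + n₄ : ℝ) / (n₁ + n₅)| := by
        have h1 : |(n₂ + n₄ : ℝ) / (n₁ + n₅)| ≤ 1 / 4 := by
          rw [abs_div, div_le_iff₀ (abs_pos.2 h0)]
          have : 4 * |(n₂ + n₄ : ℝ)| ≤ |(n₁ + n₅ : ℝ)| := by exact_mod_cast h.1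
          linarith
        have := abs_le.1 h1
        rw [le_abs]; left; linarith
      refine le_trans (le_of_eq (tsum_congr fun n₃ => ?_)) (hS' _ (n₅ +
        (n₂ + n₄) * (2 * (n₁ + n₂ + n₄ + n₅) - (n₂ + n₄)) / (2 * (n₁ + n₅))) hl)
      rw [if_pos h]
      congr 3
      field_simp
      ring
    · refine le_trans (le_of_eq ?_) zero_le
      rw [ENNReal.tsum_eq_zero]
      intro n₁
      rw [if_neg h, ENNReal.ofReal_zero]

theorem bdd_jb {δ : ℝ} (hδ : 0 < δ) : Bdd (fun _ n₂ n₃ n₄ n₅ =>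
    ENNReal.ofReal (wt δ n₂) * ENNReal.ofReal (wt δ n₄) *
      ENNReal.ofReal (jb (n₃ + n₅) ^ (-(1 + δ)))) := by
  obtain ⟨S, hS⟩ := exists_nsq_wt_le hδ
  obtain ⟨S', hS'⟩ := exists_tsum_br_le (r := 1 + δ) (by linarith)
  refine Bdd.schur (k := fun _ _ n₃ _ n₅ => ENNReal.ofReal (jb (n₃ + n₅) ^ (-(1 + δ)))) hS
    (S' := S') ?_ ?_
  · intro n₂ n₃ n₄ a
    refine le_trans (le_of_eq (tsum_congr fun n₁ => ?_)) (hS' (-1) (n₃ + a) (by norm_num))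
    rw [jb_eq_br]; push_cast; congr 3; ring
  · intro n₁ n₂ n₄ n₅
    refine le_trans (le_of_eq (tsum_congr fun n₁ => ?_)) (hS' 1 n₅ (by norm_num))
    rw [jb_eq_br]; push_cast; congr 3; ring

theorem bdd_majKer {δ : ℝ} (hδ : 0 < δ) :
    Bdd (fun n₁ n₂ n₃ n₄ n₅ => ENNReal.ofReal (majKer δ n₁ n₂ n₃ n₄ n₅)) := by
  obtain ⟨S, hS⟩ := exists_nsq_wt_le hδ
  -- The subscript names the one input frequency that carries no weight.
  have h₅ := Bdd.young hS
  have h₂ := h₅.swap₄₅.swap₃₄.swap₂₃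
  have h₄ := h₅.swap₄₅
  have hd := (Bdd.youngDual hS).swap₁₃
  have hsum := ((((h₅.add hd).add (bdd_jb hδ)).add (bdd_resKer hδ)).add h₂).add h₄
  refine hsum.mono 1 fun n₁ n₂ n₃ n₄ n₅ => ?_
  have h := wt_nonneg δ
  have hw := h (n₁ + n₂ + n₃ + n₄ + n₅)
  have hr := resKer_nonneg δ n₁ n₂ n₃ n₄ n₅
  have hj : 0 ≤ jb (n₃ + n₅) ^ (-(1 + δ)) := Real.rpow_nonneg (br_pos _).le _
  have e : n₃ + n₂ + n₁ + n₄ + n₅ = n₁ + n₂ + n₃ + n₄ + n₅ := by ring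
  have h1 := h n₁; have h2 := h n₂; have h3 := h n₃; have h4 := h n₄; have h5 := h n₅
  have h12 := mul_nonneg h1 h2; have h123 := mul_nonneg h12 h3
  have h13 := mul_nonneg h1 h3; have h134 := mul_nonneg h13 h4
  have h21 := mul_nonneg h2 h1; have h24 := mul_nonneg h2 h4
  simp only [e, ← ENNReal.ofReal_mul, h1, h2, hw, h12, h123, h13, h134, h21, h24]
  rw [← ENNReal.ofReal_add, ← ENNReal.ofReal_add, ← ENNReal.ofReal_add, ← ENNReal.ofReal_add,
    ← ENNReal.ofReal_add, ENNReal.coe_one, one_mul]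
  · apply ENNReal.ofReal_le_ofReal
    apply le_of_eq
    unfold majKer
    ring
  all_goals positivity

theorem bdd_symKer {δ : ℝ} (hδ : 0 < δ) :
    Bdd (fun n₁ n₂ n₃ n₄ n₅ => ENNReal.ofReal (symKer δ n₁ n₂ n₃ n₄ n₅)) := by
  have h := bdd_majKer hδ
  have hsum := ((((h.add h.swap₃₅).add h.swap₁₃).add h.swap₁₃.swap₃₅).add
    h.swap₃₅.swap₁₃).add h.swap₃₅.swap₁₃.swap₃₅
  refine hsum.mono 1 fun n₁ n₂ n₃ n₄ n₅ => ?_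
  have h := majKer_nonneg δ
  have := h n₁ n₂ n₃ n₄ n₅; have := h n₁ n₂ n₅ n₄ n₃; have := h n₃ n₂ n₁ n₄ n₅
  have := h n₃ n₂ n₅ n₄ n₁; have := h n₅ n₂ n₁ n₄ n₃; have := h n₅ n₂ n₃ n₄ n₁
  rw [← ENNReal.ofReal_add, ← ENNReal.ofReal_add, ← ENNReal.ofReal_add, ← ENNReal.ofReal_add,
    ← ENNReal.ofReal_add, ENNReal.coe_one, one_mul]
  · apply ENNReal.ofReal_le_ofReal
    apply le_of_eq
    unfold symKer
    ring
  all_goals positivity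

/-! ### Power counting. -/

/-- For exponents t in [0,1] a comparison constant C ≥ 1 costs only C^t ≤ C. The bound δ ≤ 1/4 keeps
exponents such as 1/2+2δ and 4δ in this range. -/
theorem rpow_neg_le_mul {C x y t : ℝ} (hC : 1 ≤ C) (hx : 0 < x) (h : x ≤ C * y) (ht : 0 ≤ t)
    (ht1 : t ≤ 1) : y ^ (-t) ≤ C * x ^ (-t) := by
  have hC0 : 0 < C := by linarith
  calc y ^ (-t) ≤ (x / C) ^ (-t) := by
        apply Real.rpow_le_rpow_of_nonpos (by positivity) _ (by linarith)
        rw [div_le_iff₀ hC0]; linarith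
    _ = C ^ t * x ^ (-t) := by
        rw [Real.div_rpow hx.le hC0.le, Real.rpow_neg hC0.le]; field_simp
    _ ≤ C * x ^ (-t) := by
        gcongr
        calc C ^ t ≤ C ^ (1 : ℝ) := Real.rpow_le_rpow_of_exponent_le hC ht1
          _ = C := Real.rpow_one C

theorem rpow_le_mul {C x y t : ℝ} (hC : 1 ≤ C) (hx : 0 ≤ x) (hy : 0 ≤ y) (h : x ≤ C * y)
    (ht : 0 ≤ t) (ht1 : t ≤ 1) : x ^ t ≤ C * y ^ t := by
  have hC0 : 0 < C := by linarith
  calc x ^ t ≤ (C * y) ^ t := Real.rpow_le_rpow hx h ht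
    _ = C ^ t * y ^ t := Real.mul_rpow hC0.le hy
    _ ≤ C * y ^ t := by
        gcongr
        calc C ^ t ≤ C ^ (1 : ℝ) := Real.rpow_le_rpow_of_exponent_le hC ht1
          _ = C := Real.rpow_one C

theorem rpow_mul_rpow_neg_le {C x y t : ℝ} (hC : 1 ≤ C) (hx : 0 ≤ x) (hy : 0 < y) (h : x ≤ C * y)
    (ht : 0 ≤ t) (ht1 : t ≤ 1) : x ^ t * y ^ (-t) ≤ C := by
  calc x ^ t * y ^ (-t) ≤ (C * y ^ t) * y ^ (-t) := by
        gcongr; exact rpow_le_mul hC hx hy.le h ht ht1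
    _ = C := by rw [mul_assoc, ← Real.rpow_add hy]; simp

theorem rpow_neg_anti {x t u : ℝ} (hx : 1 ≤ x) (h : t ≤ u) : x ^ (-u) ≤ x ^ (-t) :=
  Real.rpow_le_rpow_of_exponent_le hx (by linarith)

/-- Resonant case, with a gain `F` coming from the resonance function or from the small
frequencies. -/
theorem resonant_le {δ C M F x0 x1 x3 x5 Z : ℝ} (hδ : 0 < δ) (hδ1 : δ ≤ 1 / 4) (hC : 1 ≤ C)
    (hM : 0 ≤ M) (h0 : 1 ≤ x0) (h1 : 1 ≤ x1) (h3 : 1 ≤ x3) (h5 : 1 ≤ x5) (hZ : 1 ≤ Z)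
    (hM5 : M ≤ C * x5) (h53 : x5 ≤ C * x3) (h01 : x0 ≤ C * x1) (hZ5 : Z ≤ C * x5)
    (hF0 : 0 ≤ F) (hF : F ≤ C * Z ^ (-1 : ℝ)) :
    M * F * x0 ^ (1 / 2 + 2 * δ) * (x1 ^ (-(1 / 2 + 2 * δ)) * x3 ^ (-(1 / 2 + 2 * δ)) *
      x5 ^ (-(1 / 2 + 2 * δ))) ≤ C ^ 5 * Z ^ (-(1 + δ)) := by
  have a : x0 ^ (1 / 2 + 2 * δ) * x1 ^ (-(1 / 2 + 2 * δ)) ≤ C :=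
    rpow_mul_rpow_neg_le hC (by linarith) (by linarith) h01 (by linarith) (by linarith)
  have b : x3 ^ (-(1 / 2 + 2 * δ)) ≤ C * x5 ^ (-(1 / 2 + 2 * δ)) :=
    rpow_neg_le_mul hC (by linarith) h53 (by linarith) (by linarith)
  -- The weights of n₃ and n₅ pay for M ≲ x₅ and leave x₅^{-4δ}, of which Z^{-δ} is kept; together
  -- with F ≲ Z⁻¹ this is the summable power of Z.
  have c : x5 * (x5 ^ (-(1 / 2 + 2 * δ)) * x5 ^ (-(1 / 2 + 2 * δ))) ≤ C * Z ^ (-δ) := by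
    have e : x5 * (x5 ^ (-(1 / 2 + 2 * δ)) * x5 ^ (-(1 / 2 + 2 * δ))) = x5 ^ (-(4 * δ)) := by
      rw [← Real.rpow_add (by linarith), ← Real.rpow_one_add' (by linarith)]
      · congr 1; ring
      · intro h; linarith
    rw [e]
    refine (rpow_neg_le_mul hC (by linarith) hZ5 (by linarith) (by linarith)).trans ?_
    gcongr
    linarith
  have hZe : Z ^ (-(1 + δ)) = Z ^ (-1 : ℝ) * Z ^ (-δ) := by
    rw [← Real.rpow_add (by linarith)]; congr 1; ring
  rw [hZe]
  have p0 : 0 ≤ x0 ^ (1 / 2 + 2 * δ) := Real.rpow_nonneg (by linarith) _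
  have p1 : 0 ≤ x1 ^ (-(1 / 2 + 2 * δ)) := Real.rpow_nonneg (by linarith) _
  have p3 : 0 ≤ x3 ^ (-(1 / 2 + 2 * δ)) := Real.rpow_nonneg (by linarith) _
  have p5 : 0 ≤ x5 ^ (-(1 / 2 + 2 * δ)) := Real.rpow_nonneg (by linarith) _
  have pZ : 0 ≤ Z ^ (-1 : ℝ) := Real.rpow_nonneg (by linarith) _
  have pZ' : 0 ≤ Z ^ (-δ) := Real.rpow_nonneg (by linarith) _
  generalize x0 ^ (1 / 2 + 2 * δ) = A0 at *
  generalize x1 ^ (-(1 / 2 + 2 * δ)) = A1 at *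
  generalize x3 ^ (-(1 / 2 + 2 * δ)) = A3 at *
  generalize x5 ^ (-(1 / 2 + 2 * δ)) = A5 at *
  calc M * F * A0 * (A1 * A3 * A5) = (A0 * A1) * (M * (A3 * A5)) * F := by ring
    _ ≤ C * ((C * x5) * ((C * A5) * A5)) * (C * Z ^ (-1 : ℝ)) := by gcongr
    _ = C ^ 4 * Z ^ (-1 : ℝ) * (x5 * (A5 * A5)) := by ring
    _ ≤ C ^ 4 * Z ^ (-1 : ℝ) * (C * Z ^ (-δ)) := by gcongr
    _ = _ := by ring

/-- The new loss is N/x₀, where N stands for the largest input. By the hypothesis on J and 3/4 ≤ 1 −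
δ one has J^{-(1-δ)} ≲ (NZ/x₀)^{-3/2}; this absorbs N/x₀ and leaves Z^{-3/2} ≤ Z^{-(1+δ)}. -/
theorem resonant_deriv_le {δ C M J N x0 x1 x3 x5 Z : ℝ} (hδ : 0 < δ) (hδ1 : δ ≤ 1 / 4)
    (hC : 1 ≤ C) (hM : 0 ≤ M) (hJ : 1 ≤ J) (hN : 1 ≤ N) (h0 : 1 ≤ x0) (h1 : 1 ≤ x1) (h3 : 1 ≤ x3)
    (h5 : 1 ≤ x5) (hZ : 1 ≤ Z) (hM5 : M ≤ C * x5) (h53 : x5 ≤ C * x3) (h01 : x0 ≤ C * x1)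
    (h0N : x0 ≤ C * N) (hJZ : (N * Z) ^ 2 ≤ C * (x0 ^ 2 * J)) :
    M * J ^ (-(1 - δ)) * x0 ^ (2 * δ - 1 / 2) * (x1 ^ (-(1 / 2 + 2 * δ)) *
      x3 ^ (-(1 / 2 + 2 * δ)) * x5 ^ (-(1 / 2 + 2 * δ))) * N ≤ C ^ 5 * Z ^ (-(1 + δ)) := by
  have a : x0 ^ (1 / 2 + 2 * δ) * x1 ^ (-(1 / 2 + 2 * δ)) ≤ C :=
    rpow_mul_rpow_neg_le hC (by linarith) (by linarith) h01 (by linarith) (by linarith)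
  have e0 : x0 ^ (2 * δ - 1 / 2) = x0 ^ (1 / 2 + 2 * δ) * x0⁻¹ := by
    rw [← Real.rpow_neg_one, ← Real.rpow_add (by linarith)]; congr 1; ring
  have b : x3 ^ (-(1 / 2 + 2 * δ)) ≤ C * x5 ^ (-(1 / 2 + 2 * δ)) :=
    rpow_neg_le_mul hC (by linarith) h53 (by linarith) (by linarith)
  have c : x5 * (x5 ^ (-(1 / 2 + 2 * δ)) * x5 ^ (-(1 / 2 + 2 * δ))) ≤ 1 := by
    have e : x5 * (x5 ^ (-(1 / 2 + 2 * δ)) * x5 ^ (-(1 / 2 + 2 * δ))) = x5 ^ (-(4 * δ)) := by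
      rw [← Real.rpow_add (by linarith), ← Real.rpow_one_add' (by linarith)]
      · congr 1; ring
      · intro h; linarith
    rw [e]
    exact Real.rpow_le_one_of_one_le_of_nonpos h5 (by linarith)
  have hY : 0 < N * Z / x0 := by positivity
  have d : J ^ (-(1 - δ)) ≤ C * (N * Z / x0) ^ (-(3 / 2) : ℝ) := by
    calc J ^ (-(1 - δ)) ≤ J ^ (-(3 / 4) : ℝ) := rpow_neg_anti hJ (by linarith)
      _ ≤ C * ((N * Z / x0) ^ 2) ^ (-(3 / 4) : ℝ) := by
          refine rpow_neg_le_mul hC (by positivity) ?_ (by norm_num) (by norm_num)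
          rw [div_pow, div_le_iff₀ (by positivity)]
          linarith
      _ = _ := by
          rw [← Real.rpow_natCast, ← Real.rpow_mul hY.le]; norm_num
  have f : N / x0 * (N * Z / x0) ^ (-(3 / 2) : ℝ) ≤ C * Z ^ (-(1 + δ)) := by
    have hq : 0 < N / x0 := by positivity
    rw [show N * Z / x0 = (N / x0) * Z by ring, Real.mul_rpow hq.le (by linarith), ← mul_assoc,
      ← Real.rpow_one_add' hq.le (by norm_num)]
    refine mul_le_mul ?_ (rpow_neg_anti hZ (by linarith)) (by positivity) (by linarith)
    rw [show (1 + -(3 / 2) : ℝ) = -(1 / 2) by norm_num]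
    have := rpow_neg_le_mul (x := 1) (y := N / x0) (t := 1 / 2) hC one_pos
      (by rw [mul_div_assoc', le_div_iff₀ (by linarith)]; linarith) (by norm_num) (by norm_num)
    simpa using this
  have p0 : 0 ≤ x0 ^ (1 / 2 + 2 * δ) := Real.rpow_nonneg (by linarith) _
  have p1 : 0 ≤ x1 ^ (-(1 / 2 + 2 * δ)) := Real.rpow_nonneg (by linarith) _
  have p3 : 0 ≤ x3 ^ (-(1 / 2 + 2 * δ)) := Real.rpow_nonneg (by linarith) _
  have p5 : 0 ≤ x5 ^ (-(1 / 2 + 2 * δ)) := Real.rpow_nonneg (by linarith) _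
  have pJ : 0 ≤ J ^ (-(1 - δ)) := Real.rpow_nonneg (by linarith) _
  have pY : 0 ≤ (N * Z / x0) ^ (-(3 / 2) : ℝ) := Real.rpow_nonneg hY.le _
  rw [e0]
  generalize x0 ^ (1 / 2 + 2 * δ) = A0 at *
  generalize x1 ^ (-(1 / 2 + 2 * δ)) = A1 at *
  generalize x3 ^ (-(1 / 2 + 2 * δ)) = A3 at *
  generalize x5 ^ (-(1 / 2 + 2 * δ)) = A5 at *
  generalize J ^ (-(1 - δ)) = Je at *
  generalize (N * Z / x0) ^ (-(3 / 2) : ℝ) = Y at *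
  calc M * Je * (A0 * x0⁻¹) * (A1 * A3 * A5) * N
      = (A0 * A1) * (M * (A3 * A5)) * Je * (N / x0) := by ring
    _ ≤ C * ((C * x5) * ((C * A5) * A5)) * (C * Y) * (N / x0) := by gcongr
    _ = C ^ 4 * (x5 * (A5 * A5)) * (N / x0 * Y) := by ring
    _ ≤ C ^ 4 * 1 * (C * Z ^ (-(1 + δ))) := by gcongr
    _ = _ := by ring

/-- The power J^{-1/2} pays for M x₀^{1/2} up to x₁^{1/2}. The weight of x₁ is thereby spent
completely, while those of x₃ and x₅ remain for Young's inequality. -/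
theorem nonresonant_le {δ C M J x0 x1 x3 x5 : ℝ} (hδ : 0 < δ) (hδ1 : δ ≤ 1 / 4)
    (hC : 1 ≤ C) (hM : 0 ≤ M) (hJ : 1 ≤ J) (h0 : 1 ≤ x0) (h1 : 1 ≤ x1) (h3 : 1 ≤ x3)
    (h5 : 1 ≤ x5) (h01 : x0 ≤ C * x1) (hMJ : M ^ 2 * x0 ≤ C * (x1 * J)) :
    M * J ^ (-(1 / 2) : ℝ) * x0 ^ (1 / 2 + 2 * δ) * (x1 ^ (-(1 / 2 + 2 * δ)) *
      x3 ^ (-(1 / 2 + 2 * δ)) * x5 ^ (-(1 / 2 + 2 * δ))) ≤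
      C ^ 2 * (x3 ^ (-(1 / 2 + δ)) * x5 ^ (-(1 / 2 + δ))) := by
  have a : M * J ^ (-(1 / 2) : ℝ) * x0 ^ (1 / 2 : ℝ) ≤ C * x1 ^ (1 / 2 : ℝ) := by
    have h : M ^ 2 * x0 / J ≤ C * x1 := by
      rw [div_le_iff₀ (by linarith)]; linarith
    have := rpow_le_mul (t := 1 / 2) hC (by positivity) (by linarith) h (by norm_num) (by norm_num)
    refine le_trans (le_of_eq ?_) this
    rw [Real.div_rpow (by positivity) (by linarith), Real.mul_rpow (by positivity) (by linarith),
      ← Real.rpow_natCast, ← Real.rpow_mul hM, Real.rpow_neg (by linarith)]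
    norm_num
    ring
  have b : x0 ^ (2 * δ) ≤ C * x1 ^ (2 * δ) :=
    rpow_le_mul hC (by linarith) (by linarith) h01 (by linarith) (by linarith)
  have c3 : x3 ^ (-(1 / 2 + 2 * δ)) ≤ x3 ^ (-(1 / 2 + δ)) := rpow_neg_anti h3 (by linarith)
  have c5 : x5 ^ (-(1 / 2 + 2 * δ)) ≤ x5 ^ (-(1 / 2 + δ)) := rpow_neg_anti h5 (by linarith)
  have e : x1 ^ (1 / 2 : ℝ) * x1 ^ (2 * δ) * x1 ^ (-(1 / 2 + 2 * δ)) = 1 := by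
    rw [← Real.rpow_add (by linarith), ← Real.rpow_add (by linarith)]; simp
  rw [Real.rpow_add (by linarith : 0 < x0)]
  have p0 : 0 ≤ x0 ^ (2 * δ) := Real.rpow_nonneg (by linarith) _
  have p1 : 0 ≤ x1 ^ (-(1 / 2 + 2 * δ)) := Real.rpow_nonneg (by linarith) _
  have p1' : 0 ≤ x1 ^ (1 / 2 : ℝ) := Real.rpow_nonneg (by linarith) _
  have p3 : 0 ≤ x3 ^ (-(1 / 2 + 2 * δ)) := Real.rpow_nonneg (by linarith) _
  have p5 : 0 ≤ x5 ^ (-(1 / 2 + 2 * δ)) := Real.rpow_nonneg (by linarith) _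
  have p3' : 0 ≤ x3 ^ (-(1 / 2 + δ)) := Real.rpow_nonneg (by linarith) _
  generalize x1 ^ (-(1 / 2 + 2 * δ)) = A1 at *
  generalize x3 ^ (-(1 / 2 + 2 * δ)) = A3 at *
  generalize x5 ^ (-(1 / 2 + 2 * δ)) = A5 at *
  calc M * J ^ (-(1 / 2) : ℝ) * (x0 ^ (1 / 2 : ℝ) * x0 ^ (2 * δ)) * (A1 * A3 * A5)
      = (M * J ^ (-(1 / 2) : ℝ) * x0 ^ (1 / 2 : ℝ)) * x0 ^ (2 * δ) * A1 * (A3 * A5) := by ring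
    _ ≤ (C * x1 ^ (1 / 2 : ℝ)) * (C * x1 ^ (2 * δ)) * A1 *
        (x3 ^ (-(1 / 2 + δ)) * x5 ^ (-(1 / 2 + δ))) := by gcongr
    _ = C ^ 2 * (x1 ^ (1 / 2 : ℝ) * x1 ^ (2 * δ) * A1) *
        (x3 ^ (-(1 / 2 + δ)) * x5 ^ (-(1 / 2 + δ))) := by ring
    _ = _ := by rw [e]; ring

/-- Since M ≲ J, the factor J^{-(1-δ)} pays for all of M except M^δ. -/
theorem mul_rpow_neg_one_sub_le {δ C M J : ℝ} (hδ : 0 < δ) (hδ1 : δ ≤ 1 / 4)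
    (hC : 1 ≤ C) (hM : 0 ≤ M) (hJ : 1 ≤ J) (hMJ : M ≤ C * J) :
    M * J ^ (-(1 - δ)) ≤ C * M ^ δ := by
  have h := rpow_mul_rpow_neg_le (t := 1 - δ) hC hM (by linarith) hMJ (by linarith) (by linarith)
  have e : M = M ^ δ * M ^ (1 - δ) := by
    rw [← Real.rpow_add' hM (by simp)]; simp
  calc M * J ^ (-(1 - δ)) = M ^ δ * (M ^ (1 - δ) * J ^ (-(1 - δ))) := by
        rw [← mul_assoc, ← e]
    _ ≤ M ^ δ * C := by gcongr
    _ = _ := mul_comm _ _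

/-- The derivative on x₁ is returned by the output weight because x₁ ≲ x₀. The remaining M^δ is
shared by x₃ and x₅, whose exponents drop from 1/2+2δ to 1/2+δ. -/
theorem nonresonant_deriv_le_of_output {δ C M J x0 x1 x3 x5 : ℝ} (hδ : 0 < δ) (hδ1 : δ ≤ 1 / 4)
    (hC : 1 ≤ C) (hM : 0 ≤ M) (hJ : 1 ≤ J) (h0 : 1 ≤ x0) (h1 : 1 ≤ x1) (h3 : 1 ≤ x3)
    (h5 : 1 ≤ x5) (hMJ : M ≤ C * J) (h10 : x1 ≤ C * x0) (hM35 : M ≤ C * (x3 * x5)) :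
    M * J ^ (-(1 - δ)) * x0 ^ (2 * δ - 1 / 2) * (x1 ^ (-(1 / 2 + 2 * δ)) *
      x3 ^ (-(1 / 2 + 2 * δ)) * x5 ^ (-(1 / 2 + 2 * δ))) * x1 ≤
      C ^ 3 * (x3 ^ (-(1 / 2 + δ)) * x5 ^ (-(1 / 2 + δ))) := by
  have a := mul_rpow_neg_one_sub_le hδ hδ1 hC hM hJ hMJ
  have b : M ^ δ ≤ C * (x3 ^ δ * x5 ^ δ) := by
    rw [← Real.mul_rpow (by linarith) (by linarith)]
    exact rpow_le_mul hC hM (by positivity) hM35 hδ.le (by linarith)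
  have c : x1 ^ (1 / 2 - 2 * δ) * x0 ^ (-(1 / 2 - 2 * δ)) ≤ C :=
    rpow_mul_rpow_neg_le hC (by linarith) (by linarith) h10 (by linarith) (by linarith)
  have e1 : x1 ^ (-(1 / 2 + 2 * δ)) * x1 = x1 ^ (1 / 2 - 2 * δ) := by
    nth_rewrite 2 [← Real.rpow_one x1]
    rw [← Real.rpow_add (by linarith)]; congr 1; ring
  have e3 : ∀ x : ℝ, 1 ≤ x → x ^ δ * x ^ (-(1 / 2 + 2 * δ)) = x ^ (-(1 / 2 + δ)) := by
    intro x hx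
    rw [← Real.rpow_add (by linarith)]; congr 1; ring
  have p3 : 0 ≤ x3 ^ (-(1 / 2 + 2 * δ)) := Real.rpow_nonneg (by linarith) _
  have p5 : 0 ≤ x5 ^ (-(1 / 2 + 2 * δ)) := Real.rpow_nonneg (by linarith) _
  have p1 : 0 ≤ x1 ^ (1 / 2 - 2 * δ) := Real.rpow_nonneg (by linarith) _
  have p0 : 0 ≤ x0 ^ (-(1 / 2 - 2 * δ)) := Real.rpow_nonneg (by linarith) _
  rw [show 2 * δ - 1 / 2 = -(1 / 2 - 2 * δ) by ring]
  calc M * J ^ (-(1 - δ)) * x0 ^ (-(1 / 2 - 2 * δ)) * (x1 ^ (-(1 / 2 + 2 * δ)) *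
      x3 ^ (-(1 / 2 + 2 * δ)) * x5 ^ (-(1 / 2 + 2 * δ))) * x1
      = (M * J ^ (-(1 - δ))) * ((x1 ^ (-(1 / 2 + 2 * δ)) * x1) * x0 ^ (-(1 / 2 - 2 * δ))) *
        (x3 ^ (-(1 / 2 + 2 * δ)) * x5 ^ (-(1 / 2 + 2 * δ))) := by ring
    _ ≤ (C * (C * (x3 ^ δ * x5 ^ δ))) * C *
        (x3 ^ (-(1 / 2 + 2 * δ)) * x5 ^ (-(1 / 2 + 2 * δ))) := by
        rw [e1]
        have a' := a.trans (mul_le_mul_of_nonneg_left b (by linarith))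
        generalize M * J ^ (-(1 - δ)) = MJ at *
        gcongr
    _ = C ^ 3 * ((x3 ^ δ * x3 ^ (-(1 / 2 + 2 * δ))) * (x5 ^ δ * x5 ^ (-(1 / 2 + 2 * δ)))) := by
        ring
    _ = _ := by rw [e3 x3 h3, e3 x5 h5]

/-- The weights of x₁ ≲ x₃ pay for the derivative and for M^δ, with x₁^{-3δ} to spare. This turns
x₀^{2δ-1/2} into the square summable x₀^{-1/2-δ}, so that the dual form of Young's inequality
applies. -/
theorem nonresonant_deriv_le_of_inputs {δ C M J x0 x1 x3 x5 : ℝ} (hδ : 0 < δ) (hδ1 : δ ≤ 1 / 4)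
    (hC : 1 ≤ C) (hM : 0 ≤ M) (hJ : 1 ≤ J) (h0 : 1 ≤ x0) (h1 : 1 ≤ x1) (h3 : 1 ≤ x3)
    (h5 : 1 ≤ x5) (hMJ : M ≤ C * J) (h01 : x0 ≤ C * x1) (h13 : x1 ≤ C * x3) (hM1 : M ≤ C * x1) :
    M * J ^ (-(1 - δ)) * x0 ^ (2 * δ - 1 / 2) * (x1 ^ (-(1 / 2 + 2 * δ)) *
      x3 ^ (-(1 / 2 + 2 * δ)) * x5 ^ (-(1 / 2 + 2 * δ))) * x1 ≤
      C ^ 4 * (x0 ^ (-(1 / 2 + δ)) * x5 ^ (-(1 / 2 + δ))) := by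
  have a := mul_rpow_neg_one_sub_le hδ hδ1 hC hM hJ hMJ
  have b : M ^ δ ≤ C * x1 ^ δ := rpow_le_mul hC hM (by linarith) hM1 hδ.le (by linarith)
  have c : x3 ^ (-(1 / 2 + 2 * δ)) ≤ C * x1 ^ (-(1 / 2 + 2 * δ)) :=
    rpow_neg_le_mul hC (by linarith) h13 (by linarith) (by linarith)
  have d : x1 ^ (-(3 * δ)) ≤ C * x0 ^ (-(3 * δ)) :=
    rpow_neg_le_mul hC (by linarith) h01 (by linarith) (by linarith)
  have c5 : x5 ^ (-(1 / 2 + 2 * δ)) ≤ x5 ^ (-(1 / 2 + δ)) := rpow_neg_anti h5 (by linarith)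
  have e1 : x1 ^ δ * (x1 ^ (-(1 / 2 + 2 * δ)) * x1 ^ (-(1 / 2 + 2 * δ))) * x1 =
      x1 ^ (-(3 * δ)) := by
    nth_rewrite 4 [← Real.rpow_one x1]
    rw [← Real.rpow_add (by linarith), ← Real.rpow_add (by linarith),
      ← Real.rpow_add (by linarith)]; congr 1; ring
  have e0 : x0 ^ (-(3 * δ)) * x0 ^ (2 * δ - 1 / 2) = x0 ^ (-(1 / 2 + δ)) := by
    rw [← Real.rpow_add (by linarith)]; congr 1; ring
  have p0 : 0 ≤ x0 ^ (2 * δ - 1 / 2) := Real.rpow_nonneg (by linarith) _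
  have p1 : 0 ≤ x1 ^ (-(1 / 2 + 2 * δ)) := Real.rpow_nonneg (by linarith) _
  have p3 : 0 ≤ x3 ^ (-(1 / 2 + 2 * δ)) := Real.rpow_nonneg (by linarith) _
  have p5 : 0 ≤ x5 ^ (-(1 / 2 + 2 * δ)) := Real.rpow_nonneg (by linarith) _
  have p5' : 0 ≤ x5 ^ (-(1 / 2 + δ)) := Real.rpow_nonneg (by linarith) _
  calc M * J ^ (-(1 - δ)) * x0 ^ (2 * δ - 1 / 2) * (x1 ^ (-(1 / 2 + 2 * δ)) *
      x3 ^ (-(1 / 2 + 2 * δ)) * x5 ^ (-(1 / 2 + 2 * δ))) * x1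
      = (M * J ^ (-(1 - δ))) * (x1 ^ (-(1 / 2 + 2 * δ)) * x3 ^ (-(1 / 2 + 2 * δ))) * x1 *
        x0 ^ (2 * δ - 1 / 2) * x5 ^ (-(1 / 2 + 2 * δ)) := by ring
    _ ≤ (C * (C * x1 ^ δ)) * (x1 ^ (-(1 / 2 + 2 * δ)) * (C * x1 ^ (-(1 / 2 + 2 * δ)))) * x1 *
        x0 ^ (2 * δ - 1 / 2) * x5 ^ (-(1 / 2 + δ)) := by
        have a' := a.trans (mul_le_mul_of_nonneg_left b (by linarith))
        generalize M * J ^ (-(1 - δ)) = MJ at *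
        gcongr
    _ = C ^ 3 * (x1 ^ δ * (x1 ^ (-(1 / 2 + 2 * δ)) * x1 ^ (-(1 / 2 + 2 * δ))) * x1) *
        x0 ^ (2 * δ - 1 / 2) * x5 ^ (-(1 / 2 + δ)) := by ring
    _ ≤ C ^ 3 * (C * x0 ^ (-(3 * δ))) * x0 ^ (2 * δ - 1 / 2) * x5 ^ (-(1 / 2 + δ)) := by
        rw [e1]; gcongr
    _ = C ^ 4 * (x0 ^ (-(3 * δ)) * x0 ^ (2 * δ - 1 / 2)) * x5 ^ (-(1 / 2 + δ)) := by ring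
    _ = _ := by rw [e0]; ring

/-- The gain l⁻¹ ≲ x₀⁻¹ makes the exponent of the output negative. The weights of x₃ and x₅ pay for
M and leave x₅^{-4δ} ≲ x₀^{-4δ}, so x₀ ends with exponent −1/2−2δ. -/
theorem low_output_le {δ C M l x0 x1 x3 x5 : ℝ} (hδ : 0 < δ) (hδ1 : δ ≤ 1 / 4)
    (hC : 1 ≤ C) (hl : 1 ≤ l) (h0 : 1 ≤ x0) (h1 : 1 ≤ x1) (h3 : 1 ≤ x3)
    (h5 : 1 ≤ x5) (h53 : x5 ≤ C * x3) (hM5 : M ≤ C * x5) (h05 : x0 ≤ C * x5) (h0l : x0 ≤ C * l) :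
    M * l⁻¹ * x0 ^ (1 / 2 + 2 * δ) * (x1 ^ (-(1 / 2 + 2 * δ)) * x3 ^ (-(1 / 2 + 2 * δ)) *
      x5 ^ (-(1 / 2 + 2 * δ))) ≤ C ^ 4 * (x0 ^ (-(1 / 2 + δ)) * x1 ^ (-(1 / 2 + δ))) := by
  have b : x3 ^ (-(1 / 2 + 2 * δ)) ≤ C * x5 ^ (-(1 / 2 + 2 * δ)) :=
    rpow_neg_le_mul hC (by linarith) h53 (by linarith) (by linarith)
  have c : x5 * (x5 ^ (-(1 / 2 + 2 * δ)) * x5 ^ (-(1 / 2 + 2 * δ))) ≤ C * x0 ^ (-(4 * δ)) := by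
    have e : x5 * (x5 ^ (-(1 / 2 + 2 * δ)) * x5 ^ (-(1 / 2 + 2 * δ))) = x5 ^ (-(4 * δ)) := by
      rw [← Real.rpow_add (by linarith), ← Real.rpow_one_add' (by linarith)]
      · congr 1; ring
      · intro h; linarith
    rw [e]
    exact rpow_neg_le_mul hC (by linarith) h05 (by linarith) (by linarith)
  have d : l⁻¹ ≤ C * x0⁻¹ := by
    rw [← div_eq_mul_inv, le_div_iff₀ (by linarith), inv_mul_le_iff₀ (by linarith)]; linarith
  have e0 : x0⁻¹ * x0 ^ (1 / 2 + 2 * δ) * x0 ^ (-(4 * δ)) ≤ x0 ^ (-(1 / 2 + δ)) := by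
    rw [← Real.rpow_neg_one, ← Real.rpow_add (by linarith), ← Real.rpow_add (by linarith)]
    exact Real.rpow_le_rpow_of_exponent_le h0 (by linarith)
  have c1 : x1 ^ (-(1 / 2 + 2 * δ)) ≤ x1 ^ (-(1 / 2 + δ)) := rpow_neg_anti h1 (by linarith)
  have p0 : 0 ≤ x0 ^ (1 / 2 + 2 * δ) := Real.rpow_nonneg (by linarith) _
  have p0' : 0 ≤ x0 ^ (-(1 / 2 + δ)) := Real.rpow_nonneg (by linarith) _
  have p1 : 0 ≤ x1 ^ (-(1 / 2 + 2 * δ)) := Real.rpow_nonneg (by linarith) _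
  have p3 : 0 ≤ x3 ^ (-(1 / 2 + 2 * δ)) := Real.rpow_nonneg (by linarith) _
  have p5 : 0 ≤ x5 ^ (-(1 / 2 + 2 * δ)) := Real.rpow_nonneg (by linarith) _
  have pi : 0 ≤ x0⁻¹ := by positivity
  have pl : 0 ≤ l⁻¹ := by positivity
  generalize x0 ^ (1 / 2 + 2 * δ) = A0 at *
  generalize x1 ^ (-(1 / 2 + 2 * δ)) = A1 at *
  generalize x3 ^ (-(1 / 2 + 2 * δ)) = A3 at *
  generalize x5 ^ (-(1 / 2 + 2 * δ)) = A5 at *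
  calc M * l⁻¹ * A0 * (A1 * A3 * A5) = M * (A3 * A5) * l⁻¹ * A0 * A1 := by ring
    _ ≤ (C * x5) * ((C * A5) * A5) * (C * x0⁻¹) * A0 * x1 ^ (-(1 / 2 + δ)) := by gcongr
    _ = C ^ 3 * (x5 * (A5 * A5)) * (x0⁻¹ * A0) * x1 ^ (-(1 / 2 + δ)) := by ring
    _ ≤ C ^ 3 * (C * x0 ^ (-(4 * δ))) * (x0⁻¹ * A0) * x1 ^ (-(1 / 2 + δ)) := by gcongr
    _ = C ^ 4 * (x0⁻¹ * A0 * x0 ^ (-(4 * δ))) * x1 ^ (-(1 / 2 + δ)) := by ring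
    _ ≤ C ^ 4 * x0 ^ (-(1 / 2 + δ)) * x1 ^ (-(1 / 2 + δ)) := by gcongr
    _ = _ := by ring

/-! ### Pointwise domination at regularity 1/2+2δ, and its symmetries. -/

/-- The weight `⟨n⟩^{-1/2-2δ}`. -/
def swt (δ : ℝ) (n : ℤ) : ℝ := jb n ^ (-(1 / 2 + 2 * δ))

theorem swt_nonneg (δ : ℝ) (n : ℤ) : 0 ≤ swt δ n := Real.rpow_nonneg (br_pos _).le _

theorem swt_le_wt {δ : ℝ} (hδ : 0 < δ) (n : ℤ) : swt δ n ≤ wt δ n :=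
  rpow_neg_anti (one_le_br _) (by linarith)

/-- A multiplier of size `M` with the gain `⟨Φ⟩^{-1/2}` is dominated by the majorant. -/
def Main₁ (A δ M : ℝ) (n₁ n₂ n₃ n₄ n₅ : ℤ) : Prop :=
  M * jb (Phi (n₁ + n₂ + n₃ + n₄ + n₅) n₁ n₃ n₅) ^ (-(1 / 2) : ℝ) *
    jb (n₁ + n₂ + n₃ + n₄ + n₅) ^ (1 / 2 + 2 * δ) *
    (swt δ n₁ * swt δ n₂ * swt δ n₃ * swt δ n₄ * swt δ n₅) ≤ A * symKer δ n₁ n₂ n₃ n₄ n₅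

/-- A multiplier of size `M` with the gain `⟨Φ⟩^{-1+δ}` is dominated by the majorant, with one
derivative less on the output and on one of the inputs. -/
def Main₃ (A δ M : ℝ) (n₁ n₂ n₃ n₄ n₅ : ℤ) : Prop :=
  M * jb (Phi (n₁ + n₂ + n₃ + n₄ + n₅) n₁ n₃ n₅) ^ (-(1 - δ)) *
    jb (n₁ + n₂ + n₃ + n₄ + n₅) ^ (2 * δ - 1 / 2) *
    (swt δ n₁ * swt δ n₂ * swt δ n₃ * swt δ n₄ * swt δ n₅) * max (max (jb n₁) (jb n₃)) (jb n₅) ≤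
    A * symKer δ n₁ n₂ n₃ n₄ n₅

/-- A multiplier of size `M` is dominated by the majorant after spending one derivative on the
second or fourth function. -/
def Low (A δ M : ℝ) (n₁ n₂ n₃ n₄ n₅ : ℤ) : Prop :=
  M * (max (jb n₂) (jb n₄))⁻¹ * jb (n₁ + n₂ + n₃ + n₄ + n₅) ^ (1 / 2 + 2 * δ) *
    (swt δ n₁ * swt δ n₂ * swt δ n₃ * swt δ n₄ * swt δ n₅) ≤ A * symKer δ n₁ n₂ n₃ n₄ n₅

theorem Phi_swap₁₃ (n n₁ n₃ n₅ : ℤ) : Phi n n₃ n₁ n₅ = Phi n n₁ n₃ n₅ := by unfold Phi; ring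

theorem Phi_swap₃₅ (n n₁ n₃ n₅ : ℤ) : Phi n n₁ n₅ n₃ = Phi n n₁ n₃ n₅ := by unfold Phi; ring

theorem Phi_neg (n n₁ n₃ n₅ : ℤ) : Phi (-n) (-n₁) (-n₃) (-n₅) = -Phi n n₁ n₃ n₅ := by
  simp only [Phi, abs_neg]; ring

theorem sum_swap₁₃ (n₁ n₂ n₃ n₄ n₅ : ℤ) : n₃ + n₂ + n₁ + n₄ + n₅ = n₁ + n₂ + n₃ + n₄ + n₅ := by
  ring

theorem sum_swap₃₅ (n₁ n₂ n₃ n₄ n₅ : ℤ) : n₁ + n₂ + n₅ + n₄ + n₃ = n₁ + n₂ + n₃ + n₄ + n₅ := by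
  ring

theorem Main₁.swap₁₃ {A δ M : ℝ} {n₁ n₂ n₃ n₄ n₅ : ℤ} (h : Main₁ A δ M n₃ n₂ n₁ n₄ n₅) :
    Main₁ A δ M n₁ n₂ n₃ n₄ n₅ := by
  unfold Main₁ at *
  rw [symKer_swap₁₃, sum_swap₁₃, Phi_swap₁₃] at h
  exact le_trans (le_of_eq (by ring)) h

theorem Main₁.swap₃₅ {A δ M : ℝ} {n₁ n₂ n₃ n₄ n₅ : ℤ} (h : Main₁ A δ M n₁ n₂ n₅ n₄ n₃) :
    Main₁ A δ M n₁ n₂ n₃ n₄ n₅ := by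
  unfold Main₁ at *
  rw [symKer_swap₃₅, sum_swap₃₅, Phi_swap₃₅] at h
  exact le_trans (le_of_eq (by ring)) h

theorem Main₁.neg {A δ M : ℝ} {n₁ n₂ n₃ n₄ n₅ : ℤ}
    (h : Main₁ A δ M (-n₁) (-n₂) (-n₃) (-n₄) (-n₅)) : Main₁ A δ M n₁ n₂ n₃ n₄ n₅ := by
  unfold Main₁ swt at *
  simpa only [symKer_neg, ← neg_add, Phi_neg, jb_neg] using h

theorem Main₃.swap₁₃ {A δ M : ℝ} {n₁ n₂ n₃ n₄ n₅ : ℤ} (h : Main₃ A δ M n₃ n₂ n₁ n₄ n₅) :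
    Main₃ A δ M n₁ n₂ n₃ n₄ n₅ := by
  unfold Main₃ at *
  rw [symKer_swap₁₃, sum_swap₁₃, Phi_swap₁₃, max_comm (jb n₃)] at h
  exact le_trans (le_of_eq (by ring)) h

theorem Main₃.swap₃₅ {A δ M : ℝ} {n₁ n₂ n₃ n₄ n₅ : ℤ} (h : Main₃ A δ M n₁ n₂ n₅ n₄ n₃) :
    Main₃ A δ M n₁ n₂ n₃ n₄ n₅ := by
  unfold Main₃ at *
  rw [symKer_swap₃₅, sum_swap₃₅, Phi_swap₃₅, max_right_comm] at h
  exact le_trans (le_of_eq (by ring)) h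

theorem Main₃.neg {A δ M : ℝ} {n₁ n₂ n₃ n₄ n₅ : ℤ}
    (h : Main₃ A δ M (-n₁) (-n₂) (-n₃) (-n₄) (-n₅)) : Main₃ A δ M n₁ n₂ n₃ n₄ n₅ := by
  unfold Main₃ swt at *
  simpa only [symKer_neg, ← neg_add, Phi_neg, jb_neg] using h

theorem Low.swap₁₃ {A δ M : ℝ} {n₁ n₂ n₃ n₄ n₅ : ℤ} (h : Low A δ M n₃ n₂ n₁ n₄ n₅) :
    Low A δ M n₁ n₂ n₃ n₄ n₅ := by
  unfold Low at *
  rw [symKer_swap₁₃, sum_swap₁₃] at h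
  exact le_trans (le_of_eq (by ring)) h

theorem Low.swap₃₅ {A δ M : ℝ} {n₁ n₂ n₃ n₄ n₅ : ℤ} (h : Low A δ M n₁ n₂ n₅ n₄ n₃) :
    Low A δ M n₁ n₂ n₃ n₄ n₅ := by
  unfold Low at *
  rw [symKer_swap₃₅, sum_swap₃₅] at h
  exact le_trans (le_of_eq (by ring)) h

theorem Low.neg {A δ M : ℝ} {n₁ n₂ n₃ n₄ n₅ : ℤ}
    (h : Low A δ M (-n₁) (-n₂) (-n₃) (-n₄) (-n₅)) : Low A δ M n₁ n₂ n₃ n₄ n₅ := by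
  unfold Low swt at *
  simpa only [symKer_neg, ← neg_add, jb_neg] using h

theorem Main₁.mono {A A' δ M : ℝ} {n₁ n₂ n₃ n₄ n₅ : ℤ} (h : Main₁ A δ M n₁ n₂ n₃ n₄ n₅)
    (hA : A ≤ A') : Main₁ A' δ M n₁ n₂ n₃ n₄ n₅ :=
  le_trans h (mul_le_mul_of_nonneg_right hA (symKer_nonneg _ _ _ _ _ _))

theorem Main₃.mono {A A' δ M : ℝ} {n₁ n₂ n₃ n₄ n₅ : ℤ} (h : Main₃ A δ M n₁ n₂ n₃ n₄ n₅)
    (hA : A ≤ A') : Main₃ A' δ M n₁ n₂ n₃ n₄ n₅ :=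
  le_trans h (mul_le_mul_of_nonneg_right hA (symKer_nonneg _ _ _ _ _ _))

theorem Low.mono {A A' δ M : ℝ} {n₁ n₂ n₃ n₄ n₅ : ℤ} (h : Low A δ M n₁ n₂ n₃ n₄ n₅)
    (hA : A ≤ A') : Low A' δ M n₁ n₂ n₃ n₄ n₅ :=
  le_trans h (mul_le_mul_of_nonneg_right hA (symKer_nonneg _ _ _ _ _ _))

/-- Common last step of the criteria below: the weights in n₂ and n₄ are only carried along, so it
suffices to bound the rest by the first four terms of `majKer`. -/
theorem mul_swt_le_symKer {δ A r : ℝ} (hδ : 0 < δ) (hA : 0 ≤ A) {n₁ n₂ n₃ n₄ n₅ : ℤ}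
    (hr : r ≤ A * (wt δ n₁ * wt δ n₃ + wt δ (n₁ + n₂ + n₃ + n₄ + n₅) * wt δ n₁ +
      jb (n₃ + n₅) ^ (-(1 + δ)) + resKer δ n₁ n₂ n₃ n₄ n₅)) :
    r * (swt δ n₂ * swt δ n₄) ≤ A * symKer δ n₁ n₂ n₃ n₄ n₅ := by
  have h := wt_nonneg δ
  have h1 := h n₁; have h2 := h n₂; have h3 := h n₃; have h4 := h n₄; have h5 := h n₅
  have hw := h (n₁ + n₂ + n₃ + n₄ + n₅)
  have hj : 0 ≤ jb (n₃ + n₅) ^ (-(1 + δ)) := Real.rpow_nonneg (br_pos _).le _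
  have hk := resKer_nonneg δ n₁ n₂ n₃ n₄ n₅
  have s2 := swt_nonneg δ n₂
  have s4 := swt_nonneg δ n₄
  calc r * (swt δ n₂ * swt δ n₄)
      ≤ (A * (wt δ n₁ * wt δ n₃ + wt δ (n₁ + n₂ + n₃ + n₄ + n₅) * wt δ n₁ +
      jb (n₃ + n₅) ^ (-(1 + δ)) + resKer δ n₁ n₂ n₃ n₄ n₅)) * (wt δ n₂ * wt δ n₄) := by
        gcongr
        · exact swt_le_wt hδ _
        · exact swt_le_wt hδ _
    _ ≤ A * majKer δ n₁ n₂ n₃ n₄ n₅ := by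
        rw [mul_assoc]
        gcongr
        unfold majKer
        have : 0 ≤ wt δ n₁ * wt δ n₃ * wt δ n₅ * (wt δ n₂ + wt δ n₄) := by positivity
        linarith
    _ ≤ _ := by gcongr; exact majKer_le_symKer _ _ _ _ _ _

/-! ### Criteria for domination. -/

/-- The parameter Z will be ⟨n₃₅⟩ or ⟨Φ/(2n₁₅)⟩; `hk` says that one of the two Schur kernels covers
it. The gain is ⟨Φ⟩^{-1/2} ≲ Z⁻¹. -/
theorem Main₁.of_resonant {δ C M Z : ℝ} {n₁ n₂ n₃ n₄ n₅ : ℤ} (hδ : 0 < δ) (hδ1 : δ ≤ 1 / 4)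
    (hC : 1 ≤ C) (hM : 0 ≤ M) (hZ : 1 ≤ Z)
    (hk : Z ^ (-(1 + δ)) ≤ jb (n₃ + n₅) ^ (-(1 + δ)) + resKer δ n₁ n₂ n₃ n₄ n₅)
    (hM5 : M ≤ C * jb n₅) (h53 : jb n₅ ≤ C * jb n₃)
    (h01 : jb (n₁ + n₂ + n₃ + n₄ + n₅) ≤ C * jb n₁) (hZ5 : Z ≤ C * jb n₅)
    (hJ : Z ^ 2 ≤ C * jb (Phi (n₁ + n₂ + n₃ + n₄ + n₅) n₁ n₃ n₅)) :
    Main₁ (C ^ 5) δ M n₁ n₂ n₃ n₄ n₅ := by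
  have hF : jb (Phi (n₁ + n₂ + n₃ + n₄ + n₅) n₁ n₃ n₅) ^ (-(1 / 2) : ℝ) ≤ C * Z ^ (-1 : ℝ) := by
    refine (rpow_neg_le_mul hC (by positivity) hJ (by norm_num) (by norm_num)).trans ?_
    rw [← Real.rpow_natCast, ← Real.rpow_mul (by linarith)]
    norm_num
  have h := resonant_le hδ hδ1 hC hM (one_le_br _) (one_le_br _) (one_le_br _) (one_le_br _) hZ
    hM5 h53 h01 hZ5 (Real.rpow_nonneg (br_pos _).le _) hF
  have h2 := mul_swt_le_symKer (δ := δ) (A := C ^ 5) (n₁ := n₁) (n₂ := n₂) (n₃ := n₃) (n₄ := n₄)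
    (n₅ := n₅) hδ (by positivity) (h.trans ?_)
  · exact le_trans (le_of_eq (by unfold swt; simp only [jb_eq_br]; ring)) h2
  · gcongr
    have := wt_nonneg δ n₁; have := wt_nonneg δ n₃
    have := wt_nonneg δ (n₁ + n₂ + n₃ + n₄ + n₅)
    have : 0 ≤ wt δ n₁ * wt δ n₃ + wt δ (n₁ + n₂ + n₃ + n₄ + n₅) * wt δ n₁ := by positivity
    linarith

/-- The same mechanism, with the gain coming from the derivative on n₂ or n₄ instead of Φ. -/
theorem Low.of_resonant {δ C M Z : ℝ} {n₁ n₂ n₃ n₄ n₅ : ℤ} (hδ : 0 < δ) (hδ1 : δ ≤ 1 / 4)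
    (hC : 1 ≤ C) (hM : 0 ≤ M) (hZ : 1 ≤ Z)
    (hk : Z ^ (-(1 + δ)) ≤ jb (n₃ + n₅) ^ (-(1 + δ)) + resKer δ n₁ n₂ n₃ n₄ n₅)
    (hM5 : M ≤ C * jb n₅) (h53 : jb n₅ ≤ C * jb n₃)
    (h01 : jb (n₁ + n₂ + n₃ + n₄ + n₅) ≤ C * jb n₁) (hZ5 : Z ≤ C * jb n₅)
    (hL : Z ≤ C * max (jb n₂) (jb n₄)) :
    Low (C ^ 5) δ M n₁ n₂ n₃ n₄ n₅ := by
  have hl : 1 ≤ max (jb n₂) (jb n₄) := le_max_of_le_left (one_le_br _)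
  have hF : (max (jb n₂) (jb n₄))⁻¹ ≤ C * Z ^ (-1 : ℝ) := by
    rw [← Real.rpow_neg_one]
    exact rpow_neg_le_mul hC (by positivity) hL (by norm_num) (by norm_num)
  have h := resonant_le hδ hδ1 hC hM (one_le_br _) (one_le_br _) (one_le_br _) (one_le_br _) hZ
    hM5 h53 h01 hZ5 (by positivity) hF
  have h2 := mul_swt_le_symKer (δ := δ) (A := C ^ 5) (n₁ := n₁) (n₂ := n₂) (n₃ := n₃) (n₄ := n₄)
    (n₅ := n₅) hδ (by positivity) (h.trans ?_)
  · exact le_trans (le_of_eq (by unfold swt; simp only [jb_eq_br]; ring)) h2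
  · gcongr
    have := wt_nonneg δ n₁; have := wt_nonneg δ n₃
    have := wt_nonneg δ (n₁ + n₂ + n₃ + n₄ + n₅)
    have : 0 ≤ wt δ n₁ * wt δ n₃ + wt δ (n₁ + n₂ + n₃ + n₄ + n₅) * wt δ n₁ := by positivity
    linarith

theorem Main₃.of_resonant {δ C M Z N : ℝ} {n₁ n₂ n₃ n₄ n₅ : ℤ} (hδ : 0 < δ) (hδ1 : δ ≤ 1 / 4)
    (hC : 1 ≤ C) (hM : 0 ≤ M) (hZ : 1 ≤ Z)
    (hk : Z ^ (-(1 + δ)) ≤ jb (n₃ + n₅) ^ (-(1 + δ)) + resKer δ n₁ n₂ n₃ n₄ n₅)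
    (hM5 : M ≤ C * jb n₅) (h53 : jb n₅ ≤ C * jb n₃)
    (h01 : jb (n₁ + n₂ + n₃ + n₄ + n₅) ≤ C * jb n₁)
    (hN : N = max (max (jb n₁) (jb n₃)) (jb n₅))
    (hJ : (N * Z) ^ 2 ≤ C * (jb (n₁ + n₂ + n₃ + n₄ + n₅) ^ 2 *
      jb (Phi (n₁ + n₂ + n₃ + n₄ + n₅) n₁ n₃ n₅))) :
    Main₃ (C ^ 5) δ M n₁ n₂ n₃ n₄ n₅ := by
  have h1N : jb n₁ ≤ N := hN ▸ (le_max_left _ _).trans (le_max_left _ _)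
  have hN1 : 1 ≤ N := (one_le_br _).trans h1N
  have h := resonant_deriv_le hδ hδ1 hC hM (one_le_br _) hN1 (one_le_br _) (one_le_br _)
    (one_le_br _) (one_le_br _) hZ hM5 h53 h01
    (h01.trans (mul_le_mul_of_nonneg_left h1N (by linarith))) hJ
  have h2 := mul_swt_le_symKer (δ := δ) (A := C ^ 5) (n₁ := n₁) (n₂ := n₂) (n₃ := n₃) (n₄ := n₄)
    (n₅ := n₅) hδ (by positivity) (h.trans ?_)
  · unfold Main₃
    rw [← hN]
    exact le_trans (le_of_eq (by unfold swt; simp only [jb_eq_br]; ring)) h2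
  · gcongr
    have := wt_nonneg δ n₁; have := wt_nonneg δ n₃
    have := wt_nonneg δ (n₁ + n₂ + n₃ + n₄ + n₅)
    have : 0 ≤ wt δ n₁ * wt δ n₃ + wt δ (n₁ + n₂ + n₃ + n₄ + n₅) * wt δ n₁ := by positivity
    linarith

theorem Main₁.of_nonresonant₅ {δ C M : ℝ} {n₁ n₂ n₃ n₄ n₅ : ℤ} (hδ : 0 < δ) (hδ1 : δ ≤ 1 / 4)
    (hC : 1 ≤ C) (hM : 0 ≤ M)
    (h0 : jb (n₁ + n₂ + n₃ + n₄ + n₅) ≤ C * jb n₅)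
    (hJ : M ^ 2 * jb (n₁ + n₂ + n₃ + n₄ + n₅) ≤
      C * (jb n₅ * jb (Phi (n₁ + n₂ + n₃ + n₄ + n₅) n₁ n₃ n₅))) :
    Main₁ (C ^ 2) δ M n₁ n₂ n₃ n₄ n₅ := by
  have h := nonresonant_le (x3 := jb n₁) (x5 := jb n₃) hδ hδ1 hC hM (one_le_br _) (one_le_br _)
    (one_le_br _) (one_le_br _) (one_le_br _) h0 hJ
  have h2 := mul_swt_le_symKer (δ := δ) (A := C ^ 2) (n₁ := n₁) (n₂ := n₂) (n₃ := n₃) (n₄ := n₄)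
    (n₅ := n₅) hδ (by positivity) (h.trans ?_)
  · exact le_trans (le_of_eq (by unfold swt; simp only [jb_eq_br]; ring)) h2
  · gcongr
    have := wt_nonneg δ n₁; have := wt_nonneg δ n₃
    have := wt_nonneg δ (n₁ + n₂ + n₃ + n₄ + n₅)
    have h3 : 0 ≤ wt δ (n₁ + n₂ + n₃ + n₄ + n₅) * wt δ n₁ := by positivity
    have hj : 0 ≤ jb (n₃ + n₅) ^ (-(1 + δ)) := Real.rpow_nonneg (br_pos _).le _
    have hk := resKer_nonneg δ n₁ n₂ n₃ n₄ n₅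
    change wt δ n₁ * wt δ n₃ ≤ _
    linarith

/-- The largest of the three inputs is the one whose weight is spent; a permutation moves it to the
fifth place. -/
theorem Main₁.of_nonresonant {δ C M N : ℝ} {n₁ n₂ n₃ n₄ n₅ : ℤ} (hδ : 0 < δ) (hδ1 : δ ≤ 1 / 4)
    (hC : 1 ≤ C) (hM : 0 ≤ M) (hN : N = max (max (jb n₁) (jb n₃)) (jb n₅))
    (h0 : jb (n₁ + n₂ + n₃ + n₄ + n₅) ≤ C * N)
    (hJ : M ^ 2 * jb (n₁ + n₂ + n₃ + n₄ + n₅) ≤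
      C * (N * jb (Phi (n₁ + n₂ + n₃ + n₄ + n₅) n₁ n₃ n₅))) :
    Main₁ (C ^ 2) δ M n₁ n₂ n₃ n₄ n₅ := by
  have hc : N = jb n₁ ∨ N = jb n₃ ∨ N = jb n₅ := by
    rcases max_choice (max (jb n₁) (jb n₃)) (jb n₅) with h | h
    · rcases max_choice (jb n₁) (jb n₃) with h' | h' <;> rw [hN, h, h'] <;> simp
    · rw [hN, h]; simp
  rcases hc with h | h | h
  · rw [h] at h0 hJ
    refine Main₁.swap₁₃ (Main₁.swap₃₅ (Main₁.of_nonresonant₅ hδ hδ1 hC hM ?_ ?_))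
    · rwa [sum_swap₃₅, sum_swap₁₃]
    · rwa [sum_swap₃₅, sum_swap₁₃, Phi_swap₃₅, Phi_swap₁₃]
  · rw [h] at h0 hJ
    refine Main₁.swap₃₅ (Main₁.of_nonresonant₅ hδ hδ1 hC hM ?_ ?_)
    · rwa [sum_swap₃₅]
    · rwa [sum_swap₃₅, Phi_swap₃₅]
  · rw [h] at h0 hJ
    exact Main₁.of_nonresonant₅ hδ hδ1 hC hM h0 hJ

/-- By `h5` the largest input n₅ is balanced by the output or by the second largest input n₃, and
each case has its power count. The output and Φ enter through equations, so that permuted inputs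
need no rewriting of the other hypotheses. -/
theorem Main₃.of_nonresonant_sorted {δ C M : ℝ} {n φ n₁ n₂ n₃ n₄ n₅ : ℤ} (hδ : 0 < δ)
    (hδ1 : δ ≤ 1 / 4) (hC : 1 ≤ C) (hM : 0 ≤ M) (h13 : jb n₁ ≤ jb n₃) (h35 : jb n₃ ≤ jb n₅)
    (hn : n = n₁ + n₂ + n₃ + n₄ + n₅) (hφ : φ = Phi n n₁ n₃ n₅)
    (h0 : jb n ≤ C * jb n₅) (h5 : jb n₅ ≤ C * (jb n + jb n₁ + jb n₃)) (hJ : M ≤ C * jb φ)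
    (hM' : M * jb n₅ ≤ C * (jb n₁ * jb n₃ * jb n₅)) (hM5 : M ≤ C * jb n₅) :
    Main₃ ((3 * C) ^ 4) δ M n₁ n₂ n₃ n₄ n₅ := by
  subst hφ
  subst hn
  have hx := one_le_br
  have x1 : 1 ≤ jb n₁ := hx _
  have x3 : 1 ≤ jb n₃ := hx _
  have x5 : 1 ≤ jb n₅ := hx _
  have x0 : 1 ≤ jb (n₁ + n₂ + n₃ + n₄ + n₅) := hx _
  have xJ : 1 ≤ jb (Phi (n₁ + n₂ + n₃ + n₄ + n₅) n₁ n₃ n₅) := hx _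
  have hC3 : 1 ≤ 3 * C := by linarith
  have hmul : ∀ {a b : ℝ}, 1 ≤ b → a ≤ C * b → a ≤ 3 * C * b := fun {a b} hb h => by
    nlinarith [mul_nonneg (by linarith : 0 ≤ C) (by linarith : 0 ≤ b)]
  have hw1 := wt_nonneg δ n₁; have hw3 := wt_nonneg δ n₃
  have hw0 := wt_nonneg δ (n₁ + n₂ + n₃ + n₄ + n₅)
  have h3 : 0 ≤ wt δ (n₁ + n₂ + n₃ + n₄ + n₅) * wt δ n₁ := by positivity
  have h4 : 0 ≤ wt δ n₁ * wt δ n₃ := by positivity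
  have hj : 0 ≤ jb (n₃ + n₅) ^ (-(1 + δ)) := Real.rpow_nonneg (br_pos _).le _
  have hk := resKer_nonneg δ n₁ n₂ n₃ n₄ n₅
  have key : M * jb (Phi (n₁ + n₂ + n₃ + n₄ + n₅) n₁ n₃ n₅) ^ (-(1 - δ)) *
      jb (n₁ + n₂ + n₃ + n₄ + n₅) ^ (2 * δ - 1 / 2) * (jb n₅ ^ (-(1 / 2 + 2 * δ)) *
      jb n₃ ^ (-(1 / 2 + 2 * δ)) * jb n₁ ^ (-(1 / 2 + 2 * δ))) * jb n₅ ≤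
      (3 * C) ^ 4 * (wt δ n₁ * wt δ n₃ + wt δ (n₁ + n₂ + n₃ + n₄ + n₅) * wt δ n₁ +
      jb (n₃ + n₅) ^ (-(1 + δ)) + resKer δ n₁ n₂ n₃ n₄ n₅) := by
    have hor : jb n₅ ≤ 3 * C * jb (n₁ + n₂ + n₃ + n₄ + n₅) ∨ jb n₅ ≤ 3 * C * jb n₃ := by
      rcases le_total (jb (n₁ + n₂ + n₃ + n₄ + n₅)) (jb n₃) with h | h
      · right
        refine h5.trans ?_
        nlinarith
      · left
        refine h5.trans ?_
        nlinarith
    rcases hor with h | h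
    · have := nonresonant_deriv_le_of_output (x1 := jb n₅) (x3 := jb n₃) (x5 := jb n₁) hδ hδ1 hC3
        hM xJ x0 x5 x3 x1 (hmul xJ hJ) h (by
          have : M ≤ C * (jb n₃ * jb n₁) := by
            refine le_of_mul_le_mul_right (hM'.trans (le_of_eq ?_)) (by linarith : 0 < jb n₅)
            ring
          exact hmul (by nlinarith) this)
      refine this.trans ?_
      have e : (3 * C) ^ 3 ≤ (3 * C) ^ 4 := pow_le_pow_right₀ hC3 (by norm_num)
      change (3 * C) ^ 3 * (wt δ n₃ * wt δ n₁) ≤ _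
      calc (3 * C) ^ 3 * (wt δ n₃ * wt δ n₁) ≤ (3 * C) ^ 4 * (wt δ n₁ * wt δ n₃) := by
            rw [mul_comm (wt δ n₃)]; gcongr
        _ ≤ _ := by gcongr; linarith
    · have := nonresonant_deriv_le_of_inputs (x1 := jb n₅) (x3 := jb n₃) (x5 := jb n₁) hδ hδ1 hC3
        hM xJ x0 x5 x3 x1 (hmul xJ hJ) (hmul x5 h0) h (hmul x5 hM5)
      refine this.trans ?_
      change (3 * C) ^ 4 * (wt δ (n₁ + n₂ + n₃ + n₄ + n₅) * wt δ n₁) ≤ _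
      gcongr
      linarith
  have h2 := mul_swt_le_symKer hδ (by positivity) key
  unfold Main₃
  rw [max_eq_right h13, max_eq_right h35]
  exact le_trans (le_of_eq (by unfold swt; ring)) h2

theorem Main₃.of_nonresonant {δ C M N : ℝ} {n₁ n₂ n₃ n₄ n₅ : ℤ} (hδ : 0 < δ)
    (hδ1 : δ ≤ 1 / 4) (hC : 1 ≤ C) (hM : 0 ≤ M) (hN : N = max (max (jb n₁) (jb n₃)) (jb n₅))
    (h0 : jb (n₁ + n₂ + n₃ + n₄ + n₅) ≤ C * N)
    (h1 : jb n₁ ≤ C * (jb (n₁ + n₂ + n₃ + n₄ + n₅) + jb n₃ + jb n₅))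
    (h3 : jb n₃ ≤ C * (jb (n₁ + n₂ + n₃ + n₄ + n₅) + jb n₁ + jb n₅))
    (h5 : jb n₅ ≤ C * (jb (n₁ + n₂ + n₃ + n₄ + n₅) + jb n₁ + jb n₃))
    (hJ : M ≤ C * jb (Phi (n₁ + n₂ + n₃ + n₄ + n₅) n₁ n₃ n₅))
    (hM' : M * N ≤ C * (jb n₁ * jb n₃ * jb n₅)) (hMN : M ≤ C * N) :
    Main₃ ((3 * C) ^ 4) δ M n₁ n₂ n₃ n₄ n₅ := by
  have hn : ∀ m₁ m₃ m₅ : ℤ, m₁ + m₃ + m₅ = n₁ + n₃ + n₅ →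
      n₁ + n₂ + n₃ + n₄ + n₅ = m₁ + n₂ + m₃ + n₄ + m₅ := by intro m₁ m₃ m₅ h; linarith
  have hab : ∀ a b c : ℝ, a ≤ c → b ≤ c → max (max a b) c = c := fun a b c h h' =>
    max_eq_right (max_le h h')
  rcases le_total (jb n₁) (jb n₃) with h13 | h13 <;> rcases le_total (jb n₃) (jb n₅) with h35 | h35
  · rw [hab _ _ _ (h13.trans h35) h35] at hN
    subst hN
    exact Main₃.of_nonresonant_sorted hδ hδ1 hC hM h13 h35 rfl rfl h0 h5 hJ hM' hMN
  · rw [max_right_comm, hab _ _ _ h13 h35] at hN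
    subst hN
    rcases le_total (jb n₁) (jb n₅) with h15 | h15
    · exact (Main₃.of_nonresonant_sorted hδ hδ1 hC hM h15 h35 (hn _ _ _ (by ring))
        (by unfold Phi; ring) h0 (by linarith) hJ (by linarith) hMN).swap₃₅
    · exact (Main₃.of_nonresonant_sorted hδ hδ1 hC hM h15 h13 (hn _ _ _ (by ring))
        (by unfold Phi; ring) h0 (by linarith) hJ (by linarith) hMN).swap₁₃.swap₃₅
  · rcases le_total (jb n₁) (jb n₅) with h15 | h15
    · rw [hab _ _ _ h15 h35] at hN
      subst hN
      exact (Main₃.of_nonresonant_sorted hδ hδ1 hC hM h13 h15 (hn _ _ _ (by ring))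
        (by unfold Phi; ring) h0 (by linarith) hJ (by linarith) hMN).swap₁₃
    · rw [max_comm (jb n₁), max_right_comm, hab _ _ _ h13 h15] at hN
      subst hN
      exact (Main₃.of_nonresonant_sorted hδ hδ1 hC hM h35 h15 (hn _ _ _ (by ring))
        (by unfold Phi; ring) h0 (by linarith) hJ (by linarith) hMN).swap₃₅.swap₁₃
  · rw [max_comm (jb n₁), max_right_comm, hab _ _ _ h13 (h35.trans h13)] at hN
    subst hN
    exact (Main₃.of_nonresonant_sorted hδ hδ1 hC hM h35 h13 (hn _ _ _ (by ring))
        (by unfold Phi; ring) h0 (by linarith) hJ (by linarith) hMN).swap₁₃.swap₃₅.swap₁₃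

theorem Low.of_low_output {δ C M : ℝ} {n₁ n₂ n₃ n₄ n₅ : ℤ} (hδ : 0 < δ) (hδ1 : δ ≤ 1 / 4)
    (hC : 1 ≤ C) (h53 : jb n₅ ≤ C * jb n₃) (hM5 : M ≤ C * jb n₅)
    (h05 : jb (n₁ + n₂ + n₃ + n₄ + n₅) ≤ C * jb n₅)
    (h0l : jb (n₁ + n₂ + n₃ + n₄ + n₅) ≤ C * max (jb n₂) (jb n₄)) :
    Low (C ^ 4) δ M n₁ n₂ n₃ n₄ n₅ := by
  have h := low_output_le (M := M) (x1 := jb n₁) hδ hδ1 hC (le_max_of_le_left (one_le_br _))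
    (one_le_br _) (one_le_br _) (one_le_br _) (one_le_br _) h53 hM5 h05 h0l
  have h2 := mul_swt_le_symKer (δ := δ) (A := C ^ 4) (n₁ := n₁) (n₂ := n₂) (n₃ := n₃) (n₄ := n₄)
    (n₅ := n₅) hδ (by positivity) (h.trans ?_)
  · exact le_trans (le_of_eq (by unfold swt; simp only [jb_eq_br]; ring)) h2
  · gcongr
    have := wt_nonneg δ n₁; have := wt_nonneg δ n₃
    have h3 : 0 ≤ wt δ n₁ * wt δ n₃ := by positivity
    have hj : 0 ≤ jb (n₃ + n₅) ^ (-(1 + δ)) := Real.rpow_nonneg (br_pos _).le _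
    have hk := resKer_nonneg δ n₁ n₂ n₃ n₄ n₅
    change wt δ (n₁ + n₂ + n₃ + n₄ + n₅) * wt δ n₁ ≤ _
    linarith

theorem jb_add_le_mul (a b : ℤ) : jb (a + b) ≤ 3 * (jb a * jb b) := by
  have h := br_le_one_add_abs ((a + b : ℤ) : ℝ)
  have h1 := abs_add_le (a : ℝ) b
  have ha := abs_le_br (a : ℝ); have hb := abs_le_br (b : ℝ)
  have ha1 := one_le_br (a : ℝ); have hb1 := one_le_br (b : ℝ)
  simp only [jb_eq_br]
  push_cast at *
  nlinarith [mul_nonneg (sub_nonneg.2 ha1) (sub_nonneg.2 hb1)]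

theorem jb_sum_le_max (n₁ n₂ n₃ n₄ n₅ : ℤ) : ∃ m ∈ [n₁, n₂, n₃, n₄, n₅],
    jb (n₁ + n₂ + n₃ + n₄ + n₅) ≤ 5 * jb m := by
  have hex : ∃ m ∈ [n₁, n₂, n₃, n₄, n₅], ∀ k ∈ [n₁, n₂, n₃, n₄, n₅], |k| ≤ |m| := by
    obtain ⟨m, hm, h⟩ := Finset.exists_max_image [n₁, n₂, n₃, n₄, n₅].toFinset (fun k => |k|)
      ⟨n₁, by simp⟩
    exact ⟨m, by simpa using hm, fun k hk => h k (by simpa using hk)⟩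
  obtain ⟨m, hm, h⟩ := hex
  refine ⟨m, hm, br_le_mul_of_abs_le (by norm_num) ?_⟩
  have h1 := h n₁ (by simp); have h2 := h n₂ (by simp); have h3 := h n₃ (by simp)
  have h4 := h n₄ (by simp); have h5 := h n₅ (by simp)
  have : |n₁ + n₂ + n₃ + n₄ + n₅| ≤ 5 * |m| := by
    rw [abs_le] at *
    constructor <;> linarith [h1.1, h1.2, h2.1, h2.2, h3.1, h3.2, h4.1, h4.2, h5.1, h5.2]
  exact_mod_cast this

/-- The derivative on n₂ or n₄ pays for the whole multiplier. The largest of the five inputs absorbs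
the output weight, and Young's inequality uses the other four. -/
theorem Low.of_le {δ C M : ℝ} {n₁ n₂ n₃ n₄ n₅ : ℤ} (hδ : 0 < δ) (hδ1 : δ ≤ 1 / 4)
    (hC : 0 ≤ C) (hM : M ≤ C * max (jb n₂) (jb n₄)) :
    Low (C * 5) δ M n₁ n₂ n₃ n₄ n₅ := by
  have hl : 1 ≤ max (jb n₂) (jb n₄) := le_max_of_le_left (one_le_br _)
  have hMl : M * (max (jb n₂) (jb n₄))⁻¹ ≤ C := by
    rw [← div_eq_mul_inv, div_le_iff₀ (by linarith)]; exact hM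
  have hs := swt_nonneg δ
  have s1 := hs n₁; have s2 := hs n₂; have s3 := hs n₃; have s4 := hs n₄; have s5 := hs n₅
  have hw := wt_nonneg δ
  have w1 := hw n₁; have w2 := hw n₂; have w3 := hw n₃; have w4 := hw n₄; have w5 := hw n₅
  have w0 := hw (n₁ + n₂ + n₃ + n₄ + n₅)
  have t1 := swt_le_wt hδ n₁; have t2 := swt_le_wt hδ n₂; have t3 := swt_le_wt hδ n₃
  have t4 := swt_le_wt hδ n₄; have t5 := swt_le_wt hδ n₅
  have hx0 : 0 ≤ jb (n₁ + n₂ + n₃ + n₄ + n₅) ^ (1 / 2 + 2 * δ) :=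
    Real.rpow_nonneg (br_pos _).le _
  have hmaj : ∀ m₁ m₃ m₅ : ℤ, wt δ n₂ * wt δ n₄ * (wt δ m₁ * wt δ m₃) +
      wt δ m₁ * wt δ m₃ * wt δ m₅ * (wt δ n₂ + wt δ n₄) ≤ majKer δ m₁ n₂ m₃ n₄ m₅ := by
    intro m₁ m₃ m₅
    unfold majKer
    have hj : 0 ≤ jb (m₃ + m₅) ^ (-(1 + δ)) := Real.rpow_nonneg (br_pos _).le _
    have hk := resKer_nonneg δ m₁ n₂ m₃ n₄ m₅
    have := hw m₁; have := hw (m₁ + n₂ + m₃ + n₄ + m₅)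
    gcongr
    have : 0 ≤ wt δ (m₁ + n₂ + m₃ + n₄ + m₅) * wt δ m₁ := by positivity
    linarith
  have key : jb (n₁ + n₂ + n₃ + n₄ + n₅) ^ (1 / 2 + 2 * δ) *
      (swt δ n₁ * swt δ n₂ * swt δ n₃ * swt δ n₄ * swt δ n₅) ≤
      5 * symKer δ n₁ n₂ n₃ n₄ n₅ := by
    obtain ⟨m, hm, h⟩ := jb_sum_le_max n₁ n₂ n₃ n₄ n₅
    have hr : jb (n₁ + n₂ + n₃ + n₄ + n₅) ^ (1 / 2 + 2 * δ) * swt δ m ≤ 5 :=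
      rpow_mul_rpow_neg_le (by norm_num) (br_pos _).le (br_pos _) h (by linarith) (by linarith)
    have p12 : 0 ≤ wt δ n₁ * wt δ n₃ * wt δ n₅ * wt δ n₂ := by positivity
    have p14 : 0 ≤ wt δ n₁ * wt δ n₃ * wt δ n₅ * wt δ n₄ := by positivity
    have q1 : 0 ≤ wt δ n₂ * wt δ n₄ * (wt δ n₃ * wt δ n₅) := by positivity
    have q3 : 0 ≤ wt δ n₂ * wt δ n₄ * (wt δ n₁ * wt δ n₅) := by positivity
    have q5 : 0 ≤ wt δ n₂ * wt δ n₄ * (wt δ n₁ * wt δ n₃) := by positivity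
    have m5 := (hmaj n₁ n₃ n₅).trans (majKer_le_symKer δ n₁ n₂ n₃ n₄ n₅)
    have m3 := (hmaj n₁ n₅ n₃).trans (majKer_le_symKer δ n₁ n₂ n₅ n₄ n₃)
    have m1 := (hmaj n₃ n₅ n₁).trans (majKer_le_symKer δ n₃ n₂ n₅ n₄ n₁)
    rw [symKer_swap₃₅] at m3
    rw [symKer_swap₃₅, symKer_swap₁₃] at m1
    generalize jb (n₁ + n₂ + n₃ + n₄ + n₅) ^ (1 / 2 + 2 * δ) = X at *
    have split : ∀ a b c d e w₁ w₂ w₃ w₄ : ℝ, 0 ≤ a → 0 ≤ b → 0 ≤ c → 0 ≤ d → a ≤ w₁ → b ≤ w₂ →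
        c ≤ w₃ → d ≤ w₄ → X * e ≤ 5 → X * e * (a * b * c * d) ≤ 5 * (w₁ * w₂ * w₃ * w₄) := by
      intro a b c d e w₁ w₂ w₃ w₄ ha hb hc hd h1 h2 h3 h4 h5
      have : 0 ≤ w₁ := ha.trans h1
      have : 0 ≤ w₂ := hb.trans h2
      have : 0 ≤ w₃ := hc.trans h3
      gcongr
    simp only [List.mem_cons, List.not_mem_nil, or_false] at hm
    rcases hm with rfl | rfl | rfl | rfl | rfl
    · have := split _ _ _ _ _ _ _ _ _ s2 s3 s4 s5 t2 t3 t4 t5 hr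
      linarith
    · have := split _ _ _ _ _ _ _ _ _ s1 s3 s4 s5 t1 t3 t4 t5 hr
      linarith
    · have := split _ _ _ _ _ _ _ _ _ s1 s2 s4 s5 t1 t2 t4 t5 hr
      linarith
    · have := split _ _ _ _ _ _ _ _ _ s1 s2 s3 s5 t1 t2 t3 t5 hr
      linarith
    · have := split _ _ _ _ _ _ _ _ _ s1 s2 s3 s4 t1 t2 t3 t4 hr
      linarith
  unfold Low
  rw [mul_assoc (M * _), mul_assoc C]
  have : 0 ≤ symKer δ n₁ n₂ n₃ n₄ n₅ := symKer_nonneg _ _ _ _ _ _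
  gcongr

/-! ### Elementary analysis of the resonance function. -/

/-- If u and v lie within N/16 of p, then n = u + v + e − p is close to p as well, e being
negligible; all four are then close to the largest. -/
theorem comparable_of_close {n p u v e L N : ℝ} (hn : 0 ≤ n) (hp : 0 ≤ p)
    (hs : n + p = u + v + e) (he : |e| ≤ 2 * L) (hLN : 1024 * L ≤ N)
    (hN : N = n ∨ N = p ∨ N = u ∨ N = v) (ha : |u - p| < N / 16) (hb : |v - p| ≤ |u - p|) :
    N ≤ 4 * n ∧ N ≤ 4 * p ∧ N ≤ 4 * u ∧ N ≤ 4 * v := by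
  have hb' := abs_le.1 (hb.trans ha.le)
  have ha' := abs_le.1 ha.le
  have he' := abs_le.1 he
  have hp' : N ≤ 2 * p := by
    rcases hN with h | h | h | h <;> linarith [hb'.1, hb'.2, ha'.1, ha'.2, he'.1, he'.2]
  refine ⟨?_, ?_, ?_, ?_⟩ <;> linarith [hb'.1, hb'.2, ha'.1, ha'.2, he'.1, he'.2]

/-- From n − u = (v − p) + e: when v − p and e are small against one side of the relation, n is
paired with u and p with v. -/
theorem comparable_of_small {n p u v e L : ℝ} (hn : 0 ≤ n) (hp : 0 ≤ p) (hu : 0 ≤ u) (hv : 0 ≤ v)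
    (hs : n + p = u + v + e) (he : |e| ≤ 2 * L)
    (h : (1024 * L ≤ n ∧ 1024 * L ≤ p ∧ 6 * |v - p| ≤ n ∧ 6 * |v - p| ≤ p) ∨
      (1024 * L ≤ u ∧ 1024 * L ≤ v ∧ 6 * |v - p| ≤ u ∧ 6 * |v - p| ≤ v)) :
    p ≤ 2 * v ∧ n ≤ 2 * u ∧ v ≤ 2 * p ∧ |v - p| ≤ p ∧ L ≤ n := by
  have he' := abs_le.1 he
  have hb' := abs_le.1 (le_refl |v - p|)
  have hL : 0 ≤ L := by linarith [abs_nonneg e]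
  rcases h with ⟨h1, h2, h3, h4⟩ | ⟨h1, h2, h3, h4⟩ <;> refine ⟨?_, ?_, ?_, ?_, ?_⟩ <;>
    linarith [he'.1, he'.2, hb'.1, hb'.2]

/-- The size of the resonance function `φ = n² + p² - u² - v²` on `n + p = u + v + e`. -/
theorem resonance_cases {n p u v e L M N φ : ℝ} (hn : 0 ≤ n) (hp : 0 ≤ p) (hu : 0 ≤ u)
    (hv : 0 ≤ v) (hs : n + p = u + v + e) (he : |e| ≤ 2 * L) (hM : 0 ≤ M)
    (hN : N = max (max n p) (max u v)) (hφ : φ = n ^ 2 + p ^ 2 - u ^ 2 - v ^ 2)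
    (hb1 : 1 ≤ |v - p|) (hba : |v - p| ≤ |u - p|)
    (hH : (1 ≤ n ∧ 1024 * L ≤ n ∧ 1024 * L ≤ p ∧ M ≤ 2 * p) ∨
      (1024 * L ≤ u ∧ 1024 * L ≤ v ∧ M ≤ 2 * u ∧ M ≤ 2 * v)) :
    (N ≤ 4 * n ∧ N ≤ 4 * p ∧ N ≤ 4 * u ∧ N ≤ 4 * v) ∨
    (N * |v - p| ≤ 16 * |φ| ∧ M ^ 2 * (n + 1) ≤ 512 * (N ^ 2 * |v - p|)) ∨
    (N * |v - p| ≤ 16 * |φ| ∧ p ≤ 2 * v ∧ n ≤ 2 * u ∧ v ≤ 2 * p ∧ |v - p| ≤ p) ∨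
    (N * |v - p| ≤ 128 * (L * n) ∧ p ≤ 2 * v ∧ n ≤ 2 * u ∧ v ≤ 2 * p ∧ |v - p| ≤ p) := by
  have hL : 0 ≤ L := by linarith [abs_nonneg e]
  have hnN : n ≤ N := hN ▸ (le_max_left n p).trans (le_max_left _ _)
  have hpN : p ≤ N := hN ▸ (le_max_right n p).trans (le_max_left _ _)
  have huN : u ≤ N := hN ▸ (le_max_left u v).trans (le_max_right _ _)
  have hvN : v ≤ N := hN ▸ (le_max_right u v).trans (le_max_right _ _)
  have hLN : 1024 * L ≤ N := by rcases hH with h | h <;> linarith [h.2.1, h.1]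
  have hor : N = n ∨ N = p ∨ N = u ∨ N = v := by
    rcases max_choice (max n p) (max u v) with h | h
    · rcases max_choice n p with h' | h' <;> rw [hN, h, h'] <;> simp
    · rcases max_choice u v with h' | h' <;> rw [hN, h, h'] <;> simp
  have hbN : |v - p| ≤ N := abs_le.2 ⟨by linarith, by linarith⟩
  have hN1 : 1 ≤ N := hb1.trans hbN
  -- Small |u − p| makes all four frequencies comparable. Otherwise N|v − p| is controlled by |u −
  -- p||v − p|.
  by_cases ha : |u - p| < N / 16
  · exact Or.inl (comparable_of_close hn hp hs he hLN hor ha hba)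
  right
  push Not at ha
  -- The resonance identity; e(2n − e) is the error caused by the even frequencies.
  have hφ' : φ = 2 * ((u - p) * (v - p)) + e * (2 * n - e) := by
    rw [hφ, show n = u + v + e - p by linarith]; ring
  have hNa : N * |v - p| ≤ 16 * (|u - p| * |v - p|) := by
    nlinarith [abs_nonneg (v - p)]
  by_cases hE : |e * (2 * n - e)| ≤ |u - p| * |v - p|
  · have hφl : |u - p| * |v - p| ≤ |φ| := by
      have h1 := abs_sub_abs_le_abs_sub (2 * ((u - p) * (v - p))) (-(e * (2 * n - e)))
      rw [sub_neg_eq_add, ← hφ', abs_neg, abs_mul 2, abs_mul (u - p), abs_two] at h1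
      linarith
    have hB : N * |v - p| ≤ 16 * |φ| := by linarith
    -- If this fails, the upper bounds on M make |v − p| small against both frequencies on one side,
    -- and the pairing n ~ u, p ~ v follows.
    by_cases hq : M ^ 2 * (n + 1) ≤ 512 * (N ^ 2 * |v - p|)
    · exact Or.inl ⟨hB, hq⟩
    right; left
    push Not at hq
    refine ⟨hB, ?_⟩
    have hN2 : 0 < N ^ 2 := by positivity
    have fin : ∀ t, M ^ 2 * (n + 1) ≤ 8 * (N ^ 2 * t) → 6 * |v - p| ≤ t := by
      intro t ht
      have : N ^ 2 * (512 * |v - p|) ≤ N ^ 2 * (8 * t) := by linarith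
      have := le_of_mul_le_mul_left this hN2
      linarith [abs_nonneg (v - p)]
    have base : ∀ t, 0 ≤ t → t ≤ N → M ≤ 2 * t → M ^ 2 * (n + 1) ≤ 8 * (N ^ 2 * t) := by
      intro t ht htN hMt
      calc M ^ 2 * (n + 1) ≤ (2 * t) ^ 2 * (N + N) := by gcongr
        _ = 8 * (t * t * N) := by ring
        _ ≤ 8 * (t * N * N) := by gcongr
        _ = _ := by ring
    have := comparable_of_small hn hp hu hv hs he (by
      rcases hH with ⟨h1, h2, h3, h4⟩ | ⟨h1, h2, h3, h4⟩
      · refine Or.inl ⟨h2, h3, fin n ?_, fin p (base p hp hpN h4)⟩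
        calc M ^ 2 * (n + 1) ≤ (2 * N) ^ 2 * (n + n) := by gcongr; linarith
          _ = _ := by ring
      · exact Or.inr ⟨h1, h2, fin u (base u hu huN h3), fin v (base v hv hvN h4)⟩)
    exact ⟨this.1, this.2.1, this.2.2.1, this.2.2.2.1⟩
  · right; right
    push Not at hE
    have hE' : N * |v - p| ≤ 32 * (L * |2 * n - e|) := by
      rw [abs_mul] at hE
      have : |e| * |2 * n - e| ≤ 2 * L * |2 * n - e| := by gcongr
      linarith
    have he' := abs_le.1 he
    have h4N : |2 * n - e| ≤ 5 / 2 * N := abs_le.2 ⟨by linarith, by linarith⟩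
    -- The error term dominates the product, which forces v − p = O(L); the constant is 32 · 5/2.
    have hbL : |v - p| ≤ 80 * L := by
      have : N * |v - p| ≤ N * (80 * L) := by
        calc N * |v - p| ≤ 32 * (L * |2 * n - e|) := hE'
          _ ≤ 32 * (L * (5 / 2 * N)) := by gcongr
          _ = _ := by ring
      exact le_of_mul_le_mul_left this (by linarith)
    have := comparable_of_small hn hp hu hv hs he (by
      rcases hH with ⟨h1, h2, h3, h4⟩ | ⟨h1, h2, h3, h4⟩
      · refine Or.inl ⟨h2, h3, by linarith, by linarith⟩
      · exact Or.inr ⟨h1, h2, by linarith, by linarith⟩)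
    refine ⟨?_, this.1, this.2.1, this.2.2.1, this.2.2.2.1⟩
    have h4n : |2 * n - e| ≤ 4 * n :=
      abs_le.2 ⟨by linarith [this.2.2.2.2], by linarith [this.2.2.2.2]⟩
    calc N * |v - p| ≤ 32 * (L * |2 * n - e|) := hE'
      _ ≤ 32 * (L * (4 * n)) := by gcongr
      _ = _ := by ring

/-- The same analysis where the resonance function is bounded by `L²`. -/
theorem low_resonance_cases {n p u v e L N φ : ℝ} (hn : 0 ≤ n) (hp : 0 ≤ p) (hu : 0 ≤ u)
    (hv : 0 ≤ v) (hs : n + p = u + v + e) (he : |e| ≤ 2 * L)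
    (hN : N = max (max n p) (max u v)) (hφ : φ = n ^ 2 + p ^ 2 - u ^ 2 - v ^ 2)
    (hφL : |φ| ≤ L ^ 2) (hb1 : 1 ≤ |v - p|) (hba : |v - p| ≤ |u - p|)
    (hH : (1024 * L ≤ n ∧ 1024 * L ≤ p) ∨ (1024 * L ≤ u ∧ 1024 * L ≤ v)) :
    (N ≤ 4 * n ∧ N ≤ 4 * p ∧ N ≤ 4 * u ∧ N ≤ 4 * v) ∨
    (|v - p| ≤ 80 * L ∧ p ≤ 2 * v ∧ n ≤ 2 * u ∧ v ≤ 2 * p ∧ |v - p| ≤ p) := by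
  have hL : 0 ≤ L := by linarith [abs_nonneg e]
  have hnN : n ≤ N := hN ▸ (le_max_left n p).trans (le_max_left _ _)
  have hpN : p ≤ N := hN ▸ (le_max_right n p).trans (le_max_left _ _)
  have huN : u ≤ N := hN ▸ (le_max_left u v).trans (le_max_right _ _)
  have hvN : v ≤ N := hN ▸ (le_max_right u v).trans (le_max_right _ _)
  have hLN : 1024 * L ≤ N := by rcases hH with h | h <;> linarith [h.2, h.1]
  have hor : N = n ∨ N = p ∨ N = u ∨ N = v := by
    rcases max_choice (max n p) (max u v) with h | h
    · rcases max_choice n p with h' | h' <;> rw [hN, h, h'] <;> simp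
    · rcases max_choice u v with h' | h' <;> rw [hN, h, h'] <;> simp
  have hbN : |v - p| ≤ N := abs_le.2 ⟨by linarith, by linarith⟩
  have hN1 : 1 ≤ N := hb1.trans hbN
  by_cases ha : |u - p| < N / 16
  · exact Or.inl (comparable_of_close hn hp hs he hLN hor ha hba)
  right
  push Not at ha
  have hφ' : φ = 2 * ((u - p) * (v - p)) + e * (2 * n - e) := by
    rw [hφ, show n = u + v + e - p by linarith]; ring
  have hNa : N * |v - p| ≤ 16 * (|u - p| * |v - p|) := by
    nlinarith [abs_nonneg (v - p)]
  have he' := abs_le.1 he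
  have h4N : |2 * n - e| ≤ 5 / 2 * N := abs_le.2 ⟨by linarith, by linarith⟩
  have h2ab : 2 * (|u - p| * |v - p|) ≤ |φ| + |e| * |2 * n - e| := by
    have h1 := abs_sub (φ) (e * (2 * n - e))
    rw [show φ - e * (2 * n - e) = 2 * ((u - p) * (v - p)) by linarith, abs_mul 2,
      abs_mul (u - p), abs_two, abs_mul e] at h1
    exact h1
  -- Here φ is itself an error term, as |φ| ≤ L² ≤ LN.
  have hbL : |v - p| ≤ 80 * L := by
    have : N * |v - p| ≤ N * (80 * L) := by
      calc N * |v - p| ≤ 8 * (|φ| + |e| * |2 * n - e|) := by linarith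
        _ ≤ 8 * (L * N + 2 * L * (5 / 2 * N)) := by
            gcongr
            calc |φ| ≤ L * L := by linarith [hφL]
              _ ≤ L * N := by gcongr; linarith
        _ ≤ N * (80 * L) := by nlinarith [mul_nonneg hL (by linarith : 0 ≤ N)]
    exact le_of_mul_le_mul_left this (by linarith)
  have := comparable_of_small hn hp hu hv hs he (by
    rcases hH with ⟨h1, h2⟩ | ⟨h1, h2⟩
    · refine Or.inl ⟨h1, h2, by linarith, by linarith⟩
    · exact Or.inr ⟨h1, h2, by linarith, by linarith⟩)
  exact ⟨hbL, this.1, this.2.1, this.2.2.1, this.2.2.2.1⟩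

/-! ### The resonant sign pattern. -/

theorem Phi_resonant {n n₁ n₃ n₅ : ℤ} (hn : 0 ≤ n) (h1 : 0 ≤ n₁) (h3 : 0 ≤ n₃) (h5 : n₅ ≤ 0) :
    ((Phi n n₁ n₃ n₅ : ℤ) : ℝ) = (n : ℝ) ^ 2 + (-n₅ : ℝ) ^ 2 - (n₁ : ℝ) ^ 2 - (n₃ : ℝ) ^ 2 := by
  unfold Phi
  rw [abs_of_nonneg hn, abs_of_nonneg h1, abs_of_nonneg h3, abs_of_nonpos h5]
  push_cast; ring

/-- The resonance identity again: in this sign pattern the second Schur kernel is a power of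
⟨Φ/(2n₁₅)⟩, so smallness of Φ can be compensated by it. -/
theorem resKer_eq {δ : ℝ} {n₁ n₂ n₃ n₄ n₅ : ℤ} (hn : 0 ≤ n₁ + n₂ + n₃ + n₄ + n₅) (h1 : 0 ≤ n₁)
    (h3 : 0 ≤ n₃) (h5 : n₅ ≤ 0) (he : 4 * |n₂ + n₄| ≤ |n₁ + n₅|) (ha : n₁ + n₅ ≠ 0) :
    resKer δ n₁ n₂ n₃ n₄ n₅ =
      br ((Phi (n₁ + n₂ + n₃ + n₄ + n₅) n₁ n₃ n₅ : ℤ) / (2 * (n₁ + n₅) : ℝ)) ^ (-(1 + δ)) := by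
  unfold resKer
  rw [if_pos ⟨he, ha⟩, Phi_resonant hn h1 h3 h5]
  have h0 : (n₁ + n₅ : ℝ) ≠ 0 := by exact_mod_cast ha
  congr 2
  field_simp
  push_cast
  ring

-- The alternatives in `hH` are the two origins of the pattern: multipliers controlled by n₅, with
-- the output positive and large, and multipliers controlled by two inputs, which after relabelling
-- sit at n₁ and n₃. The order |n₃₅| ≤ |n₁₅| is arranged by symmetry in the applications.
set_option maxHeartbeats 1600000 in
theorem main_of_resonant {δ M L : ℝ} {n₁ n₂ n₃ n₄ n₅ : ℤ} (hδ : 0 < δ) (hδ1 : δ ≤ 1 / 4)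
    (hM : 0 ≤ M) (hn : 0 ≤ n₁ + n₂ + n₃ + n₄ + n₅) (h1 : 0 ≤ n₁) (h3 : 0 ≤ n₃) (h5 : n₅ ≤ 0)
    (hb : n₃ + n₅ ≠ 0) (hab : |n₃ + n₅| ≤ |n₁ + n₅|)
    (h2L : |(n₂ : ℝ)| ≤ L) (h4L : |(n₄ : ℝ)| ≤ L)
    (hH : (1 ≤ ((n₁ + n₂ + n₃ + n₄ + n₅ : ℤ) : ℝ) ∧
        1024 * L ≤ ((n₁ + n₂ + n₃ + n₄ + n₅ : ℤ) : ℝ) ∧ 1024 * L ≤ -n₅ ∧ M ≤ 2 * (-n₅)) ∨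
      (1024 * L ≤ n₁ ∧ 1024 * L ≤ n₃ ∧ M ≤ 2 * n₁ ∧ M ≤ 2 * n₃))
    (hΦ : L ^ 2 ≤ |((Phi (n₁ + n₂ + n₃ + n₄ + n₅) n₁ n₃ n₅ : ℤ) : ℝ)|) :
    Main₁ (2 ^ 100) δ M n₁ n₂ n₃ n₄ n₅ ∧ Main₃ (2 ^ 100) δ M n₁ n₂ n₃ n₄ n₅ := by
  have hφ := Phi_resonant hn h1 h3 h5
  have hres := fun he ha => resKer_eq (δ := δ) hn h1 h3 h5 he ha
  set φ : ℤ := Phi (n₁ + n₂ + n₃ + n₄ + n₅) n₁ n₃ n₅ with hφdef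
  set n : ℤ := n₁ + n₂ + n₃ + n₄ + n₅ with hndef
  have hnR : (0 : ℝ) ≤ n := by exact_mod_cast hn
  have hpR : (0 : ℝ) ≤ -n₅ := by exact_mod_cast (by linarith : 0 ≤ -n₅)
  have huR : (0 : ℝ) ≤ n₁ := by exact_mod_cast h1
  have hvR : (0 : ℝ) ≤ n₃ := by exact_mod_cast h3
  have hs : (n : ℝ) + -n₅ = n₁ + n₃ + (n₂ + n₄) := by rw [hndef]; push_cast; ring
  have he : |(n₂ + n₄ : ℝ)| ≤ 2 * L := (abs_add_le _ _).trans (by linarith)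
  have hL : 0 ≤ L := (abs_nonneg _).trans h2L
  have hb1 : 1 ≤ |(n₃ - -n₅ : ℝ)| := by
    rw [sub_neg_eq_add]; exact_mod_cast Int.one_le_abs hb
  have hba : |(n₃ - -n₅ : ℝ)| ≤ |(n₁ - -n₅ : ℝ)| := by
    rw [sub_neg_eq_add, sub_neg_eq_add]; exact_mod_cast hab
  obtain ⟨N, hN⟩ : ∃ N, N = max (max (n : ℝ) (-n₅)) (max (n₁ : ℝ) n₃) := ⟨_, rfl⟩
  have hcases := resonance_cases hnR hpR huR hvR hs he hM hN hφ hb1 hba hH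
  have hnN : (n : ℝ) ≤ N := hN ▸ (le_max_left _ _).trans (le_max_left _ _)
  have hpN : (-n₅ : ℝ) ≤ N := hN ▸ (le_max_right _ _).trans (le_max_left _ _)
  have huN : (n₁ : ℝ) ≤ N := hN ▸ (le_max_left _ _).trans (le_max_right _ _)
  have hvN : (n₃ : ℝ) ≤ N := hN ▸ (le_max_right _ _).trans (le_max_right _ _)
  rw [sub_neg_eq_add] at hcases hb1 hba
  rw [sub_neg_eq_add] at hba
  have hN1 : 1 ≤ N := hb1.trans (abs_le.2 ⟨by linarith, by linarith⟩)
  have x5 : jb n₅ = br (-n₅) := by rw [jb_eq_br, br_neg]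
  have hp5 : (-n₅ : ℝ) ≤ jb n₅ := by
    rw [x5]; exact (le_abs_self _).trans (abs_le_br _)
  have hn0 : (n : ℝ) ≤ jb n := (le_abs_self _).trans (abs_le_br _)
  have x5' : 1 ≤ jb n₅ := one_le_br _
  have x0 : 1 ≤ jb n := one_le_br _
  have x1 : 1 ≤ jb n₁ := one_le_br _
  have x3 : 1 ≤ jb n₃ := one_le_br _
  have hJ1 : 1 ≤ jb φ := one_le_br _
  have hJ : |(φ : ℝ)| ≤ jb φ := abs_le_br _
  have cmp : ∀ {c x y : ℝ}, 0 ≤ x → 0 ≤ y → 1 ≤ c → x ≤ c * y → br x ≤ c * br y := by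
    intro c x y hx hy hc h
    exact br_le_mul_of_abs_le hc (by rwa [abs_of_nonneg hx, abs_of_nonneg hy])
  set N' := max (max (jb n₁) (jb n₃)) (jb n₅) with hN'
  have hN'N : N' ≤ br N := by
    refine max_le (max_le ?_ ?_) ?_
    · exact br_le_br (abs_le_abs_of_nonneg huR huN)
    · exact br_le_br (abs_le_abs_of_nonneg hvR hvN)
    · rw [x5]; exact br_le_br (abs_le_abs_of_nonneg hpR hpN)
  have hN'1 : 1 ≤ N' := x5'.trans (le_max_right _ _)
  have hbrN : br N ≤ 2 * N := by
    have := br_le_mul_abs (y := N) (by rwa [abs_of_nonneg (by linarith)])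
    rwa [abs_of_nonneg (by linarith)] at this
  have hMN : M ≤ 2 * N := by rcases hH with h | h <;> linarith [h.2.2.2]
  have hZjb : jb (n₃ + n₅) ^ (-(1 + δ)) ≤ jb (n₃ + n₅) ^ (-(1 + δ)) + resKer δ n₁ n₂ n₃ n₄ n₅ :=
    le_add_of_nonneg_right (resKer_nonneg _ _ _ _ _ _)
  have hZb : jb (n₃ + n₅) ≤ 2 * |(n₃ + n₅ : ℝ)| := by
    have := br_le_mul_abs (y := ((n₃ + n₅ : ℤ) : ℝ)) (by push_cast; exact hb1)
    push_cast at this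
    rw [jb_eq_br]; push_cast; exact this
  have hZ2 : jb (n₃ + n₅) ^ 2 = 1 + |(n₃ + n₅ : ℝ)| ^ 2 := by
    rw [jb_eq_br, br_sq, sq_abs]; push_cast; ring
  have hZ1 : 1 ≤ jb (n₃ + n₅) := one_le_br _
  -- Numerical constants are not optimised: each comparison costs at most 2^20, and the resonant
  -- power count takes a fifth power.
  have hA5 : ((2 : ℝ) ^ 20) ^ 5 ≤ 2 ^ 100 := by norm_num
  have hC1 : (1 : ℝ) ≤ 2 ^ 20 := by norm_num
  have hnuv : (n : ℝ) ≤ 2 * (n₁ + n₃) := by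
    have := abs_le.1 he
    rcases hH with h | h <;> linarith [h.1, h.2.1, h.2.2.1]
  have hpuv : (-n₅ : ℝ) ≤ 2 * (n₁ + n₃) := by
    have := abs_le.1 he
    rcases hH with h | h <;> linarith [h.1, h.2.1, h.2.2.1]
  have hunp : (n₁ : ℝ) ≤ 2 * (n + -n₅) := by
    have := abs_le.1 he
    rcases hH with h | h <;> linarith [h.1, h.2.1, h.2.2.1]
  have hvnp : (n₃ : ℝ) ≤ 2 * (n + -n₅) := by
    have := abs_le.1 he
    rcases hH with h | h <;> linarith [h.1, h.2.1, h.2.2.1]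
  have hu1 : (n₁ : ℝ) ≤ jb n₁ := (le_abs_self _).trans (abs_le_br _)
  have hv3 : (n₃ : ℝ) ≤ jb n₃ := (le_abs_self _).trans (abs_le_br _)
  have h1N' : jb n₁ ≤ N' := (le_max_left _ _).trans (le_max_left _ _)
  have h3N' : jb n₃ ≤ N' := (le_max_right _ _).trans (le_max_left _ _)
  have h5N' : jb n₅ ≤ N' := le_max_right _ _
  have b0 : jb n ≤ 1 + n := by
    have := br_le_one_add_abs (n : ℝ); rwa [abs_of_nonneg hnR] at this
  have b1 : jb n₁ ≤ 1 + n₁ := by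
    have := br_le_one_add_abs (n₁ : ℝ); rwa [abs_of_nonneg huR] at this
  have b3 : jb n₃ ≤ 1 + n₃ := by
    have := br_le_one_add_abs (n₃ : ℝ); rwa [abs_of_nonneg hvR] at this
  have b5 : jb n₅ ≤ 1 + -n₅ := by
    have := br_le_one_add_abs (-n₅ : ℝ); rwa [abs_of_nonneg hpR, ← x5] at this
  have hNN' : N ≤ 4 * N' := by
    rw [hN]
    refine max_le (max_le ?_ ?_) (max_le ?_ ?_) <;> linarith
  -- For the derivative estimate N|n₃₅| ≲ |Φ| already suffices, since n₃₅ ≠ 0 gives M ≲ N ≲ |Φ|.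
  have nonres₃ : N * |(n₃ + n₅ : ℝ)| ≤ 16 * |(φ : ℝ)| → Main₃ (2 ^ 100) δ M n₁ n₂ n₃ n₄ n₅ := by
    intro hB
    have hNφ : N ≤ 16 * |(φ : ℝ)| := (le_mul_of_one_le_right (by linarith) hb1).trans hB
    refine (Main₃.of_nonresonant (C := 2 ^ 10) hδ hδ1 (by norm_num) hM hN'
      ?_ ?_ ?_ ?_ ?_ ?_ ?_).mono (by norm_num)
    · linarith
    · linarith
    · linarith
    · linarith
    · linarith
    · have q13 : 0 ≤ (jb n₁ - 1) * (jb n₃ - 1) := mul_nonneg (by linarith) (by linarith)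
      have q15 : jb n₁ ≤ jb n₁ * jb n₅ := le_mul_of_one_le_right (by linarith) x5'
      have q15' : jb n₅ ≤ jb n₁ * jb n₅ := le_mul_of_one_le_left (by linarith) x1
      have q35 : jb n₃ ≤ jb n₃ * jb n₅ := le_mul_of_one_le_right (by linarith) x5'
      have q35' : jb n₅ ≤ jb n₃ * jb n₅ := le_mul_of_one_le_left (by linarith) x3
      have hx : M ≤ 10 * (jb n₁ * jb n₃) ∧ M ≤ 10 * (jb n₃ * jb n₅) ∧
          M ≤ 10 * (jb n₁ * jb n₅) := by
        rcases hH with ⟨_, _, _, h⟩ | ⟨_, _, h, h'⟩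
        · exact ⟨by linarith, by linarith, by linarith⟩
        · exact ⟨by linarith, by linarith, by linarith⟩
      have hNor : N' = jb n₁ ∨ N' = jb n₃ ∨ N' = jb n₅ := by
        rcases max_choice (max (jb n₁) (jb n₃)) (jb n₅) with h | h
        · rcases max_choice (jb n₁) (jb n₃) with h' | h' <;> rw [hN', h, h'] <;> simp
        · rw [hN', h]; simp
      have hpos : 0 ≤ jb n₁ * jb n₃ * jb n₅ := by positivity
      rcases hNor with h | h | h <;> rw [h]
      · linarith [mul_le_mul_of_nonneg_right hx.2.1 (by linarith : 0 ≤ jb n₁)]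
      · linarith [mul_le_mul_of_nonneg_right hx.2.2 (by linarith : 0 ≤ jb n₃)]
      · linarith [mul_le_mul_of_nonneg_right hx.1 (by linarith : 0 ≤ jb n₅)]
    · linarith
  have res₁ : (-n₅ : ℝ) ≤ 2 * n₃ → (n : ℝ) ≤ 2 * n₁ → |(n₃ + n₅ : ℝ)| ≤ -n₅ → (n₃ : ℝ) ≤ 2 * -n₅ →
      jb (n₃ + n₅) ^ 2 ≤ 2 ^ 20 * jb φ → Main₁ (2 ^ 100) δ M n₁ n₂ n₃ n₄ n₅ := by
    intro g1 g2 g3 g4 g5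
    refine (Main₁.of_resonant (C := 2 ^ 20) hδ hδ1 hC1 hM hZ1 hZjb ?_ ?_ ?_ ?_ g5).mono hA5
    · rcases hH with ⟨_, _, _, h⟩ | ⟨_, _, h, h'⟩ <;> linarith
    · rw [x5]
      exact cmp hpR hvR hC1 (by linarith)
    · exact cmp hnR huR hC1 (by linarith)
    · linarith
  rcases hcases with ⟨c1, c2, c3, c4⟩ | ⟨c1, c2⟩ | ⟨c1, c2, c3, c4, c5⟩ | ⟨c1, c2, c3, c4, c5⟩
  · have hM5 : M ≤ 2 ^ 20 * jb n₅ := by linarith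
    have h53 : jb n₅ ≤ 2 ^ 20 * jb n₃ := by
      rw [x5]; exact cmp hpR hvR hC1 (by linarith)
    have h01 : jb n ≤ 2 ^ 20 * jb n₁ := cmp hnR huR hC1 (by linarith)
    have hN0 : N' ≤ 4 * jb n :=
      hN'N.trans (cmp (by linarith) hnR (by norm_num) (by linarith))
    have fin : ∀ Z : ℝ, 1 ≤ Z →
        Z ^ (-(1 + δ)) ≤ jb (n₃ + n₅) ^ (-(1 + δ)) + resKer δ n₁ n₂ n₃ n₄ n₅ →
        Z ≤ 2 ^ 20 * jb n₅ → Z ^ 2 ≤ 65 * jb φ →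
        Main₁ (2 ^ 100) δ M n₁ n₂ n₃ n₄ n₅ ∧ Main₃ (2 ^ 100) δ M n₁ n₂ n₃ n₄ n₅ := by
      intro Z hZ hk hZ5 hZJ
      refine ⟨(Main₁.of_resonant hδ hδ1 hC1 hM hZ hk hM5 h53 h01 hZ5 (by linarith)).mono hA5,
        (Main₃.of_resonant hδ hδ1 hC1 hM hZ hk hM5 h53 h01 hN' ?_).mono hA5⟩
      calc (N' * Z) ^ 2 = N' ^ 2 * Z ^ 2 := by ring
        _ ≤ (4 * jb n) ^ 2 * (65 * jb φ) := by gcongr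
        _ = 1040 * (jb n ^ 2 * jb φ) := by ring
        _ ≤ 2 ^ 20 * (jb n ^ 2 * jb φ) := by gcongr; norm_num
    have hbN : |(n₃ + n₅ : ℝ)| ≤ N := abs_le.2 ⟨by linarith, by linarith⟩
    -- If n₃₅² ≲ |Φ|, the first Schur kernel works with Z = ⟨n₃₅⟩. Otherwise |n₃₅| exceeds
    -- 8|Φ|^{1/2} ≥ 8L, which yields the cut-off of `resKer`; then Z = ⟨Φ/(2n₁₅)⟩ works because |Φ|
    -- ≤ n₁₅² gives Z² ≲ ⟨Φ⟩.
    by_cases hbφ : |(n₃ + n₅ : ℝ)| ^ 2 ≤ 64 * |(φ : ℝ)|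
    · refine fin _ hZ1 hZjb (by linarith) ?_
      rw [hZ2]; linarith
    · push Not at hbφ
      have ha0 : n₁ + n₅ ≠ 0 := by
        intro h; rw [h, abs_zero] at hab; exact hb (abs_nonpos_iff.1 hab)
      have haR : (0 : ℝ) < |(n₁ + n₅ : ℝ)| := by linarith
      have hLb : 8 * L ≤ |(n₃ + n₅ : ℝ)| := by
        refine le_of_not_gt fun h => ?_
        have := mul_self_lt_mul_self (abs_nonneg _) h
        linarith
      have he4 : 4 * |n₂ + n₄| ≤ |n₁ + n₅| := by
        have : 4 * |(n₂ + n₄ : ℝ)| ≤ |(n₁ + n₅ : ℝ)| := by linarith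
        exact_mod_cast this
      have hk := hres he4 ha0
      have hφa : |(φ : ℝ) / (2 * (n₁ + n₅))| = |(φ : ℝ)| / (2 * |(n₁ + n₅ : ℝ)|) := by
        rw [abs_div, abs_mul, abs_two]
      have hφa2 : |(φ : ℝ)| ≤ |(n₁ + n₅ : ℝ)| ^ 2 := by
        have := pow_le_pow_left₀ (abs_nonneg _) hba 2
        linarith [abs_nonneg (φ : ℝ)]
      have hq : |(φ : ℝ) / (2 * (n₁ + n₅))| ≤ |(n₁ + n₅ : ℝ)| := by
        rw [hφa, div_le_iff₀ (by positivity)]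
        linarith [sq_nonneg |(n₁ + n₅ : ℝ)|]
      have haN : |(n₁ + n₅ : ℝ)| ≤ N := abs_le.2 ⟨by linarith, by linarith⟩
      refine fin _ (one_le_br ((φ : ℝ) / (2 * (n₁ + n₅)))) ?_ ?_ ?_
      · rw [hk]
        exact le_add_of_nonneg_left (Real.rpow_nonneg (br_pos _).le _)
      · have := br_le_one_add_abs ((φ : ℝ) / (2 * (n₁ + n₅)))
        linarith
      · rw [br_sq, ← sq_abs]
        have : |(φ : ℝ) / (2 * (n₁ + n₅))| ^ 2 ≤ |(φ : ℝ)| := by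
          rw [hφa, div_pow, div_le_iff₀ (by positivity)]
          linarith [mul_le_mul_of_nonneg_left hφa2 (abs_nonneg (φ : ℝ)),
            mul_nonneg (abs_nonneg (φ : ℝ)) (sq_nonneg |(n₁ + n₅ : ℝ)|)]
        linarith
  · refine ⟨(Main₁.of_nonresonant (C := 2 ^ 20) hδ hδ1 hC1 hM hN' ?_ ?_).mono (by norm_num),
      nonres₃ c1⟩
    · linarith
    · calc M ^ 2 * jb n ≤ M ^ 2 * (n + 1) := by gcongr; linarith
        _ ≤ 512 * (N ^ 2 * |(n₃ + n₅ : ℝ)|) := c2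
        _ = 512 * (N * (N * |(n₃ + n₅ : ℝ)|)) := by ring
        _ ≤ 512 * ((4 * N') * (16 * jb φ)) := by
            have h16 : N * |(n₃ + n₅ : ℝ)| ≤ 16 * jb φ := by linarith
            gcongr
        _ = 2 ^ 15 * (N' * jb φ) := by ring
        _ ≤ 2 ^ 20 * (N' * jb φ) := by gcongr <;> norm_num
  · refine ⟨res₁ c2 c3 c5 c4 ?_, nonres₃ c1⟩
    rw [hZ2]
    have hbN : |(n₃ + n₅ : ℝ)| ≤ N := abs_le.2 ⟨by linarith, by linarith⟩
    linarith [mul_le_mul_of_nonneg_right hbN (abs_nonneg (n₃ + n₅ : ℝ))]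
  -- The n₂₄ term wins: n₃₅ = O(L), and L ≤ |Φ|^{1/2} converts this into a gain from Φ. For the
  -- derivative estimate the sharper N|n₃₅| ≲ Ln is needed, which also returns the factor N/n.
  · have hbL : |(n₃ + n₅ : ℝ)| ≤ 128 * L := by
      have : N * |(n₃ + n₅ : ℝ)| ≤ N * (128 * L) := by
        calc _ ≤ 128 * (L * n) := c1
          _ ≤ 128 * (L * N) := by gcongr
          _ = _ := by ring
      exact le_of_mul_le_mul_left this (by linarith)
    refine ⟨res₁ c2 c3 c5 c4 ?_, ?_⟩
    · rw [hZ2]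
      linarith [pow_le_pow_left₀ (abs_nonneg _) hbL 2]
    · refine (Main₃.of_resonant (C := 2 ^ 20) hδ hδ1 hC1 hM hZ1 hZjb ?_ ?_ ?_ hN' ?_).mono hA5
      · rcases hH with ⟨_, _, _, h⟩ | ⟨_, _, h, h'⟩ <;> linarith
      · rw [x5]
        exact cmp hpR hvR hC1 (by linarith)
      · exact cmp hnR huR hC1 (by linarith)
      · calc (N' * jb (n₃ + n₅)) ^ 2 ≤ ((2 * N) * (2 * |(n₃ + n₅ : ℝ)|)) ^ 2 := by
              gcongr
              linarith
          _ = 16 * (N * |(n₃ + n₅ : ℝ)|) ^ 2 := by ring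
          _ ≤ 16 * (128 * (L * n)) ^ 2 := by gcongr
          _ = 2 ^ 18 * (n ^ 2 * L ^ 2) := by ring
          _ ≤ 2 ^ 20 * (jb n ^ 2 * jb φ) := by
              gcongr
              · norm_num
              · norm_num
              · linarith

-- With |Φ| ≤ L² the available gain is 1/L, so in every case a parameter Z = O(1 + L) has to be
-- found.
set_option maxHeartbeats 800000 in
theorem low_of_resonant {δ M L : ℝ} {n₁ n₂ n₃ n₄ n₅ : ℤ} (hδ : 0 < δ) (hδ1 : δ ≤ 1 / 4)
    (hM : 0 ≤ M) (hn : 0 ≤ n₁ + n₂ + n₃ + n₄ + n₅) (h1 : 0 ≤ n₁) (h3 : 0 ≤ n₃) (h5 : n₅ ≤ 0)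
    (hb : n₃ + n₅ ≠ 0) (hab : |n₃ + n₅| ≤ |n₁ + n₅|)
    (h2L : |(n₂ : ℝ)| ≤ L) (h4L : |(n₄ : ℝ)| ≤ L) (hLl : L ≤ max (jb n₂) (jb n₄))
    (hH : (1024 * L ≤ ((n₁ + n₂ + n₃ + n₄ + n₅ : ℤ) : ℝ) ∧ 1024 * L ≤ -n₅ ∧ M ≤ 2 * (-n₅)) ∨
      (1024 * L ≤ n₁ ∧ 1024 * L ≤ n₃ ∧ M ≤ 2 * n₃))
    (hΦ : |((Phi (n₁ + n₂ + n₃ + n₄ + n₅) n₁ n₃ n₅ : ℤ) : ℝ)| ≤ L ^ 2) :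
    Low (2 ^ 100) δ M n₁ n₂ n₃ n₄ n₅ := by
  have hφ := Phi_resonant hn h1 h3 h5
  have hres := fun he ha => resKer_eq (δ := δ) hn h1 h3 h5 he ha
  set φ : ℤ := Phi (n₁ + n₂ + n₃ + n₄ + n₅) n₁ n₃ n₅ with hφdef
  set n : ℤ := n₁ + n₂ + n₃ + n₄ + n₅ with hndef
  have hnR : (0 : ℝ) ≤ n := by exact_mod_cast hn
  have hpR : (0 : ℝ) ≤ -n₅ := by exact_mod_cast (by linarith : 0 ≤ -n₅)
  have huR : (0 : ℝ) ≤ n₁ := by exact_mod_cast h1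
  have hvR : (0 : ℝ) ≤ n₃ := by exact_mod_cast h3
  have hs : (n : ℝ) + -n₅ = n₁ + n₃ + (n₂ + n₄) := by rw [hndef]; push_cast; ring
  have he : |(n₂ + n₄ : ℝ)| ≤ 2 * L := (abs_add_le _ _).trans (by linarith)
  have hL : 0 ≤ L := (abs_nonneg _).trans h2L
  have hb1 : 1 ≤ |(n₃ - -n₅ : ℝ)| := by
    rw [sub_neg_eq_add]; exact_mod_cast Int.one_le_abs hb
  have hba : |(n₃ - -n₅ : ℝ)| ≤ |(n₁ - -n₅ : ℝ)| := by
    rw [sub_neg_eq_add, sub_neg_eq_add]; exact_mod_cast hab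
  obtain ⟨N, hN⟩ : ∃ N, N = max (max (n : ℝ) (-n₅)) (max (n₁ : ℝ) n₃) := ⟨_, rfl⟩
  have hcases := low_resonance_cases hnR hpR huR hvR hs he hN hφ hΦ hb1 hba
    (hH.imp (fun h => ⟨h.1, h.2.1⟩) (fun h => ⟨h.1, h.2.1⟩))
  have hpN : (-n₅ : ℝ) ≤ N := hN ▸ (le_max_right _ _).trans (le_max_left _ _)
  have huN : (n₁ : ℝ) ≤ N := hN ▸ (le_max_left _ _).trans (le_max_right _ _)
  have hvN : (n₃ : ℝ) ≤ N := hN ▸ (le_max_right _ _).trans (le_max_right _ _)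
  have hnN : (n : ℝ) ≤ N := hN ▸ (le_max_left _ _).trans (le_max_left _ _)
  rw [sub_neg_eq_add] at hcases hb1 hba
  rw [sub_neg_eq_add] at hba
  have x5 : jb n₅ = br (-n₅) := by rw [jb_eq_br, br_neg]
  have hp5 : (-n₅ : ℝ) ≤ jb n₅ := by
    rw [x5]; exact (le_abs_self _).trans (abs_le_br _)
  have x5' : 1 ≤ jb n₅ := one_le_br _
  have cmp : ∀ {c x y : ℝ}, 0 ≤ x → 0 ≤ y → 1 ≤ c → x ≤ c * y → br x ≤ c * br y := by
    intro c x y hx hy hc h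
    exact br_le_mul_of_abs_le hc (by rwa [abs_of_nonneg hx, abs_of_nonneg hy])
  have hl1 : 1 ≤ max (jb n₂) (jb n₄) := le_max_of_le_left (one_le_br _)
  have hZjb : jb (n₃ + n₅) ^ (-(1 + δ)) ≤ jb (n₃ + n₅) ^ (-(1 + δ)) + resKer δ n₁ n₂ n₃ n₄ n₅ :=
    le_add_of_nonneg_right (resKer_nonneg _ _ _ _ _ _)
  have hZb : jb (n₃ + n₅) ≤ 2 * |(n₃ + n₅ : ℝ)| := by
    have := br_le_mul_abs (y := ((n₃ + n₅ : ℤ) : ℝ)) (by push_cast; exact hb1)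
    push_cast at this
    rw [jb_eq_br]; push_cast; exact this
  have hZ1 : 1 ≤ jb (n₃ + n₅) := one_le_br _
  have hA5 : ((2 : ℝ) ^ 20) ^ 5 ≤ 2 ^ 100 := by norm_num
  have hC1 : (1 : ℝ) ≤ 2 ^ 20 := by norm_num
  rcases hcases with ⟨c1, c2, c3, c4⟩ | ⟨c1, c2, c3, c4, c5⟩
  · have hM5 : M ≤ 2 ^ 20 * jb n₅ := by rcases hH with ⟨_, _, h⟩ | ⟨_, _, h⟩ <;> linarith
    have h53 : jb n₅ ≤ 2 ^ 20 * jb n₃ := by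
      rw [x5]; exact cmp hpR hvR hC1 (by linarith)
    have h01 : jb n ≤ 2 ^ 20 * jb n₁ := cmp hnR huR hC1 (by linarith)
    -- If |n₁₅| ≤ 8L, then n₃₅ = O(L) as well. Otherwise 4|n₂₄| ≤ 8L < |n₁₅| gives the cut-off of
    -- `resKer`, and |Φ/(2n₁₅)| ≤ L.
    by_cases ha : |(n₁ + n₅ : ℝ)| ≤ 8 * L
    · have hbN : |(n₃ + n₅ : ℝ)| ≤ N := abs_le.2 ⟨by linarith, by linarith⟩
      exact (Low.of_resonant hδ hδ1 hC1 hM hZ1 hZjb hM5 h53 h01 (by linarith)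
        (by linarith)).mono hA5
    · push Not at ha
      have ha0 : n₁ + n₅ ≠ 0 := by
        intro h; rw [h, abs_zero] at hab; exact hb (abs_nonpos_iff.1 hab)
      have haR : (0 : ℝ) < |(n₁ + n₅ : ℝ)| := by linarith
      have he4 : 4 * |n₂ + n₄| ≤ |n₁ + n₅| := by
        have : 4 * |(n₂ + n₄ : ℝ)| ≤ |(n₁ + n₅ : ℝ)| := by linarith
        exact_mod_cast this
      have hk := hres he4 ha0
      have hq : |(φ : ℝ) / (2 * (n₁ + n₅))| ≤ L := by
        rw [abs_div, abs_mul, abs_two, div_le_iff₀ (by positivity)]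
        linarith [mul_le_mul_of_nonneg_left ha.le hL, sq_nonneg L]
      have hZ := br_le_one_add_abs ((φ : ℝ) / (2 * (n₁ + n₅)))
      have hLN : L ≤ N := by rcases hH with ⟨h, _⟩ | ⟨h, _⟩ <;> linarith
      refine (Low.of_resonant hδ hδ1 hC1 hM (one_le_br ((φ : ℝ) / (2 * (n₁ + n₅)))) ?_ hM5 h53 h01
        (by linarith) (by linarith)).mono hA5
      rw [hk]
      exact le_add_of_nonneg_left (Real.rpow_nonneg (br_pos _).le _)
  · refine (Low.of_resonant (C := 2 ^ 20) hδ hδ1 hC1 hM hZ1 hZjb ?_ ?_ ?_ ?_ ?_).mono hA5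
    · rcases hH with ⟨_, _, h⟩ | ⟨_, _, h⟩ <;> linarith
    · rw [x5]
      exact cmp hpR hvR hC1 (by linarith)
    · exact cmp hnR huR hC1 (by linarith)
    · linarith
    · linarith

/-! ### Sign patterns without cancellation, and the case split on signs. -/

/-- The cross terms 2(xq + xr + qr) outweigh everything that contains e. -/
theorem sq_add_sub_ge {x q r e : ℝ} (hx : 0 ≤ x) (hq : 0 ≤ q) (hr : 0 ≤ r) (heq : 512 * |e| ≤ q)
    (her : 512 * |e| ≤ r) : q * r ≤ (x + q + r + e) ^ 2 - x ^ 2 - q ^ 2 - r ^ 2 := by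
  have h1 := mul_le_mul_of_nonneg_right heq hx
  have h2 := mul_le_mul_of_nonneg_right heq hr
  have h3 := mul_le_mul_of_nonneg_right her hq
  have n1 := mul_le_mul_of_nonneg_right (neg_abs_le e) hx
  have n2 := mul_le_mul_of_nonneg_right (neg_abs_le e) hr
  have n3 := mul_le_mul_of_nonneg_right (neg_abs_le e) hq
  linarith [sq_nonneg e, mul_nonneg hx hq, mul_nonneg hx hr, mul_nonneg hq hr]

/-- Only balance of the four large frequencies and M ≲ |Φ| are needed besides the power count `hM2`.
The last three hypotheses bound M by the product of any two inputs, in particular of the two smaller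
ones. -/
theorem main_of_nonresonant {δ M : ℝ} {n₁ n₂ n₃ n₄ n₅ : ℤ} (hδ : 0 < δ) (hδ1 : δ ≤ 1 / 4)
    (hM : 0 ≤ M) (h0 : |n₁ + n₂ + n₃ + n₄ + n₅| ≤ 4 * (|n₁| + |n₃| + |n₅|))
    (h1 : |n₁| ≤ 4 * (|n₁ + n₂ + n₃ + n₄ + n₅| + |n₃| + |n₅|))
    (h3 : |n₃| ≤ 4 * (|n₁ + n₂ + n₃ + n₄ + n₅| + |n₁| + |n₅|))
    (h5 : |n₅| ≤ 4 * (|n₁ + n₂ + n₃ + n₄ + n₅| + |n₁| + |n₃|))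
    (hMJ : M ≤ 4 * |((Phi (n₁ + n₂ + n₃ + n₄ + n₅) n₁ n₃ n₅ : ℤ) : ℝ)|)
    (hM2 : M ^ 2 * jb (n₁ + n₂ + n₃ + n₄ + n₅) ≤ 100 * (max (max (jb n₁) (jb n₃)) (jb n₅) *
      jb (Phi (n₁ + n₂ + n₃ + n₄ + n₅) n₁ n₃ n₅)))
    (hM13 : M ≤ 4 * jb n₁ ∨ M ≤ 4 * jb n₃) (hM15 : M ≤ 4 * jb n₁ ∨ M ≤ 4 * jb n₅)
    (hM35 : M ≤ 4 * jb n₃ ∨ M ≤ 4 * jb n₅) :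
    Main₁ (2 ^ 100) δ M n₁ n₂ n₃ n₄ n₅ ∧ Main₃ (2 ^ 100) δ M n₁ n₂ n₃ n₄ n₅ := by
  obtain ⟨N, hN⟩ : ∃ N, N = max (max (jb n₁) (jb n₃)) (jb n₅) := ⟨_, rfl⟩
  rw [← hN] at hM2
  have h1N : jb n₁ ≤ N := hN ▸ (le_max_left _ _).trans (le_max_left _ _)
  have h3N : jb n₃ ≤ N := hN ▸ (le_max_right _ _).trans (le_max_left _ _)
  have h5N : jb n₅ ≤ N := hN ▸ le_max_right _ _
  have x1 : 1 ≤ jb n₁ := one_le_br _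
  have x3 : 1 ≤ jb n₃ := one_le_br _
  have x5 : 1 ≤ jb n₅ := one_le_br _
  have hJ : |((Phi (n₁ + n₂ + n₃ + n₄ + n₅) n₁ n₃ n₅ : ℤ) : ℝ)| ≤
    jb (Phi (n₁ + n₂ + n₃ + n₄ + n₅) n₁ n₃ n₅) := abs_le_br _
  have key : ∀ a b c d : ℤ, |a| ≤ 4 * (|b| + |c| + |d|) → jb a ≤ 5 * (jb b + jb c + jb d) := by
    intro a b c d h
    have h' : |(a : ℝ)| ≤ 4 * (|(b : ℝ)| + |(c : ℝ)| + |(d : ℝ)|) := by exact_mod_cast h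
    have e1 := br_le_one_add_abs (a : ℝ)
    have e2 := abs_le_br (b : ℝ)
    have e3 := abs_le_br (c : ℝ)
    have e4 := abs_le_br (d : ℝ)
    have e5 := one_le_br (b : ℝ)
    have e6 := one_le_br (c : ℝ)
    have e7 := one_le_br (d : ℝ)
    simp only [jb_eq_br]
    linarith
  have k0 := key _ _ _ _ h0
  have k1 := key _ _ _ _ h1
  have k3 := key _ _ _ _ h3
  have k5 := key _ _ _ _ h5
  have y0 : 1 ≤ jb (n₁ + n₂ + n₃ + n₄ + n₅) := one_le_br _
  have yJ : 1 ≤ jb (Phi (n₁ + n₂ + n₃ + n₄ + n₅) n₁ n₃ n₅) := one_le_br _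
  have hNJ : 0 ≤ N * jb (Phi (n₁ + n₂ + n₃ + n₄ + n₅) n₁ n₃ n₅) :=
    mul_nonneg (by linarith) (by linarith)
  have hMx : M ≤ 4 * (jb n₁ * jb n₃) ∧ M ≤ 4 * (jb n₁ * jb n₅) ∧ M ≤ 4 * (jb n₃ * jb n₅) := by
    have gen : ∀ {x y : ℝ}, 1 ≤ x → 1 ≤ y → (M ≤ 4 * x ∨ M ≤ 4 * y) → M ≤ 4 * (x * y) := by
      intro x y hx hy h
      have e1 : x ≤ x * y := le_mul_of_one_le_right (by linarith) hy
      have e2 : y ≤ x * y := le_mul_of_one_le_left (by linarith) hx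
      rcases h with h | h <;> linarith
    exact ⟨gen x1 x3 hM13, gen x1 x5 hM15, gen x3 x5 hM35⟩
  refine ⟨(Main₁.of_nonresonant (C := 2 ^ 10) hδ hδ1 (by norm_num) hM hN (by linarith)
    (by linarith)).mono (by norm_num), (Main₃.of_nonresonant (C := 2 ^ 10) hδ hδ1 (by norm_num) hM
    hN (by linarith) (by linarith) (by linarith) (by linarith) (by linarith) ?_ ?_).mono
      (by norm_num)⟩
  · have hpos : 0 ≤ jb n₁ * jb n₃ * jb n₅ := by positivity
    have hNor : N = jb n₁ ∨ N = jb n₃ ∨ N = jb n₅ := by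
      rcases max_choice (max (jb n₁) (jb n₃)) (jb n₅) with h | h
      · rcases max_choice (jb n₁) (jb n₃) with h' | h' <;> rw [hN, h, h'] <;> simp
      · rw [hN, h]; simp
    rcases hNor with h | h | h <;> rw [h]
    · linarith [mul_le_mul_of_nonneg_right hMx.2.2 (by linarith : 0 ≤ jb n₁)]
    · linarith [mul_le_mul_of_nonneg_right hMx.2.1 (by linarith : 0 ≤ jb n₃)]
    · linarith [mul_le_mul_of_nonneg_right hMx.1 (by linarith : 0 ≤ jb n₅)]
  · rcases hM13 with h | h <;> linarith

/-- Here n₁ = n + (−n₃) + (−n₅) − n₂₄ is a sum of nonnegative frequencies up to a small error, so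
n₁² exceeds the sum of their squares by at least a cross term. -/
theorem mul_le_abs_Phi_of_output {n₁ n₂ n₃ n₄ n₅ L : ℤ} (hn : 0 ≤ n₁ + n₂ + n₃ + n₄ + n₅)
    (h1 : 0 ≤ n₁) (h3 : n₃ ≤ 0) (h5 : n₅ ≤ 0) (h2L : |n₂| ≤ L) (h4L : |n₄| ≤ L)
    (hLn : 1024 * L ≤ n₁ + n₂ + n₃ + n₄ + n₅) (hL5 : 1024 * L ≤ -n₅) :
    (n₁ + n₂ + n₃ + n₄ + n₅) * (-n₅) ≤ |Phi (n₁ + n₂ + n₃ + n₄ + n₅) n₁ n₃ n₅| := by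
  have he : |n₂ + n₄| ≤ 2 * L := (abs_add_le _ _).trans (by linarith)
  have h := sq_add_sub_ge (x := ((-n₃ : ℤ) : ℝ)) (q := ((n₁ + n₂ + n₃ + n₄ + n₅ : ℤ) : ℝ))
    (r := ((-n₅ : ℤ) : ℝ)) (e := ((-(n₂ + n₄) : ℤ) : ℝ)) (by exact_mod_cast (by linarith))
    (by exact_mod_cast hn) (by exact_mod_cast (by linarith))
    (by rw [← Int.cast_abs, abs_neg]; exact_mod_cast (by linarith))
    (by rw [← Int.cast_abs, abs_neg]; exact_mod_cast (by linarith))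
  have h' : (n₁ + n₂ + n₃ + n₄ + n₅) * (-n₅) ≤
      (-n₃ + (n₁ + n₂ + n₃ + n₄ + n₅) + -n₅ + -(n₂ + n₄)) ^ 2 - (-n₃) ^ 2 -
        (n₁ + n₂ + n₃ + n₄ + n₅) ^ 2 - (-n₅) ^ 2 := by exact_mod_cast h
  refine h'.trans (le_trans (le_of_eq ?_) (neg_le_abs _))
  unfold Phi
  rw [abs_of_nonneg hn, abs_of_nonneg h1, abs_of_nonpos h3, abs_of_nonpos h5]
  ring

/-- In the first case n, in the second −n₁, is the sum of three nonnegative frequencies up to a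
small error; n₃ n₅ is one of the cross terms. -/
theorem mul_le_abs_Phi_of_inputs {n₁ n₂ n₃ n₄ n₅ L : ℤ}
    (h1 : 0 ≤ n₁ ∨ n₁ ≤ 0 ∧ n₁ + n₂ + n₃ + n₄ + n₅ ≤ 0) (h3 : 0 ≤ n₃) (h5 : 0 ≤ n₅)
    (h2L : |n₂| ≤ L) (h4L : |n₄| ≤ L) (hL3 : 1024 * L ≤ n₃) (hL5 : 1024 * L ≤ n₅) :
    n₃ * n₅ ≤ |Phi (n₁ + n₂ + n₃ + n₄ + n₅) n₁ n₃ n₅| := by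
  have he : |n₂ + n₄| ≤ 2 * L := (abs_add_le _ _).trans (by linarith)
  have he' := abs_le.1 he
  rcases h1 with h1 | ⟨h1, hn⟩
  · have h := sq_add_sub_ge (x := (n₁ : ℝ)) (q := (n₃ : ℝ)) (r := (n₅ : ℝ))
      (e := ((n₂ + n₄ : ℤ) : ℝ)) (by exact_mod_cast h1) (by exact_mod_cast h3)
      (by exact_mod_cast h5) (by rw [← Int.cast_abs]; exact_mod_cast (by linarith))
      (by rw [← Int.cast_abs]; exact_mod_cast (by linarith))
    have h' : n₃ * n₅ ≤ (n₁ + n₃ + n₅ + (n₂ + n₄)) ^ 2 - n₁ ^ 2 - n₃ ^ 2 - n₅ ^ 2 := by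
      exact_mod_cast h
    refine h'.trans (le_trans (le_of_eq ?_) (le_abs_self _))
    unfold Phi
    rw [abs_of_nonneg (by linarith [he'.1, he'.2] : 0 ≤ n₁ + n₂ + n₃ + n₄ + n₅), abs_of_nonneg h1,
      abs_of_nonneg h3, abs_of_nonneg h5]
    ring
  · have h := sq_add_sub_ge (x := ((-(n₁ + n₂ + n₃ + n₄ + n₅) : ℤ) : ℝ)) (q := (n₃ : ℝ))
      (r := (n₅ : ℝ)) (e := ((n₂ + n₄ : ℤ) : ℝ)) (by exact_mod_cast (by linarith))
      (by exact_mod_cast h3)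
      (by exact_mod_cast h5) (by rw [← Int.cast_abs]; exact_mod_cast (by linarith))
      (by rw [← Int.cast_abs]; exact_mod_cast (by linarith))
    have h' : n₃ * n₅ ≤ (-(n₁ + n₂ + n₃ + n₄ + n₅) + n₃ + n₅ + (n₂ + n₄)) ^ 2 -
        (-(n₁ + n₂ + n₃ + n₄ + n₅)) ^ 2 - n₃ ^ 2 - n₅ ^ 2 := by exact_mod_cast h
    refine h'.trans (le_trans (le_of_eq ?_) (le_abs_self _))
    unfold Phi
    rw [abs_of_nonpos hn, abs_of_nonpos h1, abs_of_nonneg h3, abs_of_nonneg h5]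
    ring

theorem main_of_output_of_neg {δ M : ℝ} {n₁ n₂ n₃ n₄ n₅ L : ℤ} (hδ : 0 < δ) (hδ1 : δ ≤ 1 / 4)
    (hM : 0 ≤ M) (hn : 0 < n₁ + n₂ + n₃ + n₄ + n₅) (h1 : 0 ≤ n₁) (h3 : n₃ < 0) (h5 : n₅ < 0)
    (h2L : |n₂| ≤ L) (h4L : |n₄| ≤ L) (hLn : 1024 * L ≤ n₁ + n₂ + n₃ + n₄ + n₅)
    (hL5 : 1024 * L ≤ -n₅) (hM5 : M ≤ 2 * (-n₅)) :
    Main₁ (2 ^ 100) δ M n₁ n₂ n₃ n₄ n₅ ∧ Main₃ (2 ^ 100) δ M n₁ n₂ n₃ n₄ n₅ := by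
  have hP := mul_le_abs_Phi_of_output hn.le h1 h3.le h5.le h2L h4L hLn hL5
  have hPR : ((n₁ + n₂ + n₃ + n₄ + n₅ : ℤ) : ℝ) * (-n₅) ≤
    |((Phi (n₁ + n₂ + n₃ + n₄ + n₅) n₁ n₃ n₅ : ℤ) : ℝ)| := by exact_mod_cast hP
  have e2 := abs_le.1 h2L
  have e4 := abs_le.1 h4L
  have hnR : (1 : ℝ) ≤ ((n₁ + n₂ + n₃ + n₄ + n₅ : ℤ) : ℝ) := by exact_mod_cast hn
  have h5R : (1 : ℝ) ≤ -n₅ := by exact_mod_cast (by linarith : (1 : ℤ) ≤ -n₅)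
  have h51 : (-n₅ : ℝ) ≤ n₁ := by exact_mod_cast (by linarith : (-n₅ : ℤ) ≤ n₁)
  have b1 : M ≤ 4 * jb n₁ := by
    have := (le_abs_self _).trans (abs_le_br (n₁ : ℝ))
    rw [jb_eq_br]; linarith
  have h5b : (-n₅ : ℝ) ≤ jb n₅ := (neg_le_abs _).trans (abs_le_br (n₅ : ℝ))
  have a0 : |n₁ + n₂ + n₃ + n₄ + n₅| = n₁ + n₂ + n₃ + n₄ + n₅ := abs_of_pos hn
  have a1 : |n₁| = n₁ := abs_of_nonneg h1
  have a3 : |n₃| = -n₃ := abs_of_neg h3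
  have a5 : |n₅| = -n₅ := abs_of_neg h5
  refine main_of_nonresonant hδ hδ1 hM (by omega) (by omega) (by omega) (by omega) ?_ ?_
    (.inl b1) (.inl b1) (.inr (by linarith))
  · nlinarith
  · have hb0 : jb (n₁ + n₂ + n₃ + n₄ + n₅) ≤ 2 * ((n₁ + n₂ + n₃ + n₄ + n₅ : ℤ) : ℝ) := by
      have := br_le_mul_abs (y := ((n₁ + n₂ + n₃ + n₄ + n₅ : ℤ) : ℝ)) (hnR.trans (le_abs_self _))
      rwa [abs_of_nonneg (by linarith)] at this
    have hJ := abs_le_br ((Phi (n₁ + n₂ + n₃ + n₄ + n₅) n₁ n₃ n₅ : ℤ) : ℝ)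
    have hN : jb n₅ ≤ max (max (jb n₁) (jb n₃)) (jb n₅) := le_max_right _ _
    rw [jb_eq_br (Phi _ _ _ _)]
    generalize br ((Phi (n₁ + n₂ + n₃ + n₄ + n₅) n₁ n₃ n₅ : ℤ) : ℝ) = J at *
    generalize max (max (jb n₁) (jb n₃)) (jb n₅) = N at *
    generalize ((n₁ + n₂ + n₃ + n₄ + n₅ : ℤ) : ℝ) = n at *
    have hx0 : 0 ≤ jb (n₁ + n₂ + n₃ + n₄ + n₅) := (br_pos _).le
    calc M ^ 2 * jb (n₁ + n₂ + n₃ + n₄ + n₅) ≤ (2 * (-n₅)) ^ 2 * (2 * n) := by gcongr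
      _ = 8 * ((-n₅) * (n * (-n₅))) := by ring
      _ ≤ 8 * (N * J) := by
          have : n * (-n₅) ≤ J := by linarith
          have : (-n₅ : ℝ) ≤ N := by linarith
          have : 0 ≤ n * (-n₅ : ℝ) := by positivity
          gcongr
          linarith
      _ ≤ 100 * (N * J) := by
          have : 0 ≤ N * J := mul_nonneg (by linarith) (by nlinarith)
          linarith

/-- With n > 0 > n₅, the inputs n₁ and n₃ cannot both be negative. One negative sign excludes
cancellation, none gives the resonant pattern. -/
theorem main_of_output_pos {δ M : ℝ} {n₁ n₂ n₃ n₄ n₅ L : ℤ} (hδ : 0 < δ) (hδ1 : δ ≤ 1 / 4)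
    (hM : 0 ≤ M) (hn : 0 < n₁ + n₂ + n₃ + n₄ + n₅) (h5 : n₅ < 0) (h15 : n₁ + n₅ ≠ 0)
    (h35 : n₃ + n₅ ≠ 0) (h2L : |n₂| ≤ L) (h4L : |n₄| ≤ L)
    (hLn : 1024 * L ≤ n₁ + n₂ + n₃ + n₄ + n₅) (hL5 : 1024 * L ≤ -n₅) (hM5 : M ≤ 2 * (-n₅))
    (hΦ : L ^ 2 ≤ |Phi (n₁ + n₂ + n₃ + n₄ + n₅) n₁ n₃ n₅|) :
    Main₁ (2 ^ 100) δ M n₁ n₂ n₃ n₄ n₅ ∧ Main₃ (2 ^ 100) δ M n₁ n₂ n₃ n₄ n₅ := by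
  have e2 := abs_le.1 h2L
  have e4 := abs_le.1 h4L
  rcases lt_or_ge n₁ 0 with h1 | h1 <;> rcases lt_or_ge n₃ 0 with h3 | h3
  · omega
  · have h := main_of_output_of_neg (n₁ := n₃) (n₃ := n₁) hδ hδ1 hM (by linarith) h3 h1 h5 h2L h4L
      (by linarith) hL5 hM5
    exact ⟨h.1.swap₁₃, h.2.swap₁₃⟩
  · exact main_of_output_of_neg hδ hδ1 hM hn h1 h3 h5 h2L h4L hLn hL5 hM5
  · rcases le_total |n₃ + n₅| |n₁ + n₅| with hab | hab
    · exact main_of_resonant (L := (L : ℝ)) hδ hδ1 hM hn.le h1 h3 h5.le h35 hab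
        (by exact_mod_cast h2L) (by exact_mod_cast h4L) (.inl ⟨by exact_mod_cast hn,
          by exact_mod_cast hLn, by exact_mod_cast hL5, hM5⟩) (by exact_mod_cast hΦ)
    · have h := main_of_resonant (n₁ := n₃) (n₂ := n₂) (n₃ := n₁) (n₄ := n₄) (L := (L : ℝ)) hδ hδ1
        hM (by linarith) h3 h1 h5.le h15 hab
        (by exact_mod_cast h2L) (by exact_mod_cast h4L) (by
          rw [sum_swap₁₃]
          exact .inl ⟨by exact_mod_cast hn,
            by exact_mod_cast hLn, by exact_mod_cast hL5, hM5⟩)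
        (by rw [sum_swap₁₃, Phi_swap₁₃]; exact_mod_cast hΦ)
      exact ⟨h.1.swap₁₃, h.2.swap₁₃⟩

theorem low_of_output_pos {δ M : ℝ} {n₁ n₂ n₃ n₄ n₅ L : ℤ} (hδ : 0 < δ) (hδ1 : δ ≤ 1 / 4)
    (hM : 0 ≤ M) (hn : 0 < n₁ + n₂ + n₃ + n₄ + n₅) (h5 : n₅ < 0) (h15 : n₁ + n₅ ≠ 0)
    (h35 : n₃ + n₅ ≠ 0) (h2L : |n₂| ≤ L) (h4L : |n₄| ≤ L) (hLl : (L : ℝ) ≤ max (jb n₂) (jb n₄))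
    (hLn : 1024 * L ≤ n₁ + n₂ + n₃ + n₄ + n₅) (hL5 : 1024 * L ≤ -n₅) (hM5 : M ≤ 2 * (-n₅))
    (hΦ : |Phi (n₁ + n₂ + n₃ + n₄ + n₅) n₁ n₃ n₅| ≤ L ^ 2) :
    Low (2 ^ 100) δ M n₁ n₂ n₃ n₄ n₅ := by
  have e2 := abs_le.1 h2L
  have e4 := abs_le.1 h4L
  -- For the patterns without cancellation |Φ| ≥ n|n₅|, which is positive and at least 1024² L²;
  -- this contradicts |Φ| ≤ L².
  have hbad : ¬ (n₁ + n₂ + n₃ + n₄ + n₅) * (-n₅) ≤ L ^ 2 := by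
    have : 0 < (n₁ + n₂ + n₃ + n₄ + n₅) * (-n₅) := mul_pos hn (by linarith)
    nlinarith [mul_le_mul hLn hL5 (by linarith) hn.le]
  rcases lt_or_ge n₁ 0 with h1 | h1 <;> rcases lt_or_ge n₃ 0 with h3 | h3
  · omega
  · refine absurd ?_ hbad
    have := mul_le_abs_Phi_of_output (n₁ := n₃) (n₃ := n₁) (by linarith) h3 h1.le h5.le h2L h4L
      (by linarith) hL5
    rw [sum_swap₁₃, Phi_swap₁₃] at this
    exact this.trans hΦ
  · exact absurd ((mul_le_abs_Phi_of_output hn.le h1 h3.le h5.le h2L h4L hLn hL5).trans hΦ) hbad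
  · rcases le_total |n₃ + n₅| |n₁ + n₅| with hab | hab
    · exact low_of_resonant (L := (L : ℝ)) hδ hδ1 hM hn.le h1 h3 h5.le h35 hab
        (by exact_mod_cast h2L) (by exact_mod_cast h4L) hLl (.inl ⟨
          by exact_mod_cast hLn, by exact_mod_cast hL5, hM5⟩) (by exact_mod_cast hΦ)
    · refine (low_of_resonant (n₁ := n₃) (n₂ := n₂) (n₃ := n₁) (n₄ := n₄) (L := (L : ℝ)) hδ hδ1
        hM (by linarith) h3 h1 h5.le h15 hab
        (by exact_mod_cast h2L) (by exact_mod_cast h4L) hLl ?_ ?_).swap₁₃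
      · rw [sum_swap₁₃]
        exact .inl ⟨by exact_mod_cast hLn, by exact_mod_cast hL5, hM5⟩
      · rw [sum_swap₁₃, Phi_swap₁₃]; exact_mod_cast hΦ

theorem main_of_inputs_of_nonresonant {δ M : ℝ} {n₁ n₂ n₃ n₄ n₅ L : ℤ} (hδ : 0 < δ)
    (hδ1 : δ ≤ 1 / 4) (hM : 0 ≤ M) (h1 : 0 ≤ n₁ ∨ n₁ ≤ 0 ∧ n₁ + n₂ + n₃ + n₄ + n₅ ≤ 0)
    (h3 : 0 < n₃) (h5 : 0 < n₅) (h2L : |n₂| ≤ L) (h4L : |n₄| ≤ L) (hL3 : 1024 * L ≤ n₃)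
    (hL5 : 1024 * L ≤ n₅) (hM3 : M ≤ 2 * n₃) (hM5 : M ≤ 2 * n₅) :
    Main₁ (2 ^ 100) δ M n₁ n₂ n₃ n₄ n₅ ∧ Main₃ (2 ^ 100) δ M n₁ n₂ n₃ n₄ n₅ := by
  have hP := mul_le_abs_Phi_of_inputs h1 h3.le h5.le h2L h4L hL3 hL5
  have hPR : (n₃ : ℝ) * n₅ ≤
    |((Phi (n₁ + n₂ + n₃ + n₄ + n₅) n₁ n₃ n₅ : ℤ) : ℝ)| := by exact_mod_cast hP
  have e2 := abs_le.1 h2L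
  have e4 := abs_le.1 h4L
  have h3R : (1 : ℝ) ≤ n₃ := by exact_mod_cast h3
  have h5R : (1 : ℝ) ≤ n₅ := by exact_mod_cast h5
  have b3 : M ≤ 4 * jb n₃ := by
    have := (le_abs_self _).trans (abs_le_br (n₃ : ℝ))
    rw [jb_eq_br]; linarith
  have b5 : M ≤ 4 * jb n₅ := by
    have := (le_abs_self _).trans (abs_le_br (n₅ : ℝ))
    rw [jb_eq_br]; linarith
  have a3 : |n₃| = n₃ := abs_of_pos h3
  have a5 : |n₅| = n₅ := abs_of_pos h5
  have a0 := abs_cases (n₁ + n₂ + n₃ + n₄ + n₅)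
  have a1 := abs_cases n₁
  have k0 : |n₁ + n₂ + n₃ + n₄ + n₅| ≤ 4 * (|n₁| + |n₃| + |n₅|) := by omega
  refine main_of_nonresonant hδ hδ1 hM k0 (by omega) (by omega) (by omega) ?_ ?_
    (.inr b3) (.inr b5) (.inl b3)
  · nlinarith
  · have hb0 : jb (n₁ + n₂ + n₃ + n₄ + n₅) ≤ 13 * max (max (jb n₁) (jb n₃)) (jb n₅) := by
      have k0R : |((n₁ + n₂ + n₃ + n₄ + n₅ : ℤ) : ℝ)| ≤
        4 * (|(n₁ : ℝ)| + |(n₃ : ℝ)| + |(n₅ : ℝ)|) := by exact_mod_cast k0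
      have c0 := br_le_one_add_abs ((n₁ + n₂ + n₃ + n₄ + n₅ : ℤ) : ℝ)
      have c1 := abs_le_br (n₁ : ℝ)
      have c3 := abs_le_br (n₃ : ℝ)
      have c5 := abs_le_br (n₅ : ℝ)
      have d5 := one_le_br (n₅ : ℝ)
      have g1 : jb n₁ ≤ max (max (jb n₁) (jb n₃)) (jb n₅) :=
        (le_max_left _ _).trans (le_max_left _ _)
      have g3 : jb n₃ ≤ max (max (jb n₁) (jb n₃)) (jb n₅) :=
        (le_max_right _ _).trans (le_max_left _ _)
      have g5 : jb n₅ ≤ max (max (jb n₁) (jb n₃)) (jb n₅) := le_max_right _ _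
      simp only [jb_eq_br] at *
      linarith
    have hJ := abs_le_br ((Phi (n₁ + n₂ + n₃ + n₄ + n₅) n₁ n₃ n₅ : ℤ) : ℝ)
    rw [jb_eq_br (Phi _ _ _ _)]
    have hx0 : 0 ≤ jb (n₁ + n₂ + n₃ + n₄ + n₅) := (br_pos _).le
    generalize br ((Phi (n₁ + n₂ + n₃ + n₄ + n₅) n₁ n₃ n₅ : ℤ) : ℝ) = J at *
    generalize max (max (jb n₁) (jb n₃)) (jb n₅) = N at *
    have hM2 : M ^ 2 ≤ 4 * J := by nlinarith [mul_le_mul hM3 hM5 hM (by linarith)]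
    calc M ^ 2 * jb (n₁ + n₂ + n₃ + n₄ + n₅) ≤ 4 * J * (13 * N) := by
          gcongr
          nlinarith
      _ ≤ 100 * (N * J) := by
          have : 0 ≤ N * J := mul_nonneg (by linarith) (by nlinarith)
          linarith

/-- Resonance requires n₁ ≤ 0 ≤ n. The negative frequency n₁ is then moved to the fifth place, and
the order of n₃ and n₅ is chosen so that the larger difference comes first. -/
theorem main_of_inputs_pos {δ M : ℝ} {n₁ n₂ n₃ n₄ n₅ L : ℤ} (hδ : 0 < δ)
    (hδ1 : δ ≤ 1 / 4) (hM : 0 ≤ M) (h3 : 0 < n₃) (h5 : 0 < n₅) (h13 : n₁ + n₃ ≠ 0)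
    (h15 : n₁ + n₅ ≠ 0) (h2L : |n₂| ≤ L) (h4L : |n₄| ≤ L) (hL3 : 1024 * L ≤ n₃)
    (hL5 : 1024 * L ≤ n₅) (hM3 : M ≤ 2 * n₃) (hM5 : M ≤ 2 * n₅)
    (hΦ : L ^ 2 ≤ |Phi (n₁ + n₂ + n₃ + n₄ + n₅) n₁ n₃ n₅|) :
    Main₁ (2 ^ 100) δ M n₁ n₂ n₃ n₄ n₅ ∧ Main₃ (2 ^ 100) δ M n₁ n₂ n₃ n₄ n₅ := by
  by_cases hres : 0 ≤ n₁ ∨ n₁ ≤ 0 ∧ n₁ + n₂ + n₃ + n₄ + n₅ ≤ 0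
  · exact main_of_inputs_of_nonresonant hδ hδ1 hM hres h3 h5 h2L h4L hL3 hL5 hM3 hM5
  obtain ⟨h1, hn⟩ : n₁ ≤ 0 ∧ 0 ≤ n₁ + n₂ + n₃ + n₄ + n₅ := by omega
  have hL3' : 1024 * (L : ℝ) ≤ n₃ := by exact_mod_cast hL3
  have hL5' : 1024 * (L : ℝ) ≤ n₅ := by exact_mod_cast hL5
  rcases le_total |n₅ + n₁| |n₃ + n₁| with hab | hab
  · have h := main_of_resonant (n₁ := n₃) (n₂ := n₂) (n₃ := n₅) (n₄ := n₄) (n₅ := n₁)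
      (L := (L : ℝ)) hδ hδ1 hM (by linarith) h3.le h5.le h1 (by omega) hab (by exact_mod_cast h2L)
      (by exact_mod_cast h4L) (.inr ⟨hL3', hL5', hM3, hM5⟩)
      (by rw [sum_swap₃₅, sum_swap₁₃, Phi_swap₃₅, Phi_swap₁₃]; exact_mod_cast hΦ)
    exact ⟨h.1.swap₃₅.swap₁₃, h.2.swap₃₅.swap₁₃⟩
  · have h := main_of_resonant (n₁ := n₅) (n₂ := n₂) (n₃ := n₃) (n₄ := n₄) (n₅ := n₁)
      (L := (L : ℝ)) hδ hδ1 hM (by linarith) h5.le h3.le h1 (by omega) hab (by exact_mod_cast h2L)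
      (by exact_mod_cast h4L) (.inr ⟨hL5', hL3', hM5, hM3⟩)
      (by rw [sum_swap₁₃, sum_swap₃₅, sum_swap₁₃, Phi_swap₁₃, Phi_swap₃₅, Phi_swap₁₃]
          exact_mod_cast hΦ)
    exact ⟨h.1.swap₁₃.swap₃₅.swap₁₃, h.2.swap₁₃.swap₃₅.swap₁₃⟩

theorem low_of_inputs_pos {δ M : ℝ} {n₁ n₂ n₃ n₄ n₅ L : ℤ} (hδ : 0 < δ)
    (hδ1 : δ ≤ 1 / 4) (hM : 0 ≤ M) (h3 : 0 < n₃) (h5 : 0 < n₅) (h13 : n₁ + n₃ ≠ 0)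
    (h15 : n₁ + n₅ ≠ 0) (h2L : |n₂| ≤ L) (h4L : |n₄| ≤ L) (hLl : (L : ℝ) ≤ max (jb n₂) (jb n₄))
    (hL3 : 1024 * L ≤ n₃) (hL5 : 1024 * L ≤ n₅) (hM3 : M ≤ 2 * n₃) (hM5 : M ≤ 2 * n₅)
    (hΦ : |Phi (n₁ + n₂ + n₃ + n₄ + n₅) n₁ n₃ n₅| ≤ L ^ 2) :
    Low (2 ^ 100) δ M n₁ n₂ n₃ n₄ n₅ := by
  have hL : 0 ≤ L := (abs_nonneg _).trans h2L
  by_cases hres : 0 ≤ n₁ ∨ n₁ ≤ 0 ∧ n₁ + n₂ + n₃ + n₄ + n₅ ≤ 0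
  · have := (mul_le_abs_Phi_of_inputs hres h3.le h5.le h2L h4L hL3 hL5).trans hΦ
    have : 0 < n₃ * n₅ := mul_pos h3 h5
    nlinarith [mul_le_mul hL3 hL5 (by linarith) h3.le]
  obtain ⟨h1, hn⟩ : n₁ ≤ 0 ∧ 0 ≤ n₁ + n₂ + n₃ + n₄ + n₅ := by omega
  have hL3' : 1024 * (L : ℝ) ≤ n₃ := by exact_mod_cast hL3
  have hL5' : 1024 * (L : ℝ) ≤ n₅ := by exact_mod_cast hL5
  rcases le_total |n₅ + n₁| |n₃ + n₁| with hab | hab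
  · exact (low_of_resonant (n₁ := n₃) (n₂ := n₂) (n₃ := n₅) (n₄ := n₄) (n₅ := n₁)
      (L := (L : ℝ)) hδ hδ1 hM (by linarith) h3.le h5.le h1 (by omega) hab (by exact_mod_cast h2L)
      (by exact_mod_cast h4L) hLl (.inr ⟨hL3', hL5', hM5⟩)
      (by rw [sum_swap₃₅, sum_swap₁₃, Phi_swap₃₅, Phi_swap₁₃]; exact_mod_cast hΦ)).swap₃₅.swap₁₃
  · exact (low_of_resonant (n₁ := n₅) (n₂ := n₂) (n₃ := n₃) (n₄ := n₄) (n₅ := n₁)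
      (L := (L : ℝ)) hδ hδ1 hM (by linarith) h5.le h3.le h1 (by omega) hab (by exact_mod_cast h2L)
      (by exact_mod_cast h4L) hLl (.inr ⟨hL5', hL3', hM3⟩)
      (by rw [sum_swap₁₃, sum_swap₃₅, sum_swap₁₃, Phi_swap₁₃, Phi_swap₃₅, Phi_swap₁₃]
          exact_mod_cast hΦ)).swap₁₃.swap₃₅.swap₁₃

/-! ### Almost cancelling pairs. -/

/-- The two frequencies of the pair pay for M, and Z = ⟨n₃₅⟩ is within the gain from n₂ or n₄. If n₁
does not absorb the output weight, the output is itself small and is paid for by the same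
derivative. -/
theorem Low.of_pair {δ C M : ℝ} {n₁ n₂ n₃ n₄ n₅ : ℤ} (hδ : 0 < δ) (hδ1 : δ ≤ 1 / 4)
    (hC : 1 ≤ C) (hM : 0 ≤ M) (hM3 : M ≤ C * jb n₃) (hM5 : M ≤ C * jb n₅)
    (hZ : jb (n₃ + n₅) ≤ C * max (jb n₂) (jb n₄)) (hl3 : max (jb n₂) (jb n₄) ≤ C * jb n₃)
    (hl5 : max (jb n₂) (jb n₄) ≤ C * jb n₅)
    (h0 : jb (n₁ + n₂ + n₃ + n₄ + n₅) ≤ C * jb n₁ ∨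
      jb (n₁ + n₂ + n₃ + n₄ + n₅) ≤ C * max (jb n₂) (jb n₄)) :
    Low (C ^ 10) δ M n₁ n₂ n₃ n₄ n₅ := by
  wlog h : jb n₅ ≤ jb n₃ generalizing n₃ n₅
  · refine (this hM5 hM3 (by rwa [add_comm]) hl5 hl3 ?_ (le_of_not_ge h)).swap₃₅
    rwa [sum_swap₃₅]
  have hl : 0 < max (jb n₂) (jb n₄) := lt_max_of_lt_left (br_pos _)
  have hCC : C ≤ C ^ 2 := by nlinarith
  have up : ∀ {a b : ℝ}, 0 < b → a ≤ C * b → a ≤ C ^ 2 * b := fun {a b} hb h =>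
    h.trans (mul_le_mul_of_nonneg_right hCC hb.le)
  have tr : ∀ {a : ℝ}, a ≤ C * max (jb n₂) (jb n₄) → a ≤ C ^ 2 * jb n₅ := fun {a} h =>
    h.trans ((mul_le_mul_of_nonneg_left hl5 (by linarith)).trans (le_of_eq (by ring)))
  have h53 : jb n₅ ≤ C ^ 2 * jb n₃ := up (br_pos _)
    (h.trans (le_mul_of_one_le_left (br_pos _).le hC))
  have hC2 : 1 ≤ C ^ 2 := hC.trans hCC
  rcases h0 with h0 | h0
  · refine (Low.of_resonant (C := C ^ 2) (Z := jb (n₃ + n₅)) hδ hδ1 hC2 hM (one_le_br _)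
      (le_add_of_nonneg_right (resKer_nonneg _ _ _ _ _ _)) (up (br_pos _) hM5) h53
      (up (br_pos _) h0) (tr hZ) (up hl hZ)).mono (le_of_eq (by ring))
  · refine (Low.of_low_output (C := C ^ 2) hδ hδ1 hC2 h53 (up (br_pos _) hM5) (tr h0)
      (up hl h0)).mono ?_
    rw [← pow_mul]
    exact pow_le_pow_right₀ hC (by norm_num)

/-- The pair `(n₃, n₅)` almost cancels. -/
theorem Low.of_close_pair {δ M : ℝ} {n₁ n₂ n₃ n₄ n₅ L : ℤ} (hδ : 0 < δ) (hδ1 : δ ≤ 1 / 4)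
    (hM : 0 ≤ M) (hL : L = max |n₂| |n₄|) (hM3 : M ≤ 4 * |(n₃ : ℝ)|) (hM5 : M ≤ 4 * |(n₅ : ℝ)|)
    (hZ : |n₃ + n₅| ≤ 2 ^ 11 * L) (hl3 : L ≤ |n₃|) (hl5 : L ≤ |n₅|) :
    Low (2 ^ 150) δ M n₁ n₂ n₃ n₄ n₅ := by
  have hm : ((L : ℤ) : ℝ) ≤ max (jb n₂) (jb n₄) := by
    rw [hL]; push_cast
    exact max_le_max (abs_le_br _) (abs_le_br _)
  have hl1 : 1 ≤ max (jb n₂) (jb n₄) := le_max_of_le_left (one_le_br _)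
  have hmle : ∀ k : ℤ, L ≤ |k| → max (jb n₂) (jb n₄) ≤ 2 ^ 14 * jb k := by
    intro k hk
    have h2 : jb n₂ ≤ jb k := br_le_br (by exact_mod_cast ((le_max_left _ _).trans (hL ▸ hk)))
    have h4 : jb n₄ ≤ jb k := br_le_br (by exact_mod_cast ((le_max_right _ _).trans (hL ▸ hk)))
    exact (max_le h2 h4).trans (le_mul_of_one_le_left (br_pos _).le (by norm_num))
  have hjl : ∀ k : ℤ, |k| ≤ 2 ^ 13 * L → jb k ≤ 2 ^ 14 * max (jb n₂) (jb n₄) := by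
    intro k hk
    have h := br_le_one_add_abs (k : ℝ)
    have hk' : |(k : ℝ)| ≤ 2 ^ 13 * (L : ℝ) := by exact_mod_cast hk
    rw [jb_eq_br k]
    linarith
  have hMj : ∀ k : ℤ, M ≤ 4 * |(k : ℝ)| → M ≤ 2 ^ 14 * jb k := by
    intro k hk
    have := abs_le_br (k : ℝ)
    have := br_pos (k : ℝ)
    rw [jb_eq_br]
    linarith
  have hL0 : 0 ≤ L := hL ▸ le_max_of_le_left (abs_nonneg _)
  refine (Low.of_pair (C := 2 ^ 14) hδ hδ1 (by norm_num) hM (hMj _ hM3) (hMj _ hM5)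
    (hjl _ (by linarith)) (hmle _ hl3) (hmle _ hl5) ?_).mono (by norm_num)
  have e2 := abs_le.1 (hL ▸ le_max_left _ _ : |n₂| ≤ L)
  have e4 := abs_le.1 (hL ▸ le_max_right _ _ : |n₄| ≤ L)
  have eZ := abs_le.1 hZ
  have hn : |n₁ + n₂ + n₃ + n₄ + n₅| ≤ |n₁| + 2 ^ 12 * L := by
    have := abs_le.1 (le_refl |n₁|)
    rw [abs_le]
    constructor <;> linarith [this.1, this.2, e2.1, e2.2, e4.1, e4.2, eZ.1, eZ.2]
  -- Since n = n₁ + O(L), either the output is O(L) or it is O(|n₁|).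
  rcases le_total |n₁| L with h | h
  · exact .inr (hjl _ (by linarith))
  · refine .inl (br_le_mul_of_abs_le (by norm_num) ?_)
    exact_mod_cast (by linarith : |n₁ + n₂ + n₃ + n₄ + n₅| ≤ 2 ^ 14 * |n₁|)

/-! ### Exceptional sets and sign conditions. -/

theorem eta_sq_mul_le_iff {x y : ℝ} : eta ^ 2 * x ≤ y ↔ x ≤ 2 ^ 20 * y := by
  unfold eta
  constructor <;> intro h <;> linarith

theorem eta_mul_le_iff {x y : ℝ} : eta * x ≤ y ↔ x ≤ 2 ^ 10 * y := by
  unfold eta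
  constructor <;> intro h <;> linarith

/-- Clearing η = 2^{-10} leaves integer inequalities, to which `omega` applies. -/
theorem A₁_iff {n₁ n₂ n₃ n₄ n₅ : ℤ} : A₁ n₁ n₂ n₃ n₄ n₅ ↔
    (n₁ + n₅) * (n₃ + n₅) = 0 ∨
    min |n₅| |n₁ + n₂ + n₃ + n₄ + n₅| ≤ 2 ^ 20 * max |n₂| |n₄| ∨
    (2 ^ 20 * max |n₂| |n₄| < |n₅| ∧ 2 ^ 10 * |n₅| < min |n₁| |n₃| ∧
      |n₁ + n₃| ≤ 2 ^ 10 * |n₂ + n₄|) ∨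
    (2 ^ 20 * max |n₂| |n₄| < |n₅| ∧ 2 ^ 10 * |n₃| < min |n₁| |n₅| ∧
      |n₁ + n₅| ≤ 2 ^ 10 * |n₂ + n₄| ∧ |n₅| ≤ 2 * |n₁|) := by
  unfold A₁
  simp only [← not_le, eta_sq_mul_le_iff, eta_mul_le_iff]
  norm_cast

theorem A₂_iff {n₁ n₂ n₃ n₄ n₅ : ℤ} : A₂ n₁ n₂ n₃ n₄ n₅ ↔
    (n₁ + n₃) * (n₁ + n₅) = 0 ∨ min |n₃| |n₅| ≤ 2 ^ 10 * max |n₂| |n₄| := by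
  unfold A₂
  simp only [eta_mul_le_iff]
  norm_cast

theorem max_abs_sq (a b : ℤ) : max (|a| ^ 2) (|b| ^ 2) = (max |a| |b|) ^ 2 := by
  rcases le_total |a| |b| with h | h
  · rw [max_eq_right h, max_eq_right (pow_le_pow_left₀ (abs_nonneg _) h 2)]
  · rw [max_eq_left h, max_eq_left (pow_le_pow_left₀ (abs_nonneg _) h 2)]

theorem cast_max_abs_le (n₂ n₄ : ℤ) : ((max |n₂| |n₄| : ℤ) : ℝ) ≤ max (jb n₂) (jb n₄) := by
  push_cast
  exact max_le_max (abs_le_br _) (abs_le_br _)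

/-- The sign condition of the first five multipliers and their reflections. -/
def SignOut (n n₄ n₅ : ℤ) : Prop := (0 < n ∧ n₄ + n₅ < 0) ∨ (n < 0 ∧ 0 < n₄ + n₅)

/-- The sign condition of the last two multipliers and their reflections. -/
def SignIn (n₂ n₃ n₄ n₅ : ℤ) : Prop :=
  (0 < n₂ + n₃ ∧ 0 < n₄ + n₅) ∨ (n₂ + n₃ < 0 ∧ n₄ + n₅ < 0)

/-- Off 𝒜₁ both n₂ and n₄ are negligible against n₅ and n, so n₄₅ has the sign of n₅ and the
multiplier is O(|n₅|). A reflection arranges n > 0 > n₅. -/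
theorem main_of_signOut {δ : ℝ} {n₁ n₂ n₃ n₄ n₅ : ℤ} (hδ : 0 < δ) (hδ1 : δ ≤ 1 / 4)
    (hs : SignOut (n₁ + n₂ + n₃ + n₄ + n₅) n₄ n₅) (hA : ¬ A₁ n₁ n₂ n₃ n₄ n₅)
    (hΦ : max (|n₂| ^ 2) (|n₄| ^ 2) < |Phi (n₁ + n₂ + n₃ + n₄ + n₅) n₁ n₃ n₅|) :
    Main₁ (2 ^ 200) δ |((n₄ + n₅ : ℤ) : ℝ)| n₁ n₂ n₃ n₄ n₅ ∧
      Main₃ (2 ^ 200) δ |((n₄ + n₅ : ℤ) : ℝ)| n₁ n₂ n₃ n₄ n₅ := by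
  rw [A₁_iff, not_or, not_or, mul_eq_zero, not_or, not_le, lt_min_iff] at hA
  obtain ⟨⟨h15, h35⟩, ⟨hL5, hLn⟩, -⟩ := hA
  rw [max_abs_sq] at hΦ
  have h2L : |n₂| ≤ max |n₂| |n₄| := le_max_left _ _
  have h4L : |n₄| ≤ max |n₂| |n₄| := le_max_right _ _
  have hL0 : 0 ≤ max |n₂| |n₄| := (abs_nonneg _).trans h2L
  generalize max |n₂| |n₄| = L at *
  have hM5 : |((n₄ + n₅ : ℤ) : ℝ)| ≤ 2 * |(n₅ : ℝ)| := by
    have := abs_add_le n₄ n₅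
    exact_mod_cast (by linarith : |n₄ + n₅| ≤ 2 * |n₅|)
  have e4 := abs_le.1 h4L
  have a5 := abs_cases n₅
  have a0 := abs_cases (n₁ + n₂ + n₃ + n₄ + n₅)
  rcases hs with ⟨hn, h45⟩ | ⟨hn, h45⟩
  · have h5 : n₅ < 0 := by omega
    have h := main_of_output_pos (n₁ := n₁) (n₃ := n₃) hδ hδ1 (abs_nonneg _) hn h5 h15 h35 h2L h4L
      (by omega) (by omega) (by rwa [abs_of_neg (by exact_mod_cast h5 : (n₅ : ℝ) < 0)] at hM5) hΦ.le
    exact ⟨h.1.mono (by norm_num), h.2.mono (by norm_num)⟩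
  · have h5 : 0 < n₅ := by omega
    rw [← abs_neg n₂] at h2L
    rw [← abs_neg n₄] at h4L
    have h := main_of_output_pos (n₁ := -n₁) (n₂ := -n₂) (n₃ := -n₃) (n₄ := -n₄) (n₅ := -n₅)
      (L := L) hδ hδ1 (abs_nonneg ((n₄ + n₅ : ℤ) : ℝ)) (by linarith) (by linarith) (by omega)
      (by omega) h2L h4L (by omega) (by omega)
      (by rw [Int.cast_neg, neg_neg]
          rwa [abs_of_pos (by exact_mod_cast h5 : 0 < (n₅ : ℝ))] at hM5)
      (by simp only [← neg_add, Phi_neg, abs_neg]; exact hΦ.le)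
    exact ⟨h.1.neg.mono (by norm_num), h.2.neg.mono (by norm_num)⟩

/-- Off 𝒜₂ the signs of n₂₃ and n₄₅ are those of n₃ and n₅, and both frequencies control the
multiplier; a reflection makes them positive. -/
theorem main_of_signIn {δ : ℝ} {n₁ n₂ n₃ n₄ n₅ : ℤ} (hδ : 0 < δ) (hδ1 : δ ≤ 1 / 4)
    (hs : SignIn n₂ n₃ n₄ n₅) (hA : ¬ A₂ n₁ n₂ n₃ n₄ n₅)
    (hΦ : max (|n₂| ^ 2) (|n₄| ^ 2) < |Phi (n₁ + n₂ + n₃ + n₄ + n₅) n₁ n₃ n₅|) :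
    Main₁ (2 ^ 200) δ ((min |n₂ + n₃| |n₄ + n₅| : ℤ) : ℝ) n₁ n₂ n₃ n₄ n₅ ∧
      Main₃ (2 ^ 200) δ ((min |n₂ + n₃| |n₄ + n₅| : ℤ) : ℝ) n₁ n₂ n₃ n₄ n₅ := by
  rw [A₂_iff, not_or, mul_eq_zero, not_or, not_le, lt_min_iff] at hA
  obtain ⟨⟨h13, h15⟩, hL3, hL5⟩ := hA
  rw [max_abs_sq] at hΦ
  have h2L : |n₂| ≤ max |n₂| |n₄| := le_max_left _ _
  have h4L : |n₄| ≤ max |n₂| |n₄| := le_max_right _ _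
  have hL0 : 0 ≤ max |n₂| |n₄| := (abs_nonneg _).trans h2L
  generalize max |n₂| |n₄| = L at *
  have hM0 : (0 : ℝ) ≤ ((min |n₂ + n₃| |n₄ + n₅| : ℤ) : ℝ) := by
    exact_mod_cast le_min (abs_nonneg _) (abs_nonneg _)
  have hM3 : ((min |n₂ + n₃| |n₄ + n₅| : ℤ) : ℝ) ≤ 2 * ((|n₃| : ℤ) : ℝ) := by
    have := abs_add_le n₂ n₃
    exact_mod_cast (min_le_left _ _).trans (by linarith : |n₂ + n₃| ≤ 2 * |n₃|)
  have hM5 : ((min |n₂ + n₃| |n₄ + n₅| : ℤ) : ℝ) ≤ 2 * ((|n₅| : ℤ) : ℝ) := by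
    have := abs_add_le n₄ n₅
    exact_mod_cast (min_le_right _ _).trans (by linarith : |n₄ + n₅| ≤ 2 * |n₅|)
  generalize ((min |n₂ + n₃| |n₄ + n₅| : ℤ) : ℝ) = M at *
  have e2 := abs_le.1 h2L
  have e4 := abs_le.1 h4L
  have a5 := abs_cases n₅
  have a3 := abs_cases n₃
  rcases hs with ⟨h23, h45⟩ | ⟨h23, h45⟩
  · have h5 : 0 < n₅ := by omega
    have h3 : 0 < n₃ := by omega
    rw [abs_of_pos h3] at hM3
    rw [abs_of_pos h5] at hM5
    have h := main_of_inputs_pos (n₁ := n₁) (n₃ := n₃) hδ hδ1 hM0 h3 h5 h13 h15 h2L h4L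
      (by omega) (by omega) hM3 hM5 hΦ.le
    exact ⟨h.1.mono (by norm_num), h.2.mono (by norm_num)⟩
  · have h5 : n₅ < 0 := by omega
    have h3 : n₃ < 0 := by omega
    rw [abs_of_neg h3] at hM3
    rw [abs_of_neg h5] at hM5
    rw [← abs_neg n₂] at h2L
    rw [← abs_neg n₄] at h4L
    have h := main_of_inputs_pos (n₁ := -n₁) (n₂ := -n₂) (n₃ := -n₃) (n₄ := -n₄) (n₅ := -n₅)
      (L := L) hδ hδ1 hM0 (by linarith) (by linarith) (by omega)
      (by omega) h2L h4L (by omega) (by omega) hM3 hM5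
      (by simp only [← neg_add, Phi_neg, abs_neg]; exact hΦ.le)
    exact ⟨h.1.neg.mono (by norm_num), h.2.neg.mono (by norm_num)⟩

/-- The output frequency is dominated by `n₂` or `n₄`, and `n₃` is comparable to `n₅`. -/
theorem Low.of_small_output {δ M : ℝ} {n₁ n₂ n₃ n₄ n₅ : ℤ} (hδ : 0 < δ) (hδ1 : δ ≤ 1 / 4)
    (hM5 : M ≤ 2 * |(n₅ : ℝ)|) (h53 : |n₅| ≤ 4 * |n₃|)
    (h05 : |n₁ + n₂ + n₃ + n₄ + n₅| ≤ |n₅|)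
    (h0 : |n₁ + n₂ + n₃ + n₄ + n₅| ≤ 2 ^ 20 * max |n₂| |n₄|) :
    Low (2 ^ 150) δ M n₁ n₂ n₃ n₄ n₅ := by
  have hm := cast_max_abs_le n₂ n₄
  have hl1 : 1 ≤ max (jb n₂) (jb n₄) := le_max_of_le_left (one_le_br _)
  have h5 := abs_le_br (n₅ : ℝ)
  have h5' := br_pos (n₅ : ℝ)
  refine (Low.of_low_output (C := 2 ^ 21) hδ hδ1 (by norm_num) (br_le_mul_of_abs_le (by norm_num) ?_)
    ?_ (br_le_mul_of_abs_le (by norm_num) ?_) ?_).mono (by norm_num)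
  · exact_mod_cast (by linarith [abs_nonneg n₃] : |n₅| ≤ 2 ^ 21 * |n₃|)
  · rw [jb_eq_br]; linarith
  · exact_mod_cast (by linarith [abs_nonneg n₅] : |n₁ + n₂ + n₃ + n₄ + n₅| ≤ 2 ^ 21 * |n₅|)
  · have h := br_le_one_add_abs ((n₁ + n₂ + n₃ + n₄ + n₅ : ℤ) : ℝ)
    have h0' : |((n₁ + n₂ + n₃ + n₄ + n₅ : ℤ) : ℝ)| ≤ 2 ^ 20 * ((max |n₂| |n₄| : ℤ) : ℝ) := by
      exact_mod_cast h0
    rw [jb_eq_br (n₁ + n₂ + n₃ + n₄ + n₅)]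
    linarith

/-- Each way of being harmless supplies a gain in L: n₅ = O(L), a vanishing or almost vanishing
pair, or n = O(L). When these are excluded, |Φ| ≤ L² is the only remaining reason. -/
theorem low_of_signOut {δ : ℝ} {n₁ n₂ n₃ n₄ n₅ : ℤ} (hδ : 0 < δ) (hδ1 : δ ≤ 1 / 4)
    (hs : SignOut (n₁ + n₂ + n₃ + n₄ + n₅) n₄ n₅) (hA : A₁ n₁ n₂ n₃ n₄ n₅ ∨
      |Phi (n₁ + n₂ + n₃ + n₄ + n₅) n₁ n₃ n₅| ≤ max (|n₂| ^ 2) (|n₄| ^ 2)) :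
    Low (2 ^ 200) δ |((n₄ + n₅ : ℤ) : ℝ)| n₁ n₂ n₃ n₄ n₅ := by
  have hm := cast_max_abs_le n₂ n₄
  have h2L : |n₂| ≤ max |n₂| |n₄| := le_max_left _ _
  have h4L : |n₄| ≤ max |n₂| |n₄| := le_max_right _ _
  have hL0 : 0 ≤ max |n₂| |n₄| := (abs_nonneg _).trans h2L
  have h45 := abs_add_le n₄ n₅
  have h24 := abs_add_le n₂ n₄
  rcases le_or_gt |n₅| (2 ^ 20 * max |n₂| |n₄|) with hL5 | hL5
  · refine (Low.of_le (C := 2 ^ 21) hδ hδ1 (by norm_num) ?_).mono (by norm_num)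
    have : |((n₄ + n₅ : ℤ) : ℝ)| ≤ 2 ^ 21 * ((max |n₂| |n₄| : ℤ) : ℝ) := by
      exact_mod_cast (by linarith : |n₄ + n₅| ≤ 2 ^ 21 * max |n₂| |n₄|)
    linarith
  have hM5Z : |n₄ + n₅| ≤ 2 * |n₅| := by linarith
  have hM5 : |((n₄ + n₅ : ℤ) : ℝ)| ≤ 2 * |(n₅ : ℝ)| := by exact_mod_cast hM5Z
  have hMle : ∀ k : ℤ, |n₄ + n₅| ≤ 4 * |k| → |((n₄ + n₅ : ℤ) : ℝ)| ≤ 4 * |(k : ℝ)| :=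
    fun k hk => by exact_mod_cast hk
  have M0 := abs_nonneg ((n₄ + n₅ : ℤ) : ℝ)
  by_cases h15 : n₁ + n₅ = 0
  · have e : |n₁| = |n₅| := by rw [eq_neg_of_add_eq_zero_left h15, abs_neg]
    refine (Low.of_close_pair (n₁ := n₃) (n₃ := n₁) hδ hδ1 M0 rfl (hMle _ (by omega))
      (hMle _ (by omega)) ?_ (by omega) (by omega)).swap₁₃.mono (by norm_num)
    rw [h15, abs_zero]; positivity
  by_cases h35 : n₃ + n₅ = 0
  · have e : |n₃| = |n₅| := by rw [eq_neg_of_add_eq_zero_left h35, abs_neg]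
    refine (Low.of_close_pair hδ hδ1 M0 rfl (hMle _ (by omega))
      (hMle _ (by omega)) ?_ (by omega) (by omega)).mono (by norm_num)
    rw [h35, abs_zero]; positivity
  rcases le_or_gt |n₁ + n₂ + n₃ + n₄ + n₅| (2 ^ 20 * max |n₂| |n₄|) with hLn | hLn
  -- The signs of n and n₄₅ are opposite, so |n₁ + n₂ + n₃| = |n − n₄₅| ≥ |n₄₅| and one of n₁, n₃ is
  -- of the size of n₅.
  · have hor : |n₅| ≤ 4 * |n₃| ∨ |n₅| ≤ 4 * |n₁| := by
      have e2 := abs_le.1 h2L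
      have e4 := abs_le.1 h4L
      have a1 := abs_cases n₁
      have a3 := abs_cases n₃
      have a5 := abs_cases n₅
      rcases hs with ⟨hn, h⟩ | ⟨hn, h⟩ <;> omega
    rcases hor with h | h
    · exact (Low.of_small_output hδ hδ1 hM5 h (by linarith) hLn).mono (by norm_num)
    · refine (Low.of_small_output (n₁ := n₃) (n₃ := n₁) hδ hδ1 hM5 h ?_ ?_).swap₁₃.mono
        (by norm_num)
      · rw [sum_swap₁₃]; linarith
      · rwa [sum_swap₁₃]
  rw [A₁_iff, mul_eq_zero, max_abs_sq] at hA
  rcases hA with ((h | h) | h | ⟨-, h, h'⟩ | ⟨-, h, h', h''⟩) | hΦ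
  · exact absurd h h15
  · exact absurd h h35
  · exact absurd h (not_le.2 (lt_min hL5 hLn))
  -- The almost cancelling pair is (n₁, n₃): |n₁₃| ≤ 2^10 |n₂₄| ≤ 2^11 L. Both exceed n₅, hence also
  -- M up to a constant.
  · rw [lt_min_iff] at h
    refine (Low.of_close_pair (n₁ := n₅) (n₃ := n₃) (n₅ := n₁) hδ hδ1 M0 rfl (hMle _ (by omega))
      (hMle _ (by omega)) ?_ (by omega) (by omega)).swap₁₃.swap₃₅.swap₁₃.mono (by norm_num)
    rw [add_comm]; linarith
  · rw [lt_min_iff] at h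
    refine (Low.of_close_pair (n₁ := n₃) (n₃ := n₁) (n₅ := n₅) hδ hδ1 M0 rfl (hMle _ (by omega))
      (hMle _ (by omega)) ?_ (by omega) (by omega)).swap₁₃.mono (by norm_num)
    linarith
  · generalize max |n₂| |n₄| = L at *
    have e4 := abs_le.1 h4L
    have a5 := abs_cases n₅
    have a0 := abs_cases (n₁ + n₂ + n₃ + n₄ + n₅)
    rcases hs with ⟨hn, h45⟩ | ⟨hn, h45⟩
    · have h5 : n₅ < 0 := by omega
      exact (low_of_output_pos (n₁ := n₁) (n₃ := n₃) hδ hδ1 M0 hn h5 h15 h35 h2L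
        h4L hm (by omega) (by omega)
        (by rwa [abs_of_neg (by exact_mod_cast h5 : (n₅ : ℝ) < 0)] at hM5) hΦ).mono (by norm_num)
    · have h5 : 0 < n₅ := by omega
      rw [← abs_neg n₂] at h2L
      rw [← abs_neg n₄] at h4L
      rw [← jb_neg n₂, ← jb_neg n₄] at hm
      exact (low_of_output_pos (n₁ := -n₁) (n₂ := -n₂) (n₃ := -n₃) (n₄ := -n₄) (n₅ := -n₅)
        (L := L) hδ hδ1 M0 (by linarith) (by linarith) (by omega)
        (by omega) h2L h4L hm (by omega) (by omega)
        (by rw [Int.cast_neg, neg_neg]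
            rwa [abs_of_pos (by exact_mod_cast h5 : 0 < (n₅ : ℝ))] at hM5)
        (by simp only [← neg_add, Phi_neg, abs_neg]; exact hΦ)).neg.mono (by norm_num)

/-- If n₃ or n₅ is O(L), so is the minimum that bounds the multiplier. Otherwise n₁ is opposite to
n₃ or to n₅, or only |Φ| ≤ L² is left. -/
theorem low_of_signIn {δ : ℝ} {n₁ n₂ n₃ n₄ n₅ : ℤ} (hδ : 0 < δ) (hδ1 : δ ≤ 1 / 4)
    (hs : SignIn n₂ n₃ n₄ n₅) (hA : A₂ n₁ n₂ n₃ n₄ n₅ ∨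
      |Phi (n₁ + n₂ + n₃ + n₄ + n₅) n₁ n₃ n₅| ≤ max (|n₂| ^ 2) (|n₄| ^ 2)) :
    Low (2 ^ 200) δ ((min |n₂ + n₃| |n₄ + n₅| : ℤ) : ℝ) n₁ n₂ n₃ n₄ n₅ := by
  have hm := cast_max_abs_le n₂ n₄
  have h2L : |n₂| ≤ max |n₂| |n₄| := le_max_left _ _
  have h4L : |n₄| ≤ max |n₂| |n₄| := le_max_right _ _
  have hL0 : 0 ≤ max |n₂| |n₄| := (abs_nonneg _).trans h2L
  have h45 := abs_add_le n₄ n₅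
  have h23 := abs_add_le n₂ n₃
  have hm1 := min_le_left |n₂ + n₃| |n₄ + n₅|
  have hm2 := min_le_right |n₂ + n₃| |n₄ + n₅|
  have M0 : (0 : ℝ) ≤ ((min |n₂ + n₃| |n₄ + n₅| : ℤ) : ℝ) := by
    exact_mod_cast le_min (abs_nonneg _) (abs_nonneg _)
  rcases le_or_gt (min |n₃| |n₅|) (2 ^ 10 * max |n₂| |n₄|) with hL | hL
  · refine (Low.of_le (C := 2 ^ 11) hδ hδ1 (by norm_num) ?_).mono (by norm_num)
    have h : min |n₂ + n₃| |n₄ + n₅| ≤ 2 ^ 11 * max |n₂| |n₄| := by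
      rcases min_le_iff.1 hL with h | h <;> linarith
    have : ((min |n₂ + n₃| |n₄ + n₅| : ℤ) : ℝ) ≤ 2 ^ 11 * ((max |n₂| |n₄| : ℤ) : ℝ) := by
      exact_mod_cast h
    linarith
  obtain ⟨hL3, hL5⟩ := lt_min_iff.1 hL
  have hM3 : ((min |n₂ + n₃| |n₄ + n₅| : ℤ) : ℝ) ≤ 2 * ((|n₃| : ℤ) : ℝ) := by
    exact_mod_cast hm1.trans (by linarith : |n₂ + n₃| ≤ 2 * |n₃|)
  have hM5 : ((min |n₂ + n₃| |n₄ + n₅| : ℤ) : ℝ) ≤ 2 * ((|n₅| : ℤ) : ℝ) := by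
    exact_mod_cast hm2.trans (by linarith : |n₄ + n₅| ≤ 2 * |n₅|)
  generalize ((min |n₂ + n₃| |n₄ + n₅| : ℤ) : ℝ) = M at *
  have hMle : ∀ k : ℤ, M ≤ 2 * ((|k| : ℤ) : ℝ) → M ≤ 4 * |(k : ℝ)| := by
    intro k hk
    push_cast at hk
    linarith [abs_nonneg (k : ℝ)]
  by_cases h13 : n₁ + n₃ = 0
  · have e : |n₁| = |n₃| := by rw [eq_neg_of_add_eq_zero_left h13, abs_neg]
    refine (Low.of_close_pair (n₁ := n₅) (n₃ := n₃) (n₅ := n₁) hδ hδ1 M0 rfl (hMle _ hM3)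
      (hMle _ (by rwa [e])) ?_ (by omega) (by omega)).swap₁₃.swap₃₅.swap₁₃.mono (by norm_num)
    rw [add_comm, h13, abs_zero]; positivity
  by_cases h15 : n₁ + n₅ = 0
  · have e : |n₁| = |n₅| := by rw [eq_neg_of_add_eq_zero_left h15, abs_neg]
    refine (Low.of_close_pair (n₁ := n₃) (n₃ := n₁) (n₅ := n₅) hδ hδ1 M0 rfl
      (hMle _ (by rwa [e])) (hMle _ hM5) ?_ (by omega) (by omega)).swap₁₃.mono (by norm_num)
    rw [h15, abs_zero]; positivity
  rw [A₂_iff, mul_eq_zero, max_abs_sq] at hA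
  rcases hA with ((h | h) | h) | hΦ
  · exact absurd h h13
  · exact absurd h h15
  · exact absurd h (not_le.2 hL)
  generalize max |n₂| |n₄| = L at *
  have e2 := abs_le.1 h2L
  have e4 := abs_le.1 h4L
  have a5 := abs_cases n₅
  have a3 := abs_cases n₃
  rcases hs with ⟨g23, g45⟩ | ⟨g23, g45⟩
  · have h5 : 0 < n₅ := by omega
    have h3 : 0 < n₃ := by omega
    rw [abs_of_pos h3] at hM3
    rw [abs_of_pos h5] at hM5
    exact (low_of_inputs_pos (n₁ := n₁) (n₃ := n₃) hδ hδ1 M0 h3 h5 h13 h15 h2L h4L hm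
      (by omega) (by omega) hM3 hM5 hΦ).mono (by norm_num)
  · have h5 : n₅ < 0 := by omega
    have h3 : n₃ < 0 := by omega
    rw [abs_of_neg h3] at hM3
    rw [abs_of_neg h5] at hM5
    rw [← abs_neg n₂] at h2L
    rw [← abs_neg n₄] at h4L
    rw [← jb_neg n₂, ← jb_neg n₄] at hm
    exact (low_of_inputs_pos (n₁ := -n₁) (n₂ := -n₂) (n₃ := -n₃) (n₄ := -n₄) (n₅ := -n₅)
      (L := L) hδ hδ1 M0 (by linarith) (by linarith) (by omega)
      (by omega) h2L h4L hm (by omega) (by omega) hM3 hM5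
      (by simp only [← neg_add, Phi_neg, abs_neg]; exact hΦ)).neg.mono (by norm_num)

/-! ### Size and support of the multipliers. -/

theorem Main₁.scale {A B δ M M' : ℝ} {n₁ n₂ n₃ n₄ n₅ : ℤ} (h : Main₁ A δ M n₁ n₂ n₃ n₄ n₅)
    (hB : 0 ≤ B) (hM : M' ≤ B * M) : Main₁ (B * A) δ M' n₁ n₂ n₃ n₄ n₅ := by
  unfold Main₁ swt at *
  have h0 : ∀ (k : ℤ) (r : ℝ), 0 ≤ jb k ^ r := fun k r => Real.rpow_nonneg (br_pos _).le _
  generalize Phi _ _ _ _ = φ at *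
  generalize n₁ + n₂ + n₃ + n₄ + n₅ = n at *
  have key : ∀ a b e₁ e₂ e₃ e₄ e₅ : ℝ, 0 ≤ a → 0 ≤ b → 0 ≤ e₁ → 0 ≤ e₂ → 0 ≤ e₃ → 0 ≤ e₄ →
      0 ≤ e₅ → M' * a * b * (e₁ * e₂ * e₃ * e₄ * e₅) ≤
        B * (M * a * b * (e₁ * e₂ * e₃ * e₄ * e₅)) := by
    intro a b e₁ e₂ e₃ e₄ e₅ ha hb h1 h2 h3 h4 h5
    calc _ ≤ (B * M) * a * b * (e₁ * e₂ * e₃ * e₄ * e₅) := by gcongr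
      _ = _ := by ring
  refine (key _ _ _ _ _ _ _ (h0 _ _) (h0 _ _) (h0 _ _) (h0 _ _) (h0 _ _) (h0 _ _)
    (h0 _ _)).trans ?_
  rw [mul_assoc B]
  exact mul_le_mul_of_nonneg_left h hB

theorem Main₃.scale {A B δ M M' : ℝ} {n₁ n₂ n₃ n₄ n₅ : ℤ} (h : Main₃ A δ M n₁ n₂ n₃ n₄ n₅)
    (hB : 0 ≤ B) (hM : M' ≤ B * M) : Main₃ (B * A) δ M' n₁ n₂ n₃ n₄ n₅ := by
  unfold Main₃ swt at *
  have h0 : ∀ (k : ℤ) (r : ℝ), 0 ≤ jb k ^ r := fun k r => Real.rpow_nonneg (br_pos _).le _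
  have hm : 0 ≤ max (max (jb n₁) (jb n₃)) (jb n₅) := le_max_of_le_right (br_pos _).le
  generalize Phi _ _ _ _ = φ at *
  generalize n₁ + n₂ + n₃ + n₄ + n₅ = n at *
  have key : ∀ a b e₁ e₂ e₃ e₄ e₅ d : ℝ, 0 ≤ a → 0 ≤ b → 0 ≤ e₁ → 0 ≤ e₂ → 0 ≤ e₃ → 0 ≤ e₄ →
      0 ≤ e₅ → 0 ≤ d → M' * a * b * (e₁ * e₂ * e₃ * e₄ * e₅) * d ≤
        B * (M * a * b * (e₁ * e₂ * e₃ * e₄ * e₅) * d) := by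
    intro a b e₁ e₂ e₃ e₄ e₅ d ha hb h1 h2 h3 h4 h5 hd
    calc _ ≤ (B * M) * a * b * (e₁ * e₂ * e₃ * e₄ * e₅) * d := by gcongr
      _ = _ := by ring
  refine (key _ _ _ _ _ _ _ _ (h0 _ _) (h0 _ _) (h0 _ _) (h0 _ _) (h0 _ _) (h0 _ _)
    (h0 _ _) hm).trans ?_
  rw [mul_assoc B]
  exact mul_le_mul_of_nonneg_left h hB

theorem Low.scale {A B δ M M' : ℝ} {n₁ n₂ n₃ n₄ n₅ : ℤ} (h : Low A δ M n₁ n₂ n₃ n₄ n₅)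
    (hB : 0 ≤ B) (hM : M' ≤ B * M) : Low (B * A) δ M' n₁ n₂ n₃ n₄ n₅ := by
  unfold Low swt at *
  have h0 : ∀ (k : ℤ) (r : ℝ), 0 ≤ jb k ^ r := fun k r => Real.rpow_nonneg (br_pos _).le _
  have hm : 0 ≤ (max (jb n₂) (jb n₄))⁻¹ := inv_nonneg.2 (le_max_of_le_right (br_pos _).le)
  generalize n₁ + n₂ + n₃ + n₄ + n₅ = n at *
  have key : ∀ a b e₁ e₂ e₃ e₄ e₅ : ℝ, 0 ≤ a → 0 ≤ b → 0 ≤ e₁ → 0 ≤ e₂ → 0 ≤ e₃ → 0 ≤ e₄ →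
      0 ≤ e₅ → M' * a * b * (e₁ * e₂ * e₃ * e₄ * e₅) ≤
        B * (M * a * b * (e₁ * e₂ * e₃ * e₄ * e₅)) := by
    intro a b e₁ e₂ e₃ e₄ e₅ ha hb h1 h2 h3 h4 h5
    calc _ ≤ (B * M) * a * b * (e₁ * e₂ * e₃ * e₄ * e₅) := by gcongr
      _ = _ := by ring
  refine (key _ _ _ _ _ _ _ hm (h0 _ _) (h0 _ _) (h0 _ _) (h0 _ _) (h0 _ _)
    (h0 _ _)).trans ?_
  rw [mul_assoc B]
  exact mul_le_mul_of_nonneg_left h hB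

theorem Main₁.zero {A δ : ℝ} (hA : 0 ≤ A) (n₁ n₂ n₃ n₄ n₅ : ℤ) : Main₁ A δ 0 n₁ n₂ n₃ n₄ n₅ := by
  unfold Main₁
  simpa using mul_nonneg hA (symKer_nonneg _ _ _ _ _ _)

theorem Main₃.zero {A δ : ℝ} (hA : 0 ≤ A) (n₁ n₂ n₃ n₄ n₅ : ℤ) : Main₃ A δ 0 n₁ n₂ n₃ n₄ n₅ := by
  unfold Main₃
  simpa using mul_nonneg hA (symKer_nonneg _ _ _ _ _ _)

theorem Low.zero {A δ : ℝ} (hA : 0 ≤ A) (n₁ n₂ n₃ n₄ n₅ : ℤ) : Low A δ 0 n₁ n₂ n₃ n₄ n₅ := by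
  unfold Low
  simpa using mul_nonneg hA (symKer_nonneg _ _ _ _ _ _)

/-- The support and size of the multiplier with index `i` on the hyperplane. -/
def SizeBound (B : ℝ) (i : Fin 7) (M : Multiplier ℂ) : Prop := ∀ n n₁ n₂ n₃ n₄ n₅ : ℤ,
  n = n₁ + n₂ + n₃ + n₄ + n₅ → M n n₁ n₂ n₃ n₄ n₅ = 0 ∨
    (i.val < 5 ∧ SignOut n n₄ n₅ ∧ ‖M n n₁ n₂ n₃ n₄ n₅‖ ≤ B * |((n₄ + n₅ : ℤ) : ℝ)|) ∨
    (¬ i.val < 5 ∧ SignIn n₂ n₃ n₄ n₅ ∧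
      ‖M n n₁ n₂ n₃ n₄ n₅‖ ≤ B * ((min |n₂ + n₃| |n₄ + n₅| : ℤ) : ℝ))

theorem norm_intCast_div_le_one {n k : ℤ} (h : |n| ≤ |k|) : ‖(n : ℂ) / (k : ℂ)‖ ≤ 1 := by
  rw [norm_div, Complex.norm_intCast, Complex.norm_intCast]
  exact div_le_one_of_le₀ (by exact_mod_cast h) (abs_nonneg _)

/-- Equal signs exclude cancellation in a + b, so both quotients a/(a+b) and b/(a+b) have modulus at
most 1. -/
theorem norm_harmonic_le {a b : ℤ} (h : (0 < a ∧ 0 < b) ∨ (a < 0 ∧ b < 0)) :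
    ‖(a : ℂ) * b / ((a + b : ℤ) : ℂ)‖ ≤ ((min |a| |b| : ℤ) : ℝ) := by
  have ha : |a| ≤ |a + b| := by
    rcases h with ⟨h, h'⟩ | ⟨h, h'⟩
    · rw [abs_of_pos h, abs_of_pos (by linarith)]; linarith
    · rw [abs_of_neg h, abs_of_neg (by linarith)]; linarith
  have hb : |b| ≤ |a + b| := by
    rcases h with ⟨h, h'⟩ | ⟨h, h'⟩
    · rw [abs_of_pos h', abs_of_pos (by linarith)]; linarith
    · rw [abs_of_neg h', abs_of_neg (by linarith)]; linarith
  rw [Int.cast_min]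
  refine le_min ?_ ?_
  · rw [mul_div_assoc, norm_mul, Complex.norm_intCast, Int.cast_abs]
    exact mul_le_of_le_one_right (abs_nonneg _) (norm_intCast_div_le_one hb)
  · rw [mul_comm (a : ℂ), mul_div_assoc, norm_mul, Complex.norm_intCast, Int.cast_abs]
    exact mul_le_of_le_one_right (abs_nonneg _) (norm_intCast_div_le_one ha)

theorem sizeBound_m (c : Fin 7 → ℂ) (i : Fin 7) : SizeBound (3 * ∑ j, ‖c j‖) i (m c i) := by
  intro n n₁ n₂ n₃ n₄ n₅ hn
  have hc : ∀ j, ‖c j‖ ≤ ∑ j, ‖c j‖ := fun j =>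
    Finset.single_le_sum (f := fun j => ‖c j‖) (fun _ _ => norm_nonneg _) (Finset.mem_univ j)
  have hS : 0 ≤ ∑ j, ‖c j‖ := (norm_nonneg _).trans (hc 0)
  generalize ∑ j, ‖c j‖ = S at *
  have h45 : (n₄ : ℂ) + n₅ = ((n₄ + n₅ : ℤ) : ℂ) := by push_cast; rfl
  have h23 : (n₂ : ℂ) + n₃ = ((n₂ + n₃ : ℤ) : ℂ) := by push_cast; rfl
  have h123 : (n₁ : ℂ) + n₂ + n₃ = ((n₁ + n₂ + n₃ : ℤ) : ℂ) := by push_cast; rfl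
  have h2345 : (n₂ : ℂ) + n₃ + n₄ + n₅ = (((n₂ + n₃) + (n₄ + n₅) : ℤ) : ℂ) := by
    push_cast; ring
  -- Here n₁₂₃ = n − n₄₅ < n < 0. The worst factor is 2 + n/n₁₂₃, whence the 3 in the bound.
  have hq : n < 0 ∧ 0 < n₄ + n₅ → ‖(n : ℂ) / ((n₁ + n₂ + n₃ : ℤ) : ℂ)‖ ≤ 1 := fun h =>
    norm_intCast_div_le_one (by
      rw [abs_of_neg h.1, abs_of_neg (by omega)]; omega)
  have hM : ∀ (j : Fin 7) (z : ℂ) (y : ℝ), 0 ≤ y → ‖z‖ ≤ 3 * y → ‖c j * z‖ ≤ 3 * S * y := by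
    intro j z y hy hz
    rw [norm_mul]
    calc ‖c j‖ * ‖z‖ ≤ S * (3 * y) := mul_le_mul (hc j) hz (norm_nonneg _) hS
      _ = _ := by ring
  have hN : ‖((n₄ + n₅ : ℤ) : ℂ)‖ = |((n₄ + n₅ : ℤ) : ℝ)| := Complex.norm_intCast _
  have h0 := abs_nonneg ((n₄ + n₅ : ℤ) : ℝ)
  have hm0 : (0 : ℝ) ≤ ((min |n₂ + n₃| |n₄ + n₅| : ℤ) : ℝ) := by
    exact_mod_cast le_min (abs_nonneg _) (abs_nonneg _)
  have hfac : ∀ z : ℂ, ‖z‖ ≤ 3 → ‖((n₄ + n₅ : ℤ) : ℂ) * z‖ ≤ 3 * |((n₄ + n₅ : ℤ) : ℝ)| := by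
    intro z hz
    rw [norm_mul, hN, mul_comm]
    exact mul_le_mul_of_nonneg_right hz h0
  fin_cases i <;> simp only [m, Fin.isValue] <;>
    split_ifs with h
  · exact .inr (.inl ⟨by norm_num, .inl h, by
      rw [h45]; exact hM _ _ _ h0 (by rw [hN]; linarith)⟩)
  · exact .inl rfl
  · exact .inr (.inl ⟨by norm_num, .inl h, by
      rw [h45]; exact hM _ _ _ h0 (by rw [hN]; linarith)⟩)
  · exact .inl rfl
  · refine .inr (.inl ⟨by norm_num, .inr h, ?_⟩)
    rw [h45, h123, mul_assoc]
    refine hM _ _ _ h0 (hfac _ ((norm_add_le _ _).trans ?_))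
    have := hq h
    rw [Complex.norm_ofNat]
    linarith
  · exact .inl rfl
  · refine .inr (.inl ⟨by norm_num, .inr h, ?_⟩)
    rw [h45, h123, mul_assoc]
    refine hM _ _ _ h0 (hfac _ ((norm_add_le _ _).trans ?_))
    have := hq h
    rw [norm_one]
    linarith
  · exact .inl rfl
  · refine .inr (.inl ⟨by norm_num, .inr h, ?_⟩)
    rw [h45, h123, mul_div_assoc]
    exact hM _ _ _ h0 (hfac _ ((hq h).trans (by norm_num)))
  · exact .inl rfl
  · refine .inr (.inr ⟨by norm_num, .inl h, ?_⟩)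
    rw [h2345, h45, h23]
    exact hM _ _ _ hm0 ((norm_harmonic_le (.inl h)).trans (by linarith))
  · exact .inl rfl
  · refine .inr (.inr ⟨by norm_num, .inr h, ?_⟩)
    rw [h2345, h45, h23]
    exact hM _ _ _ hm0 ((norm_harmonic_le (.inr h)).trans (by linarith))
  · exact .inl rfl

theorem sizeBound_mStar (c : Fin 7 → ℂ) (i : Fin 7) :
    SizeBound (3 * ∑ j, ‖c j‖) i (mStar c i) := by
  intro n n₁ n₂ n₃ n₄ n₅ hn
  have h := sizeBound_m c i (-n) (-n₁) (-n₂) (-n₃) (-n₄) (-n₅) (by rw [hn]; ring)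
  unfold mStar
  rw [map_eq_zero, RCLike.norm_conj]
  refine h.imp id (Or.imp ?_ ?_)
  · rintro ⟨h1, h2, h3⟩
    refine ⟨h1, ?_, ?_⟩
    · unfold SignOut at *; omega
    · rwa [← neg_add, Int.cast_neg, abs_neg] at h3
  · rintro ⟨h1, h2, h3⟩
    refine ⟨h1, ?_, ?_⟩
    · unfold SignIn at *; omega
    · rwa [← neg_add, ← neg_add, abs_neg, abs_neg] at h3

theorem main_of_mainPart {δ B : ℝ} {i : Fin 7} {M : Multiplier ℂ} (hδ : 0 < δ) (hδ1 : δ ≤ 1 / 4)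
    (hB : 0 ≤ B) (hM : SizeBound B i M) (n₁ n₂ n₃ n₄ n₅ : ℤ) :
    Main₁ (B * 2 ^ 200) δ ‖mainPart i M (n₁ + n₂ + n₃ + n₄ + n₅) n₁ n₂ n₃ n₄ n₅‖ n₁ n₂ n₃ n₄ n₅ ∧
    Main₃ (B * 2 ^ 200) δ ‖mainPart i M (n₁ + n₂ + n₃ + n₄ + n₅) n₁ n₂ n₃ n₄ n₅‖
      n₁ n₂ n₃ n₄ n₅ := by
  have hB' : 0 ≤ B * 2 ^ 200 := by positivity
  unfold mainPart
  split_ifs with h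
  · rcases hM _ n₁ n₂ n₃ n₄ n₅ rfl with h0 | ⟨hi, hs, hb⟩ | ⟨hi, hs, hb⟩
    · rw [h0, norm_zero]
      exact ⟨.zero hB' .., .zero hB' ..⟩
    · rw [excSet, if_pos hi] at h
      have := main_of_signOut hδ hδ1 hs h.1 h.2
      exact ⟨this.1.scale hB hb, this.2.scale hB hb⟩
    · rw [excSet, if_neg hi] at h
      have := main_of_signIn hδ hδ1 hs h.1 h.2
      exact ⟨this.1.scale hB hb, this.2.scale hB hb⟩
  · rw [norm_zero]
    exact ⟨.zero hB' .., .zero hB' ..⟩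

theorem low_of_harmlessPart {δ B : ℝ} {i : Fin 7} {M : Multiplier ℂ} (hδ : 0 < δ)
    (hδ1 : δ ≤ 1 / 4) (hB : 0 ≤ B) (hM : SizeBound B i M) (n₁ n₂ n₃ n₄ n₅ : ℤ) :
    Low (B * 2 ^ 200) δ ‖harmlessPart i M (n₁ + n₂ + n₃ + n₄ + n₅) n₁ n₂ n₃ n₄ n₅‖
      n₁ n₂ n₃ n₄ n₅ := by
  have hB' : 0 ≤ B * 2 ^ 200 := by positivity
  unfold harmlessPart
  split_ifs with h
  · rcases hM _ n₁ n₂ n₃ n₄ n₅ rfl with h0 | ⟨hi, hs, hb⟩ | ⟨hi, hs, hb⟩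
    · rw [h0, norm_zero]
      exact .zero hB' ..
    · rw [excSet, if_pos hi] at h
      exact (low_of_signOut hδ hδ1 hs h).scale hB hb
    · rw [excSet, if_neg hi] at h
      exact (low_of_signIn hδ hδ1 hs h).scale hB hb
  · rw [norm_zero]
    exact .zero hB' ..

/-! ### From pointwise domination to norm estimates. -/

theorem jb_pos (n : ℤ) : 0 < jb n := br_pos _

theorem wnorm_eq (s : ℝ) (f : ℤ → ℝ≥0∞) :
    wnorm s f = nsq (fun n => ENNReal.ofReal (jb n ^ s) * f n) ^ (1 / 2 : ℝ) := rfl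

/-- Each input is replaced by its weighted version, which leaves a form with kernel at most
A·`symKer` on unweighted ℓ². The six exponents are independent because the estimates shift a
derivative between different functions. -/
theorem exists_wnorm_Q_le {δ A : ℝ} (hδ : 0 < δ) (hA : 0 ≤ A) : ∃ C : ℝ≥0,
    ∀ (σ₀ σ₁ σ₂ σ₃ σ₄ σ₅ : ℝ) (K : Multiplier ℝ), (∀ n₁ n₂ n₃ n₄ n₅ : ℤ,
      jb (n₁ + n₂ + n₃ + n₄ + n₅) ^ σ₀ * (jb n₁ ^ (-σ₁) * jb n₂ ^ (-σ₂) * jb n₃ ^ (-σ₃) *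
        jb n₄ ^ (-σ₄) * jb n₅ ^ (-σ₅)) * K (n₁ + n₂ + n₃ + n₄ + n₅) n₁ n₂ n₃ n₄ n₅ ≤
        A * symKer δ n₁ n₂ n₃ n₄ n₅) →
    ∀ ω₁ W₂ ω₃ W₄ ω₅ : ℤ → ℝ≥0, wnorm σ₀ (Q K ω₁ W₂ ω₃ W₄ ω₅) ≤
      C * (nrm σ₁ ω₁ * nrm σ₂ W₂ * nrm σ₃ ω₃ * nrm σ₄ W₄ * nrm σ₅ ω₅) := by
  obtain ⟨C, hC⟩ := (bdd_symKer hδ).mono (K := fun n₁ n₂ n₃ n₄ n₅ =>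
    ENNReal.ofReal (A * symKer δ n₁ n₂ n₃ n₄ n₅)) A.toNNReal fun n₁ n₂ n₃ n₄ n₅ => by
      rw [ENNReal.ofReal_mul hA, ENNReal.ofReal]
  refine ⟨NNReal.sqrt C, fun σ₀ σ₁ σ₂ σ₃ σ₄ σ₅ K hK ω₁ W₂ ω₃ W₄ ω₅ => ?_⟩
  have h0 : ∀ (k : ℤ) (r : ℝ), 0 ≤ jb k ^ r := fun k r => Real.rpow_nonneg (br_pos _).le _
  -- The weights are finite and positive, so they cancel in [0,∞].
  have hone : ∀ (k : ℤ) (r : ℝ),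
      ENNReal.ofReal (jb k ^ (-r)) * ENNReal.ofReal (jb k ^ r) = 1 := by
    intro k r
    rw [← ENNReal.ofReal_mul (h0 _ _), ← Real.rpow_add (jb_pos _), neg_add_cancel, Real.rpow_zero,
      ENNReal.ofReal_one]
  let w : ℝ → (ℤ → ℝ≥0) → ℤ → ℝ≥0∞ := fun σ ω k => ENNReal.ofReal (jb k ^ σ) * ω k
  have hle : ∀ n, ENNReal.ofReal (jb n ^ σ₀) * Q K ω₁ W₂ ω₃ W₄ ω₅ n ≤
      quint (fun n₁ n₂ n₃ n₄ n₅ => ENNReal.ofReal (A * symKer δ n₁ n₂ n₃ n₄ n₅)) (w σ₁ ω₁)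
        (w σ₂ W₂) (w σ₃ ω₃) (w σ₄ W₄) (w σ₅ ω₅) n := by
    intro n
    unfold Q quint
    simp only [← ENNReal.tsum_mul_left]
    refine ENNReal.tsum_le_tsum fun n₁ => ENNReal.tsum_le_tsum fun n₂ => ENNReal.tsum_le_tsum
      fun n₃ => ENNReal.tsum_le_tsum fun n₄ => ENNReal.tsum_le_tsum fun n₅ => ?_
    split_ifs with hn
    · have h1 := hone n₁ σ₁
      have h2 := hone n₂ σ₂
      have h3 := hone n₃ σ₃
      have h4 := hone n₄ σ₄
      have h5 := hone n₅ σ₅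
      have p1 := jb_pos n₁; have p2 := jb_pos n₂; have p3 := jb_pos n₃
      have p4 := jb_pos n₄; have p5 := jb_pos n₅
      subst hn
      have p0 := jb_pos (n₁ + n₂ + n₃ + n₄ + n₅)
      have hb := ENNReal.ofReal_le_ofReal (hK n₁ n₂ n₃ n₄ n₅)
      rw [ENNReal.ofReal_mul (by positivity), ENNReal.ofReal_mul (h0 _ _),
        ENNReal.ofReal_mul (by positivity),
        ENNReal.ofReal_mul (by positivity),
        ENNReal.ofReal_mul (by positivity), ENNReal.ofReal_mul (h0 _ _)] at hb
      refine le_trans (le_of_eq ?_) (mul_le_mul_left hb _)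
      simp only [w]
      push_cast
      generalize ENNReal.ofReal (K _ _ _ _ _ _) = k
      generalize ENNReal.ofReal (jb n₁ ^ (-σ₁)) = a₁ at *
      generalize ENNReal.ofReal (jb n₂ ^ (-σ₂)) = a₂ at *
      generalize ENNReal.ofReal (jb n₃ ^ (-σ₃)) = a₃ at *
      generalize ENNReal.ofReal (jb n₄ ^ (-σ₄)) = a₄ at *
      generalize ENNReal.ofReal (jb n₅ ^ (-σ₅)) = a₅ at *
      generalize ENNReal.ofReal (jb n₁ ^ σ₁) = b₁ at *
      generalize ENNReal.ofReal (jb n₂ ^ σ₂) = b₂ at *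
      generalize ENNReal.ofReal (jb n₃ ^ σ₃) = b₃ at *
      generalize ENNReal.ofReal (jb n₄ ^ σ₄) = b₄ at *
      generalize ENNReal.ofReal (jb n₅ ^ σ₅) = b₅ at *
      generalize ENNReal.ofReal (jb (n₁ + n₂ + n₃ + n₄ + n₅) ^ σ₀) = b₀
      calc b₀ * (k * (ω₁ n₁ * W₂ n₂ * ω₃ n₃ * W₄ n₄ * ω₅ n₅))
          = b₀ * (k * (ω₁ n₁ * W₂ n₂ * ω₃ n₃ * W₄ n₄ * ω₅ n₅)) *
            ((a₁ * b₁) * (a₂ * b₂) * (a₃ * b₃) * (a₄ * b₄) * (a₅ * b₅)) := by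
              rw [h1, h2, h3, h4, h5]; ring
        _ = _ := by ring
    · rw [mul_zero]
  have hsq : nsq (fun n => ENNReal.ofReal (jb n ^ σ₀) * Q K ω₁ W₂ ω₃ W₄ ω₅ n) ≤
      C * (nsq (w σ₁ ω₁) * nsq (w σ₂ W₂) * nsq (w σ₃ ω₃) * nsq (w σ₄ W₄) * nsq (w σ₅ ω₅)) :=
    le_trans (ENNReal.tsum_le_tsum fun n => by gcongr; exact hle n) (hC _ _ _ _ _)
  rw [wnorm_eq]
  refine (ENNReal.rpow_le_rpow hsq (by norm_num)).trans (le_of_eq ?_)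
  have hhalf : (0 : ℝ) ≤ 1 / 2 := by norm_num
  simp only [ENNReal.mul_rpow_of_nonneg _ _ hhalf]
  rw [NNReal.sqrt_eq_rpow, ENNReal.coe_rpow_of_nonneg _ hhalf]
  rfl

theorem wnorm_Q_add_le (s : ℝ) (K K₁ K₂ : Multiplier ℝ) (h : ∀ n n₁ n₂ n₃ n₄ n₅,
    K n n₁ n₂ n₃ n₄ n₅ ≤ K₁ n n₁ n₂ n₃ n₄ n₅ + K₂ n n₁ n₂ n₃ n₄ n₅) (ω₁ W₂ ω₃ W₄ ω₅ : ℤ → ℝ≥0) :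
    wnorm s (Q K ω₁ W₂ ω₃ W₄ ω₅) ≤
      2 * (wnorm s (Q K₁ ω₁ W₂ ω₃ W₄ ω₅) + wnorm s (Q K₂ ω₁ W₂ ω₃ W₄ ω₅)) := by
  have hQ : ∀ n, Q K ω₁ W₂ ω₃ W₄ ω₅ n ≤ Q K₁ ω₁ W₂ ω₃ W₄ ω₅ n + Q K₂ ω₁ W₂ ω₃ W₄ ω₅ n := by
    intro n
    unfold Q
    simp only [← ENNReal.tsum_add]
    refine ENNReal.tsum_le_tsum fun n₁ => ENNReal.tsum_le_tsum fun n₂ => ENNReal.tsum_le_tsum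
      fun n₃ => ENNReal.tsum_le_tsum fun n₄ => ENNReal.tsum_le_tsum fun n₅ => ?_
    split_ifs
    · rw [← add_mul]
      gcongr
      exact (ENNReal.ofReal_le_ofReal (h _ _ _ _ _ _)).trans ENNReal.ofReal_add_le
    · simp
  have hhalf : (0 : ℝ) ≤ 1 / 2 := by norm_num
  simp only [wnorm_eq]
  calc _ ≤ (2 * (nsq (fun n => ENNReal.ofReal (jb n ^ s) * Q K₁ ω₁ W₂ ω₃ W₄ ω₅ n) +
        nsq (fun n => ENNReal.ofReal (jb n ^ s) * Q K₂ ω₁ W₂ ω₃ W₄ ω₅ n))) ^ (1 / 2 : ℝ) := by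
        refine ENNReal.rpow_le_rpow (le_trans (ENNReal.tsum_le_tsum fun n => ?_)
          (nsq_add_le _ _)) hhalf
        dsimp only
        rw [← mul_add]
        gcongr
        exact hQ n
    _ ≤ _ := by
        rw [ENNReal.mul_rpow_of_nonneg _ _ hhalf]
        gcongr
        · calc (2 : ℝ≥0∞) ^ (1 / 2 : ℝ) ≤ 2 ^ (1 : ℝ) :=
                ENNReal.rpow_le_rpow_of_exponent_le (by norm_num) (by norm_num)
            _ = 2 := ENNReal.rpow_one _
        · exact ENNReal.rpow_add_le_add_rpow _ _ hhalf (by norm_num)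

theorem jb_sum_le_prod (n₁ n₂ n₃ n₄ n₅ : ℤ) :
    jb (n₁ + n₂ + n₃ + n₄ + n₅) ≤ 81 * (jb n₁ * jb n₂ * jb n₃ * jb n₄ * jb n₅) := by
  have p : ∀ k : ℤ, 0 ≤ jb k := fun k => (br_pos _).le
  have := p n₁; have := p n₂; have := p n₃; have := p n₄; have := p n₅
  calc jb (n₁ + n₂ + n₃ + n₄ + n₅) ≤ 3 * (jb (n₁ + n₂ + n₃ + n₄) * jb n₅) := jb_add_le_mul _ _
    _ ≤ 3 * (3 * (jb (n₁ + n₂ + n₃) * jb n₄) * jb n₅) := by gcongr; exact jb_add_le_mul _ _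
    _ ≤ 3 * (3 * (3 * (jb (n₁ + n₂) * jb n₃) * jb n₄) * jb n₅) := by
        gcongr; exact jb_add_le_mul _ _
    _ ≤ 3 * (3 * (3 * (3 * (jb n₁ * jb n₂) * jb n₃) * jb n₄) * jb n₅) := by
        gcongr; exact jb_add_le_mul _ _
    _ = _ := by ring

/-- Raising all weights by `t` costs a constant. -/
theorem weight_shift {δ t σ X Y : ℝ} {n₁ n₂ n₃ n₄ n₅ : ℤ} (ht : 0 ≤ t) (hY : 0 ≤ Y)
    (h : X * jb (n₁ + n₂ + n₃ + n₄ + n₅) ^ σ *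
      (swt δ n₁ * swt δ n₂ * swt δ n₃ * swt δ n₄ * swt δ n₅) ≤ Y) :
    X * jb (n₁ + n₂ + n₃ + n₄ + n₅) ^ (σ + t) * (jb n₁ ^ (-(1 / 2 + 2 * δ + t)) *
      jb n₂ ^ (-(1 / 2 + 2 * δ + t)) * jb n₃ ^ (-(1 / 2 + 2 * δ + t)) *
      jb n₄ ^ (-(1 / 2 + 2 * δ + t)) * jb n₅ ^ (-(1 / 2 + 2 * δ + t))) ≤ 81 ^ t * Y := by
  have p := jb_pos
  have p1 := p n₁; have p2 := p n₂; have p3 := p n₃; have p4 := p n₄; have p5 := p n₅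
  have hs : ∀ k : ℤ, jb k ^ (-(1 / 2 + 2 * δ + t)) = swt δ k * (jb k ^ t)⁻¹ := by
    intro k
    rw [swt, neg_add, Real.rpow_add (p k), Real.rpow_neg (p k).le t]
  -- The inequality ⟨n⟩ ≤ 81 ∏⟨nᵢ⟩, with 81 = 3⁴, raised to the power t ≥ 0.
  have hprod : jb (n₁ + n₂ + n₃ + n₄ + n₅) ^ t * ((jb n₁ ^ t)⁻¹ * (jb n₂ ^ t)⁻¹ * (jb n₃ ^ t)⁻¹ *
      (jb n₄ ^ t)⁻¹ * (jb n₅ ^ t)⁻¹) ≤ 81 ^ t := by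
    have hr := Real.rpow_le_rpow (p _).le (jb_sum_le_prod n₁ n₂ n₃ n₄ n₅) ht
    rw [Real.mul_rpow (by norm_num) (by positivity), Real.mul_rpow (by positivity) p5.le,
      Real.mul_rpow (by positivity) p4.le, Real.mul_rpow (by positivity) p3.le,
      Real.mul_rpow p1.le p2.le] at hr
    rw [← mul_inv, ← mul_inv, ← mul_inv, ← mul_inv, ← div_eq_mul_inv, div_le_iff₀ (by positivity)]
    exact hr
  have hpos : 0 ≤ jb (n₁ + n₂ + n₃ + n₄ + n₅) ^ t * ((jb n₁ ^ t)⁻¹ * (jb n₂ ^ t)⁻¹ *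
      (jb n₃ ^ t)⁻¹ * (jb n₄ ^ t)⁻¹ * (jb n₅ ^ t)⁻¹) := by
    have := p (n₁ + n₂ + n₃ + n₄ + n₅)
    positivity
  simp only [hs, Real.rpow_add (p (n₁ + n₂ + n₃ + n₄ + n₅))]
  calc _ = (X * jb (n₁ + n₂ + n₃ + n₄ + n₅) ^ σ *
      (swt δ n₁ * swt δ n₂ * swt δ n₃ * swt δ n₄ * swt δ n₅)) *
        (jb (n₁ + n₂ + n₃ + n₄ + n₅) ^ t * ((jb n₁ ^ t)⁻¹ * (jb n₂ ^ t)⁻¹ *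
      (jb n₃ ^ t)⁻¹ * (jb n₄ ^ t)⁻¹ * (jb n₅ ^ t)⁻¹)) := by ring
    _ ≤ Y * (jb (n₁ + n₂ + n₃ + n₄ + n₅) ^ t * ((jb n₁ ^ t)⁻¹ * (jb n₂ ^ t)⁻¹ *
      (jb n₃ ^ t)⁻¹ * (jb n₄ ^ t)⁻¹ * (jb n₅ ^ t)⁻¹)) := mul_le_mul_of_nonneg_right h hpos
    _ ≤ Y * 81 ^ t := mul_le_mul_of_nonneg_left hprod hY
    _ = _ := mul_comm _ _

/-- Half a power of Φ pays for the derivative on n₂ or n₄; this derives estimate (2) from the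
domination for (1). -/
theorem jb_mul_rpow_le {k φ : ℤ} (h : |k| ^ 2 ≤ |φ|) :
    jb k * jb φ ^ (-1 : ℝ) ≤ 2 * jb φ ^ (-(1 / 2) : ℝ) := by
  have hφ : 1 ≤ jb φ := one_le_br _
  have hk : jb k ≤ 2 * jb φ ^ (1 / 2 : ℝ) := by
    rw [← Real.sqrt_eq_rpow]
    refine abs_le_of_sq_le_sq' ?_ (by positivity) |>.2
    rw [mul_pow, Real.sq_sqrt (by linarith), jb_eq_br, br_sq]
    have h1 : (k : ℝ) ^ 2 ≤ |(φ : ℝ)| := by rw [← sq_abs]; exact_mod_cast h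
    have h2 : |(φ : ℝ)| ≤ jb φ := abs_le_br _
    linarith
  calc jb k * jb φ ^ (-1 : ℝ) ≤ 2 * jb φ ^ (1 / 2 : ℝ) * jb φ ^ (-1 : ℝ) := by gcongr
    _ = 2 * jb φ ^ (-(1 / 2) : ℝ) := by
        rw [mul_assoc, ← Real.rpow_add (by linarith)]; norm_num

theorem jb_rpow_neg_sub_one (k : ℤ) (s : ℝ) : jb k ^ (-(s - 1)) = jb k ^ (-s) * jb k := by
  rw [neg_sub, sub_eq_neg_add, Real.rpow_add (jb_pos _), Real.rpow_one]

theorem jb_rpow_neg_add_one (k : ℤ) (s : ℝ) : jb k ^ (-(s + 1)) = jb k ^ (-s) * (jb k)⁻¹ := by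
  rw [neg_add, Real.rpow_add (jb_pos _), Real.rpow_neg_one]

theorem weighted_absKerDiv_half_le {δ t A : ℝ} {M : Multiplier ℂ} {n₁ n₂ n₃ n₄ n₅ : ℤ}
    (ht : 0 ≤ t) (hA : 0 ≤ A)
    (h : Main₁ A δ ‖M (n₁ + n₂ + n₃ + n₄ + n₅) n₁ n₂ n₃ n₄ n₅‖ n₁ n₂ n₃ n₄ n₅) :
    jb (n₁ + n₂ + n₃ + n₄ + n₅) ^ (1 / 2 + 2 * δ + t) * (jb n₁ ^ (-(1 / 2 + 2 * δ + t)) *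
      jb n₂ ^ (-(1 / 2 + 2 * δ + t)) * jb n₃ ^ (-(1 / 2 + 2 * δ + t)) *
      jb n₄ ^ (-(1 / 2 + 2 * δ + t)) * jb n₅ ^ (-(1 / 2 + 2 * δ + t))) *
      absKerDiv M (1 / 2) (n₁ + n₂ + n₃ + n₄ + n₅) n₁ n₂ n₃ n₄ n₅ ≤
      81 ^ t * (A * symKer δ n₁ n₂ n₃ n₄ n₅) := by
  refine le_trans (le_of_eq ?_) (weight_shift ht (mul_nonneg hA (symKer_nonneg ..)) h)
  unfold absKerDiv
  rw [Real.rpow_neg (jb_pos (Phi _ _ _ _)).le]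
  ring

theorem absKerDiv_one_mul_le {M : Multiplier ℂ} {n n₁ n₂ n₃ n₄ n₅ k : ℤ}
    (hk : M n n₁ n₂ n₃ n₄ n₅ = 0 ∨ |k| ^ 2 ≤ |Phi n n₁ n₃ n₅|) :
    jb k * absKerDiv M 1 n n₁ n₂ n₃ n₄ n₅ ≤ 2 * absKerDiv M (1 / 2) n n₁ n₂ n₃ n₄ n₅ := by
  unfold absKerDiv
  rcases hk with h | h
  · simp [h]
  · have := jb_mul_rpow_le h
    rw [Real.rpow_neg (jb_pos _).le, Real.rpow_neg (jb_pos _).le] at this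
    rw [div_eq_mul_inv, div_eq_mul_inv]
    nlinarith [mul_le_mul_of_nonneg_left this (norm_nonneg (M n n₁ n₂ n₃ n₄ n₅))]

theorem weighted_absKerDiv_deriv_le {δ t A x : ℝ} {M : Multiplier ℂ} {n₁ n₂ n₃ n₄ n₅ : ℤ}
    (ht : 0 ≤ t) (hA : 0 ≤ A) (hx : x ≤ max (max (jb n₁) (jb n₃)) (jb n₅))
    (h : Main₃ A δ ‖M (n₁ + n₂ + n₃ + n₄ + n₅) n₁ n₂ n₃ n₄ n₅‖ n₁ n₂ n₃ n₄ n₅) :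
    jb (n₁ + n₂ + n₃ + n₄ + n₅) ^ (1 / 2 + 2 * δ + t - 1) * (jb n₁ ^ (-(1 / 2 + 2 * δ + t)) *
      jb n₂ ^ (-(1 / 2 + 2 * δ + t)) * jb n₃ ^ (-(1 / 2 + 2 * δ + t)) *
      jb n₄ ^ (-(1 / 2 + 2 * δ + t)) * jb n₅ ^ (-(1 / 2 + 2 * δ + t)) * x) *
      absKerDiv M (1 - δ) (n₁ + n₂ + n₃ + n₄ + n₅) n₁ n₂ n₃ n₄ n₅ ≤
      81 ^ t * (A * symKer δ n₁ n₂ n₃ n₄ n₅) := by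
  have h' : ‖M (n₁ + n₂ + n₃ + n₄ + n₅) n₁ n₂ n₃ n₄ n₅‖ *
      jb (Phi (n₁ + n₂ + n₃ + n₄ + n₅) n₁ n₃ n₅) ^ (-(1 - δ)) * x *
      jb (n₁ + n₂ + n₃ + n₄ + n₅) ^ (2 * δ - 1 / 2) *
      (swt δ n₁ * swt δ n₂ * swt δ n₃ * swt δ n₄ * swt δ n₅) ≤ A * symKer δ n₁ n₂ n₃ n₄ n₅ := by
    refine le_trans ?_ h
    have p0 := jb_pos (Phi (n₁ + n₂ + n₃ + n₄ + n₅) n₁ n₃ n₅)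
    have p := jb_pos (n₁ + n₂ + n₃ + n₄ + n₅)
    have := swt_nonneg δ n₁; have := swt_nonneg δ n₂; have := swt_nonneg δ n₃
    have := swt_nonneg δ n₄; have := swt_nonneg δ n₅
    have hp : 0 ≤ ‖M (n₁ + n₂ + n₃ + n₄ + n₅) n₁ n₂ n₃ n₄ n₅‖ *
      jb (Phi (n₁ + n₂ + n₃ + n₄ + n₅) n₁ n₃ n₅) ^ (-(1 - δ)) *
      jb (n₁ + n₂ + n₃ + n₄ + n₅) ^ (2 * δ - 1 / 2) *
      (swt δ n₁ * swt δ n₂ * swt δ n₃ * swt δ n₄ * swt δ n₅) := by positivity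
    exact le_trans (le_of_eq (by ring)) (mul_le_mul_of_nonneg_left hx hp)
  refine le_trans (le_of_eq ?_) (weight_shift ht (mul_nonneg hA (symKer_nonneg ..)) h')
  unfold absKerDiv
  rw [Real.rpow_neg (jb_pos (Phi _ _ _ _)).le,
    show 1 / 2 + 2 * δ + t - 1 = 2 * δ - 1 / 2 + t by ring]
  ring

theorem weighted_norm_low_le {δ t A x X : ℝ} {n₁ n₂ n₃ n₄ n₅ : ℤ}
    (ht : 0 ≤ t) (hA : 0 ≤ A) (hX : X = 0 ∨ x = max (jb n₂) (jb n₄) ∧ Low A δ X n₁ n₂ n₃ n₄ n₅) :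
    jb (n₁ + n₂ + n₃ + n₄ + n₅) ^ (1 / 2 + 2 * δ + t) * (jb n₁ ^ (-(1 / 2 + 2 * δ + t)) *
      jb n₂ ^ (-(1 / 2 + 2 * δ + t)) * jb n₃ ^ (-(1 / 2 + 2 * δ + t)) *
      jb n₄ ^ (-(1 / 2 + 2 * δ + t)) * jb n₅ ^ (-(1 / 2 + 2 * δ + t)) * x⁻¹) * X ≤
      81 ^ t * (A * symKer δ n₁ n₂ n₃ n₄ n₅) := by
  have hK := mul_nonneg hA (symKer_nonneg δ n₁ n₂ n₃ n₄ n₅)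
  rcases hX with h | ⟨rfl, h⟩
  · rw [h, mul_zero]
    positivity
  · exact le_trans (le_of_eq (by ring)) (weight_shift ht hK h)

theorem mainPart_eq_zero_or (i : Fin 7) (M : Multiplier ℂ) (n n₁ n₂ n₃ n₄ n₅ : ℤ) :
    mainPart i M n n₁ n₂ n₃ n₄ n₅ = 0 ∨
      |n₂| ^ 2 ≤ |Phi n n₁ n₃ n₅| ∧ |n₄| ^ 2 ≤ |Phi n n₁ n₃ n₅| := by
  unfold mainPart
  split_ifs with h
  · exact .inr (max_le_iff.1 h.2.le)
  · exact .inl rfl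

/-- The first three estimates for a main part hold with a constant depending only on the size. -/
theorem exists_wnorm_mainPart_le {δ t : ℝ} (hδ : 0 < δ) (hδ1 : δ ≤ 1 / 4) (ht : 0 ≤ t) (B : ℝ≥0)
    {s : ℝ} (hs : 1 / 2 + 2 * δ + t = s) :
    ∃ C : ℝ≥0, ∀ (i : Fin 7) (M : Multiplier ℂ), SizeBound B i M →
      ∀ ω₁ W₂ ω₃ W₄ ω₅ : ℤ → ℝ≥0,
      wnorm s (Q (absKerDiv (mainPart i M) (1 / 2)) ω₁ W₂ ω₃ W₄ ω₅) ≤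
        C * (nrm s ω₁ * nrm s W₂ * nrm s ω₃ * nrm s W₄ * nrm s ω₅) ∧
      wnorm s (Q (absKerDiv (mainPart i M) 1) ω₁ W₂ ω₃ W₄ ω₅) ≤
        C * (nrm s ω₁ * nrm s ω₃ * nrm s ω₅ *
          min (nrm (s - 1) W₂ * nrm s W₄) (nrm s W₂ * nrm (s - 1) W₄)) ∧
      wnorm (s - 1) (Q (absKerDiv (mainPart i M) (1 - δ)) ω₁ W₂ ω₃ W₄ ω₅) ≤
        C * (min (min (nrm (s - 1) ω₁ * nrm s ω₃ * nrm s ω₅)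
              (nrm s ω₁ * nrm (s - 1) ω₃ * nrm s ω₅))
              (nrm s ω₁ * nrm s ω₃ * nrm (s - 1) ω₅) *
          (nrm s W₂ * nrm s W₄)) := by
  have hA : (0 : ℝ) ≤ B * 2 ^ 200 := by positivity
  have hT : (0 : ℝ) ≤ 81 ^ t := by positivity
  obtain ⟨C, hC⟩ := exists_wnorm_Q_le hδ (A := 2 * (81 ^ t * (B * 2 ^ 200))) (by positivity)
  refine ⟨C, fun i M hM ω₁ W₂ ω₃ W₄ ω₅ => ?_⟩
  have hmain := main_of_mainPart hδ hδ1 B.2 hM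
  have hup : ∀ {r : ℝ} (n₁ n₂ n₃ n₄ n₅ : ℤ),
      r ≤ 2 * (81 ^ t * ((B * 2 ^ 200 : ℝ) * symKer δ n₁ n₂ n₃ n₄ n₅)) →
      r ≤ 2 * (81 ^ t * (B * 2 ^ 200)) * symKer δ n₁ n₂ n₃ n₄ n₅ :=
    fun _ _ _ _ _ h => h.trans (le_of_eq (by ring))
  have hup' : ∀ {r : ℝ} (n₁ n₂ n₃ n₄ n₅ : ℤ),
      r ≤ 81 ^ t * ((B * 2 ^ 200 : ℝ) * symKer δ n₁ n₂ n₃ n₄ n₅) →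
      r ≤ 2 * (81 ^ t * (B * 2 ^ 200)) * symKer δ n₁ n₂ n₃ n₄ n₅ :=
    fun n₁ n₂ n₃ n₄ n₅ h => hup _ _ _ _ _ (h.trans (by
      have := mul_nonneg hT (mul_nonneg hA (symKer_nonneg δ n₁ n₂ n₃ n₄ n₅))
      linarith))
  have hhalf := fun n₁ n₂ n₃ n₄ n₅ =>
    weighted_absKerDiv_half_le (n₁ := n₁) (n₂ := n₂) (n₃ := n₃) (n₄ := n₄) (n₅ := n₅) ht hA
      (hmain n₁ n₂ n₃ n₄ n₅).1
  have hder := fun n₁ n₂ n₃ n₄ n₅ x hx =>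
    weighted_absKerDiv_deriv_le (x := x) (n₁ := n₁) (n₂ := n₂) (n₃ := n₃) (n₄ := n₄) (n₅ := n₅)
      ht hA hx (hmain n₁ n₂ n₃ n₄ n₅).2
  rw [hs] at hhalf hder
  have hone : ∀ n₁ n₂ n₃ n₄ n₅ k : ℤ, mainPart i M (n₁ + n₂ + n₃ + n₄ + n₅) n₁ n₂ n₃ n₄ n₅ = 0 ∨
      |k| ^ 2 ≤ |Phi (n₁ + n₂ + n₃ + n₄ + n₅) n₁ n₃ n₅| →
      jb (n₁ + n₂ + n₃ + n₄ + n₅) ^ s * (jb n₁ ^ (-s) * jb n₂ ^ (-s) * jb n₃ ^ (-s) *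
      jb n₄ ^ (-s) * jb n₅ ^ (-s)) * (jb k *
      absKerDiv (mainPart i M) 1 (n₁ + n₂ + n₃ + n₄ + n₅) n₁ n₂ n₃ n₄ n₅) ≤
      2 * (81 ^ t * ((B * 2 ^ 200 : ℝ) * symKer δ n₁ n₂ n₃ n₄ n₅)) := by
    intro n₁ n₂ n₃ n₄ n₅ k hk
    have p1 := jb_pos n₁; have p2 := jb_pos n₂; have p3 := jb_pos n₃
    have p4 := jb_pos n₄; have p5 := jb_pos n₅; have p0 := jb_pos (n₁ + n₂ + n₃ + n₄ + n₅)
    refine (mul_le_mul_of_nonneg_left (absKerDiv_one_mul_le hk) (by positivity)).trans ?_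
    refine le_trans (le_of_eq ?_) (mul_le_mul_of_nonneg_left (hhalf n₁ n₂ n₃ n₄ n₅)
      (by norm_num : (0 : ℝ) ≤ 2))
    ring
  refine ⟨hC s s s s s s _ (fun n₁ n₂ n₃ n₄ n₅ => hup' _ _ _ _ _ (hhalf n₁ n₂ n₃ n₄ n₅)) .., ?_, ?_⟩
  · have h2 := hC s s (s - 1) s s s _ (fun n₁ n₂ n₃ n₄ n₅ => hup _ _ _ _ _ (le_trans (le_of_eq (by
      rw [jb_rpow_neg_sub_one]; ring)) (hone n₁ n₂ n₃ n₄ n₅ n₂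
        ((mainPart_eq_zero_or i M _ _ _ _ _ _).imp id And.left)))) ω₁ W₂ ω₃ W₄ ω₅
    have h4 := hC s s s s (s - 1) s _ (fun n₁ n₂ n₃ n₄ n₅ => hup _ _ _ _ _ (le_trans (le_of_eq (by
      rw [jb_rpow_neg_sub_one]; ring)) (hone n₁ n₂ n₃ n₄ n₅ n₄
        ((mainPart_eq_zero_or i M _ _ _ _ _ _).imp id And.right)))) ω₁ W₂ ω₃ W₄ ω₅
    rcases min_choice (nrm (s - 1) W₂ * nrm s W₄) (nrm s W₂ * nrm (s - 1) W₄) with h | h <;> rw [h]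
    · exact h2.trans (le_of_eq (by ring))
    · exact h4.trans (le_of_eq (by ring))
  -- Any of the three inputs may carry the lost derivative, because `Main₃` contains the maximum of
  -- their brackets.
  · have h1 := hC (s - 1) (s - 1) s s s s _ (fun n₁ n₂ n₃ n₄ n₅ => hup' _ _ _ _ _ (le_trans (le_of_eq (by
      rw [jb_rpow_neg_sub_one]; ring)) (hder n₁ n₂ n₃ n₄ n₅ (jb n₁)
        ((le_max_left _ _).trans (le_max_left _ _))))) ω₁ W₂ ω₃ W₄ ω₅
    have h3 := hC (s - 1) s s (s - 1) s s _ (fun n₁ n₂ n₃ n₄ n₅ => hup' _ _ _ _ _ (le_trans (le_of_eq (by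
      rw [jb_rpow_neg_sub_one]; ring)) (hder n₁ n₂ n₃ n₄ n₅ (jb n₃)
        ((le_max_right _ _).trans (le_max_left _ _))))) ω₁ W₂ ω₃ W₄ ω₅
    have h5 := hC (s - 1) s s s s (s - 1) _ (fun n₁ n₂ n₃ n₄ n₅ => hup' _ _ _ _ _ (le_trans (le_of_eq (by
      rw [jb_rpow_neg_sub_one]; ring)) (hder n₁ n₂ n₃ n₄ n₅ (jb n₅) (le_max_right _ _))))
      ω₁ W₂ ω₃ W₄ ω₅
    rcases min_choice (min (nrm (s - 1) ω₁ * nrm s ω₃ * nrm s ω₅)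
      (nrm s ω₁ * nrm (s - 1) ω₃ * nrm s ω₅)) (nrm s ω₁ * nrm s ω₃ * nrm (s - 1) ω₅) with h | h <;>
      rw [h]
    · rcases min_choice (nrm (s - 1) ω₁ * nrm s ω₃ * nrm s ω₅)
        (nrm s ω₁ * nrm (s - 1) ω₃ * nrm s ω₅) with h' | h' <;> rw [h']
      · exact h1.trans (le_of_eq (by ring))
      · exact h3.trans (le_of_eq (by ring))
    · exact h5.trans (le_of_eq (by ring))

-- `Low` spends the derivative on the larger of n₂ and n₄. Splitting the kernel according to which
-- one it is produces the two terms of the bound.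
open Classical in
theorem exists_wnorm_harmlessPart_le {δ t : ℝ} (hδ : 0 < δ) (hδ1 : δ ≤ 1 / 4) (ht : 0 ≤ t)
    (B : ℝ≥0) {s : ℝ} (hs : 1 / 2 + 2 * δ + t = s) :
    ∃ C : ℝ≥0, ∀ (i : Fin 7) (M : Multiplier ℂ), SizeBound B i M →
      ∀ ω₁ W₂ ω₃ W₄ ω₅ : ℤ → ℝ≥0,
      wnorm s (Q (absKer (harmlessPart i M)) ω₁ W₂ ω₃ W₄ ω₅) ≤
        C * (nrm s ω₁ * nrm s ω₃ * nrm s ω₅ *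
          (nrm (s + 1) W₂ * nrm s W₄ + nrm s W₂ * nrm (s + 1) W₄)) := by
  have hA : (0 : ℝ) ≤ B * 2 ^ 200 := by positivity
  obtain ⟨C, hC⟩ := exists_wnorm_Q_le hδ (A := 81 ^ t * (B * 2 ^ 200)) (by positivity)
  refine ⟨2 * C, fun i M hM ω₁ W₂ ω₃ W₄ ω₅ => ?_⟩
  have hlow := low_of_harmlessPart hδ hδ1 B.2 hM
  have hw := fun n₁ n₂ n₃ n₄ n₅ x X hX =>
    weighted_norm_low_le (δ := δ) (x := x) (X := X) (n₁ := n₁) (n₂ := n₂) (n₃ := n₃) (n₄ := n₄)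
      (n₅ := n₅) ht hA hX
  rw [hs] at hw
  have hup : ∀ {r : ℝ} (n₁ n₂ n₃ n₄ n₅ : ℤ),
      r ≤ 81 ^ t * ((B * 2 ^ 200 : ℝ) * symKer δ n₁ n₂ n₃ n₄ n₅) →
      r ≤ 81 ^ t * (B * 2 ^ 200) * symKer δ n₁ n₂ n₃ n₄ n₅ :=
    fun _ _ _ _ _ h => h.trans (le_of_eq (by ring))
  have h2 := hC s s (s + 1) s s s
    (fun n n₁ n₂ n₃ n₄ n₅ => if jb n₄ ≤ jb n₂ then
      absKer (harmlessPart i M) n n₁ n₂ n₃ n₄ n₅ else 0)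
    (fun n₁ n₂ n₃ n₄ n₅ => hup _ _ _ _ _ (le_trans (le_of_eq (by rw [jb_rpow_neg_add_one]; ring))
      (hw n₁ n₂ n₃ n₄ n₅ (jb n₂) (if jb n₄ ≤ jb n₂ then
        absKer (harmlessPart i M) (n₁ + n₂ + n₃ + n₄ + n₅) n₁ n₂ n₃ n₄ n₅ else 0) (by
        split_ifs with h
        · exact .inr ⟨(max_eq_left h).symm, hlow ..⟩
        · exact .inl rfl)))) ω₁ W₂ ω₃ W₄ ω₅
  have h4 := hC s s s s (s + 1) s
    (fun n n₁ n₂ n₃ n₄ n₅ => if jb n₄ ≤ jb n₂ then 0 else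
      absKer (harmlessPart i M) n n₁ n₂ n₃ n₄ n₅)
    (fun n₁ n₂ n₃ n₄ n₅ => hup _ _ _ _ _ (le_trans (le_of_eq (by rw [jb_rpow_neg_add_one]; ring))
      (hw n₁ n₂ n₃ n₄ n₅ (jb n₄) (if jb n₄ ≤ jb n₂ then 0 else
        absKer (harmlessPart i M) (n₁ + n₂ + n₃ + n₄ + n₅) n₁ n₂ n₃ n₄ n₅) (by
        split_ifs with h
        · exact .inl rfl
        · exact .inr ⟨(max_eq_right (le_of_not_ge h)).symm, hlow ..⟩)))) ω₁ W₂ ω₃ W₄ ω₅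
  refine (wnorm_Q_add_le s _ _ _ (fun n n₁ n₂ n₃ n₄ n₅ => ?_) ω₁ W₂ ω₃ W₄ ω₅).trans
    ((mul_le_mul_right (add_le_add h2 h4) 2).trans (le_of_eq ?_))
  · split_ifs <;> simp
  · push_cast; ring

end

end MBO

theorem proposition3p1 (s : ℝ) (hs : 1 / 2 < s) :
    ∃ δ : ℝ, 0 < δ ∧ ∀ c : Fin 7 → ℂ, ∃ C : ℝ≥0, ∀ ω₁ W₂ ω₃ W₄ ω₅ : ℤ → ℝ≥0,
      (∀ i : Fin 7,
        MBO.wnorm s (MBO.Q (MBO.absKer (MBO.mHatHat c i)) ω₁ W₂ ω₃ W₄ ω₅) ≤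
          C * (MBO.nrm s ω₁ * MBO.nrm s ω₃ * MBO.nrm s ω₅ *
            (MBO.nrm (s + 1) W₂ * MBO.nrm s W₄ + MBO.nrm s W₂ * MBO.nrm (s + 1) W₄))) ∧
      (∀ mh : MBO.Multiplier ℂ, (∃ i : Fin 7, mh = MBO.mHat c i ∨ mh = MBO.mHatStar c i) →
        MBO.wnorm s (MBO.Q (MBO.absKerDiv mh (1 / 2)) ω₁ W₂ ω₃ W₄ ω₅) ≤
          C * (MBO.nrm s ω₁ * MBO.nrm s W₂ * MBO.nrm s ω₃ * MBO.nrm s W₄ * MBO.nrm s ω₅) ∧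
        MBO.wnorm s (MBO.Q (MBO.absKerDiv mh 1) ω₁ W₂ ω₃ W₄ ω₅) ≤
          C * (MBO.nrm s ω₁ * MBO.nrm s ω₃ * MBO.nrm s ω₅ *
            min (MBO.nrm (s - 1) W₂ * MBO.nrm s W₄) (MBO.nrm s W₂ * MBO.nrm (s - 1) W₄)) ∧
        MBO.wnorm (s - 1) (MBO.Q (MBO.absKerDiv mh (1 - δ)) ω₁ W₂ ω₃ W₄ ω₅) ≤
          C * (min (min (MBO.nrm (s - 1) ω₁ * MBO.nrm s ω₃ * MBO.nrm s ω₅)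
                (MBO.nrm s ω₁ * MBO.nrm (s - 1) ω₃ * MBO.nrm s ω₅))
                (MBO.nrm s ω₁ * MBO.nrm s ω₃ * MBO.nrm (s - 1) ω₅) *
            (MBO.nrm s W₂ * MBO.nrm s W₄))) := by
  -- This δ makes 1/2 + 2δ = min(s, 1), so that 0 < δ ≤ 1/4, and the shift t = s − min(s, 1) ≥ 0
  -- supplies the remaining regularity.
  have hδ : 0 < (min s 1 - 1 / 2) / 2 := by
    have : 1 / 2 < min s 1 := lt_min hs (by norm_num)
    linarith
  have hδ1 : (min s 1 - 1 / 2) / 2 ≤ 1 / 4 := by linarith [min_le_right s 1]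
  have ht : 0 ≤ s - min s 1 := by linarith [min_le_left s 1]
  have hst : 1 / 2 + 2 * ((min s 1 - 1 / 2) / 2) + (s - min s 1) = s := by ring
  refine ⟨(min s 1 - 1 / 2) / 2, hδ, fun c => ?_⟩
  have hB : 0 ≤ 3 * ∑ j, ‖c j‖ := by positivity
  obtain ⟨C, hC⟩ := MBO.exists_wnorm_mainPart_le hδ hδ1 ht ⟨_, hB⟩ hst
  obtain ⟨C', hC'⟩ := MBO.exists_wnorm_harmlessPart_le hδ hδ1 ht ⟨_, hB⟩ hst
  have hle : (C : ℝ≥0∞) ≤ ((max C C' : ℝ≥0) : ℝ≥0∞) := by exact_mod_cast le_max_left _ _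
  have hle' : (C' : ℝ≥0∞) ≤ ((max C C' : ℝ≥0) : ℝ≥0∞) := by exact_mod_cast le_max_right _ _
  refine ⟨max C C', fun ω₁ W₂ ω₃ W₄ ω₅ => ⟨fun i => ?_, ?_⟩⟩
  · exact (hC' i _ (MBO.sizeBound_m c i) ω₁ W₂ ω₃ W₄ ω₅).trans (mul_le_mul_left hle' _)
  · have key : ∀ (i : Fin 7) (M : MBO.Multiplier ℂ), MBO.SizeBound (3 * ∑ j, ‖c j‖) i M → _ :=
      fun i M hM => hC i M hM ω₁ W₂ ω₃ W₄ ω₅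
    rintro mh ⟨i, rfl | rfl⟩
    · obtain ⟨h1, h2, h3⟩ := key i _ (MBO.sizeBound_m c i)
      exact ⟨h1.trans (mul_le_mul_left hle _), h2.trans (mul_le_mul_left hle _),
        h3.trans (mul_le_mul_left hle _)⟩
    · obtain ⟨h1, h2, h3⟩ := key i _ (MBO.sizeBound_mStar c i)
      exact ⟨h1.trans (mul_le_mul_left hle _), h2.trans (mul_le_mul_left hle _),
        h3.trans (mul_le_mul_left hle _)⟩
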